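/- Let $d\in\{1,2,3\}$, let $M$ be the number of source particles, and let $g\in\mathbb{R}$. Let $v\in\mathscr{S}'(\mathbb{R}^d)$ with $v\notin L^2(\mathbb{R}^d)$ have as Fourier transform a measurable function $\hat v$ with $|\hat v(k)|\le |k|^{-\alpha}$ for $k\neq 0$, and let $\omega:\mathbb{R}^d\to\mathbb{R}_+$ be measurable with $\omega(k)\ge(1+k^2)^{\beta/2}$, where $0\le\alpha<\frac d2$ and $0\le\beta\le 2$. Assume that either (1) $\alpha>\frac d2-1$, or (2) $\int\frac{|\hat v(k)|^2}{k^2+\omega(k)}\,\mathrm{d}k=\infty$ and, if $d=2$, $\alpha=0$ and $\beta>0$, while, if $d=3$, $\alpha>\frac12-\frac{\beta^2}{8+\beta^2}$. Put $D=d-2\alpha-2$ and assume $D\ge 0$ (so that (2) holds). Put $u(s)=\frac\beta2 s-\frac D2$. Let $\mathscr{H}=\bigoplus_{n\ge0}\mathscr{H}^{(n)}$, $\mathscr{H}^{(n)}=L^2(\mathbb{R}^{dM})\otimes L^2_{\mathrm{sym}}(\mathbb{R}^{dn})$, described in Fourier representation by functions of $P=(p_1,\dots,p_M)$ and $K=(k_1,\dots,k_n)$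 that are symmetric in $k_1,\dots,k_n$. Let $N$ be the boson number operator ($N=n$ on $\mathscr{H}^{(n)}$) and let $L$ be the operator of multiplication by $L(P,K)=P^2+\sum_{j=1}^n\omega(k_j)$; functions of $N$ and $L$ have their maximal domains as multiplication operators. Let $e_\ell$ be the inclusion of the $\ell$-th summand of $\mathbb{R}^{dM}=\bigoplus_{\ell=1}^M\mathbb{R}^d$. For $\phi\in\mathscr{H}^{(n)}$, $K=(k_1,\dots,k_{n+1})$ and $\hat K_j$ the tuple $K$ without its $j$-th entry, define $T=T_{\mathrm d}+T_{\mathrm{od}}$ by $$T_{\mathrm d}\phi(P,\hat K_{n+1})=-g^2\,\phi(P,\hat K_{n+1})\sum_{\ell=1}^M\int_{\mathbb{R}^d}|\hat v(k_{n+1})|^2\Big(\frac1{L(P-e_\ell k_{n+1},K)}-\frac1{k_{n+1}^2+\omega(k_{n+1})}\Big)\mathrm{d}k_{n+1},$$ $$T_{\mathrm{od}}\phi(P,\hat K_{n+1})=-g^2\sum_{\ell=1}^M\sum_{i\ne\ell}\int_{\mathbb{R}^d}\frac{|\hat v(k_{n+1})|^2\,\phi(P-(e_\ell-e_i)k_{n+1},\hat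 K_{n+1})}{L(P-e_\ell k_{n+1},K)}\,\mathrm{d}k_{n+1}$$ $$\qquad-g^2\sum_{\ell=1}^M\sum_{i=1}^M\sum_{j=1}^n\int_{\mathbb{R}^d}\frac{\overline{\hat v(k_{n+1})}\,\hat v(k_j)\,\phi(P-e_\ell k_{n+1}+e_ik_j,\hat K_j)}{L(P-e_\ell k_{n+1},K)}\,\mathrm{d}k_{n+1}.$$ Then the following holds. (a) If $D=0$ and $\beta=2$, then for every $\varepsilon>0$, $T$ defines a symmetric operator on the domain $D(T)=D(L^\varepsilon)$. (b) If $D>0$ or $\beta<2$, then for every $s>0$ with $u(s)<1$ and $u(u(s))>0$, $T$ defines a symmetric operator on the domain $D(T)=D\big((N+1)^{\max(0,1-s)}L^{s-u(s)}\big)$. Here "$T$ defines a symmetric operator on $D(T)$" means: $D(T)$ is dense in $\mathscr{H}$; for each $\phi\in D(T)$ the integrals above converge absolutely for almost every configuration in every sector and together define a vector $T\phi\in\mathscr{H}$; $T$ is linear; and $\langle T\phi,\psi\rangle=\langle\phi,T\psi\rangle$ for all $\phi,\psi\in D(T)$. -/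

import Mathlib

open MeasureTheory
open scoped SchwartzMap

noncomputable section

namespace IBC

/-- One-particle (momentum) space `ℝ^d` with the Euclidean norm. -/
abbrev E (d : ℕ) : Type := EuclideanSpace ℝ (Fin d)

/-- Momentum configurations `(P, K)` of `M` source particles and `n` bosons, carrying Lebesgue
measure. -/
abbrev Config (d M n : ℕ) : Type := (Fin M → E d) × (Fin n → E d)

/-- Relabelling the bosons. -/
def permBosons {d M n : ℕ} (σ : Equiv.Perm (Fin n)) (x : Config d M n) : Config d M n :=
  (x.1, fun j => x.2 (σ j))

theorem measurePreserving_permBosons {d M n : ℕ} (σ : Equiv.Perm (Fin n)) :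
    MeasurePreserving (permBosons (d := d) (M := M) σ) volume volume := by
  have h := volume_preserving_arrowCongr' σ.symm (MeasurableEquiv.refl (E d))
    (MeasurePreserving.id _)
  exact (MeasurePreserving.id (volume : Measure (Fin M → E d))).prod h

/-- The `n`-boson sector `L²(ℝ^{dM}) ⊗ L²_sym(ℝ^{dn})` in Fourier representation: square-integrable
functions of `(P, K)` that are symmetric in the boson momenta. -/
def sector (d M n : ℕ) : Submodule ℂ (Lp ℂ 2 (volume : Measure (Config d M n))) where
  carrier := {f | ∀ σ : Equiv.Perm (Fin n), ∀ᵐ x, f (permBosons σ x) = f x}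
  add_mem' := by
    intro f h hf hh σ
    have hadd := Lp.coeFn_add f h
    filter_upwards [hf σ, hh σ, hadd,
      (measurePreserving_permBosons σ).quasiMeasurePreserving.ae hadd] with x h1 h2 h3 h4
    rw [h3, h4, Pi.add_apply, Pi.add_apply, h1, h2]
  zero_mem' := by
    intro σ
    have h0 := Lp.coeFn_zero ℂ 2 (volume : Measure (Config d M n))
    filter_upwards [h0, (measurePreserving_permBosons σ).quasiMeasurePreserving.ae h0] with x h1 h2
    rw [h1, h2, Pi.zero_apply, Pi.zero_apply]
  smul_mem' := by
    intro c f hf σ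
    have hs := Lp.coeFn_smul c f
    filter_upwards [hf σ, hs,
      (measurePreserving_permBosons σ).quasiMeasurePreserving.ae hs] with x h1 h2 h3
    rw [h2, h3, Pi.smul_apply, Pi.smul_apply, h1]

/-- The Hilbert space `⨁ₙ L²(ℝ^{dM}) ⊗ L²_sym(ℝ^{dn})` (Fourier representation). -/
abbrev Fock (d M : ℕ) : Type := lp (fun n : ℕ => sector d M n) 2

/-- The `n`-boson component of a vector, as a function of `(P, K)`. -/
def component {d M : ℕ} (ψ : Fock d M) (n : ℕ) : Config d M n → ℂ :=
  ((ψ n : sector d M n) : Lp ℂ 2 (volume : Measure (Config d M n)))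

/-- The Fourier multiplier `L(P, K) = P² + ∑ⱼ ω(kⱼ)` of the free operator. -/
def freeSymbol {d M n : ℕ} (ω : E d → ℝ) (x : Config d M n) : ℝ :=
  (∑ i, ‖x.1 i‖ ^ 2) + ∑ j, ω (x.2 j)

/-- The (maximal) domain of the operator of multiplication by `m n (P, K)` in the `n`-boson sector:
those `ψ` for which the product is again a vector of the Hilbert space. -/
def multiplierDomain {d M : ℕ} (m : ∀ n : ℕ, Config d M n → ℝ) : Submodule ℂ (Fock d M) where
  carrier := {ψ | ∃ η : Fock d M, ∀ n, ∀ᵐ x, component η n x = (m n x : ℂ) * component ψ n x}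
  add_mem' := by
    rintro a b ⟨α, hα⟩ ⟨β, hβ⟩
    refine ⟨α + β, fun n => ?_⟩
    have h1 : component (α + β) n =ᵐ[volume] component α n + component β n := Lp.coeFn_add _ _
    have h2 : component (a + b) n =ᵐ[volume] component a n + component b n := Lp.coeFn_add _ _
    filter_upwards [hα n, hβ n, h1, h2] with x e1 e2 e3 e4
    rw [e3, e4, Pi.add_apply, Pi.add_apply, e1, e2, mul_add]
  zero_mem' := by
    refine ⟨0, fun n => ?_⟩
    have h0 : component (0 : Fock d M) n =ᵐ[volume] 0 := Lp.coeFn_zero _ _ _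
    filter_upwards [h0] with x e
    rw [e, Pi.zero_apply, mul_zero]
  smul_mem' := by
    rintro c a ⟨α, hα⟩
    refine ⟨c • α, fun n => ?_⟩
    have h1 : component (c • α) n =ᵐ[volume] c • component α n := Lp.coeFn_smul _ _
    have h2 : component (c • a) n =ᵐ[volume] c • component a n := Lp.coeFn_smul _ _
    filter_upwards [hα n, h1, h2] with x e1 e2 e3
    rw [e2, e3, Pi.smul_apply, Pi.smul_apply, e1, smul_eq_mul, smul_eq_mul, mul_left_comm]

/-- `D(L^ε)`. -/
def domainL (d M : ℕ) (ω : E d → ℝ) (ε : ℝ) : Submodule ℂ (Fock d M) :=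
  multiplierDomain fun _ x => freeSymbol ω x ^ ε

/-- `D((N+1)^a L^b)`, with `N` the boson number. -/
def domainNL (d M : ℕ) (ω : E d → ℝ) (a b : ℝ) : Submodule ℂ (Fock d M) :=
  multiplierDomain fun n x => ((n : ℝ) + 1) ^ a * freeSymbol ω x ^ b

/-- The tempered distribution `v` has the function `vhat` as its Fourier transform, in the unitary
convention `φ̂(x) = (2π)^{-d/2} ∫ e^{-ik·x} φ(k) dk`: `⟨v, φ̂⟩ = ∫ vhat φ` for Schwartz `φ`. -/
def HasFourierTransform {d : ℕ} (v : 𝓢'(E d, ℂ)) (vhat : E d → ℂ) : Prop :=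
  ∀ φ ψ : 𝓢(E d, ℂ),
    (∀ x, ψ x = (((2 * Real.pi) ^ (-(d : ℝ) / 2) : ℝ) : ℂ) *
      ∫ k, Complex.exp (-Complex.I * ((inner ℝ k x : ℝ) : ℂ)) * φ k) →
    v ψ = ∫ k, vhat k * φ k

/-- The integral `∫ |v̂(k)|² / (k² + ω(k)) dk ∈ [0, ∞]`. -/
def selfEnergy {d : ℕ} (vhat : E d → ℂ) (ω : E d → ℝ) : ENNReal :=
  ∫⁻ k, ENNReal.ofReal (‖vhat k‖ ^ 2 / (‖k‖ ^ 2 + ω k))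

/-- The standing assumptions on the interaction `v` (with Fourier transform `vhat`) and the
dispersion relation `ω`. -/
structure Admissible {d : ℕ} (v : 𝓢'(E d, ℂ)) (vhat : E d → ℂ) (ω : E d → ℝ) (α β : ℝ) :
    Prop where
  measurable_vhat : Measurable vhat
  measurable_omega : Measurable ω
  fourier : HasFourierTransform v vhat
  not_L2 : ¬ ∃ f : Lp ℂ 2 (volume : Measure (E d)), Lp.toTemperedDistribution f = v
  vhat_le : ∀ k, k ≠ 0 → ‖vhat k‖ ≤ ‖k‖ ^ (-α)
  omega_ge : ∀ k, (1 + ‖k‖ ^ 2) ^ (β / 2) ≤ ω k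
  alpha_nonneg : 0 ≤ α
  alpha_lt : α < (d : ℝ) / 2
  beta_nonneg : 0 ≤ β
  beta_le : β ≤ 2
  cases : (d : ℝ) / 2 - 1 < α ∨
    (selfEnergy vhat ω = ⊤ ∧ (d = 2 → α = 0 ∧ 0 < β) ∧
      (d = 3 → 1 / 2 - β ^ 2 / (8 + β ^ 2) < α))

/-- The configuration `(P - e_ℓ q, k₁, …, kₙ, q)` in the `(n+1)`-boson sector. -/
def emit {d M n : ℕ} (ℓ : Fin M) (x : Config d M n) (q : E d) : Config d M (n + 1) :=
  (x.1 - Pi.single ℓ q, Fin.snoc (α := fun _ => E d) x.2 q)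

/-- Integrand (in `q = k_{n+1}`) of the regularised integral `I_ℓ(P, K)`. -/
def diagIntegrand {d M n : ℕ} (vhat : E d → ℂ) (ω : E d → ℝ) (ℓ : Fin M) (x : Config d M n)
    (q : E d) : ℝ :=
  ‖vhat q‖ ^ 2 * (1 / freeSymbol ω (emit ℓ x q) - 1 / (‖q‖ ^ 2 + ω q))

/-- The diagonal part `T_d` on the `n`-boson sector. -/
def Tdiag {d M n : ℕ} (g : ℝ) (vhat : E d → ℂ) (ω : E d → ℝ) (φ : Config d M n → ℂ)
    (x : Config d M n) : ℂ :=
  -(g : ℂ) ^ 2 * φ x * ∑ ℓ : Fin M, ((∫ q, diagIntegrand vhat ω ℓ x q : ℝ) : ℂ)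

/-- Integrand of the off-diagonal terms in which the same boson is created by source `i` and
annihilated by source `ℓ ≠ i`. -/
def thetaIntegrand {d M n : ℕ} (vhat : E d → ℂ) (ω : E d → ℝ) (ℓ i : Fin M)
    (φ : Config d M n → ℂ) (x : Config d M n) (q : E d) : ℂ :=
  ((‖vhat q‖ ^ 2 : ℝ) : ℂ) * φ (x.1 - (Pi.single ℓ q - Pi.single i q), x.2) /
    ((freeSymbol ω (emit ℓ x q) : ℝ) : ℂ)

/-- Integrand of the off-diagonal terms in which boson `j ≤ n` is created by source `i` and boson
`n + 1` is annihilated by source `ℓ`. -/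
def tauIntegrand {d M n : ℕ} (vhat : E d → ℂ) (ω : E d → ℝ) (ℓ i : Fin M) (j : Fin n)
    (φ : Config d M n → ℂ) (x : Config d M n) (q : E d) : ℂ :=
  (starRingEnd ℂ) (vhat q) * vhat (x.2 j) *
      φ (x.1 - Pi.single ℓ q + Pi.single i (x.2 j),
        Fin.removeNth (α := fun _ => E d) j.castSucc (Fin.snoc (α := fun _ => E d) x.2 q)) /
    ((freeSymbol ω (emit ℓ x q) : ℝ) : ℂ)

/-- The off-diagonal part `T_od` on the `n`-boson sector. -/
def Toffdiag {d M n : ℕ} (g : ℝ) (vhat : E d → ℂ) (ω : E d → ℝ) (φ : Config d M n → ℂ)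
    (x : Config d M n) : ℂ :=
  -(g : ℂ) ^ 2 * (∑ ℓ : Fin M, ∑ i ∈ Finset.univ.filter (fun i : Fin M => i ≠ ℓ),
      (∫ q, thetaIntegrand vhat ω ℓ i φ x q))
    - (g : ℂ) ^ 2 * (∑ ℓ : Fin M, ∑ i : Fin M, ∑ j : Fin n,
      (∫ q, tauIntegrand vhat ω ℓ i j φ x q))

/-- All integrals defining `(T_d φ + T_od φ)(P, K)` converge absolutely. -/
def TConverges {d M n : ℕ} (vhat : E d → ℂ) (ω : E d → ℝ) (φ : Config d M n → ℂ)
    (x : Config d M n) : Prop :=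
  (∀ ℓ : Fin M, Integrable (diagIntegrand vhat ω ℓ x)) ∧
  (∀ ℓ i : Fin M, i ≠ ℓ → Integrable (thetaIntegrand vhat ω ℓ i φ x)) ∧
  (∀ (ℓ i : Fin M) (j : Fin n), Integrable (tauIntegrand vhat ω ℓ i j φ x))

/-- `T = T_d + T_od` defines a symmetric operator with domain `𝒟`: the subspace `𝒟` is dense, and
there is a linear operator with domain `𝒟` and values in the Hilbert space that is given in every
sector, almost everywhere, by the (absolutely convergent) expressions for `T`, and that satisfies
`⟨Tφ, ψ⟩ = ⟨φ, Tψ⟩` on `𝒟`. -/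
def TSymmetricOn {d M : ℕ} (g : ℝ) (vhat : E d → ℂ) (ω : E d → ℝ)
    (𝒟 : Submodule ℂ (Fock d M)) : Prop :=
  Dense (𝒟 : Set (Fock d M)) ∧
  ∃ T : Fock d M →ₗ.[ℂ] Fock d M, T.domain = 𝒟 ∧
    (∀ φ : T.domain, ∀ n, ∀ᵐ x,
      TConverges vhat ω (component (φ : Fock d M) n) x ∧
      component (T φ) n x = Tdiag g vhat ω (component (φ : Fock d M) n) x +
        Toffdiag g vhat ω (component (φ : Fock d M) n) x) ∧
    ∀ φ ψ : T.domain, inner ℂ (T φ) (ψ : Fock d M) = inner ℂ (φ : Fock d M) (T ψ)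

end IBC

end

noncomputable section

namespace IBC

/-! In each boson sector `T` is a real multiplication operator plus a finite sum of terms `φ ↦ ∫
κ_t(x, q) φ(S_t(x, q).1) dq`. Each `S_t` is a measure-preserving bijection of configurations with
one extra momentum `q`, and exchanging the two sources in `t` inverts it. The denominator is the
free energy of the intermediate configuration with `n + 1` bosons, which is the same for a term and
its inverse, so the kernel is Hermitian. Symmetry is then Fubini plus a change of variables
(`integral_kernelOp_symm`), and what remains is to dominate both parts of `T` by the multiplier that
defines the domain.

Off the diagonal the tool is an asymmetric Schur test (`lintegral_kernelMass_sq_le`). The kernel is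
split as `F * G`, with the integral of `F²` bounded uniformly and that of `G²`, after the change of
variables, bounded by a weight `w²`; this gives `‖T_od φ‖ ≤ C ‖w φ‖` with `w = (N+1)^{max(0,1-s)}
(1+L)^{s-u(s)}`. Every integral involved reduces by scaling to `∫ |v̂|² ω^{-σ} / (|q-p|² + W) dq ≤ C
W^{-u(σ)}`, possibly with an extra power of `|q-p|`. Without that power it is used when `0 < u(σ) <
1`. The values `σ = s` and `σ = u(s)` both occur, which explains the conditions `u(s) < 1` and
`u(u(s)) > 0`. The splitting weights are the core of the argument: `exists_theta_bound` treats a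
boson passed between two sources and uses `D < 1`, while `exists_tau_bound` treats the exchange of
two bosons and sums over the bosons at a price of at most `n^{max(0,1-s)}`.

On the diagonal the difference of the two inverses has a numerator only linear in `q`. This supplies
the missing decay and yields a bound by `(1+L)^e` for any `e` with `0 < e < 1/2` and `D/2 ≤ e`
(`exists_diag_bound`).

Finally `L ≥ n` lets the weights in `1 + L` be replaced by the graph norm of the stated multiplier.
For `D = 0`, `β = 2` the map `u` is the identity, so only `(N+1)^{1-s} ≤ (1+L)^{1-s}` is left, with
`1 - s ≤ ε` at choice. -/

/-! ### Integrals of power profiles with one or two centres -/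

theorem nontrivial_E {d : ℕ} (hd : 0 < d) : Nontrivial (E d) :=
  Module.nontrivial_of_finrank_pos (R := ℝ) (by simpa using hd)

/-- The radial profile `|q|^{-a} (|q|² + W)^{-c}` is integrable when `a < d < a + 2c`. -/
theorem integrable_radial_kernel {d : ℕ} (hd : 0 < d) {a c W : ℝ} (hc : 0 < c) (hW : 0 < W)
    (had : a < d) (hdc : (d : ℝ) < a + 2 * c) :
    Integrable (fun q : E d => ‖q‖ ^ (-a) * (‖q‖ ^ 2 + W) ^ (-c)) := by
  have := nontrivial_E hd
  refine (integrable_fun_norm_addHaar (volume : Measure (E d))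
    (f := fun y : ℝ => y ^ (-a) * (y ^ 2 + W) ^ (-c))).2 ?_
  have hfr : Module.finrank ℝ (E d) = d := by simp
  rw [hfr, ← Set.Ioc_union_Ioi_eq_Ioi (zero_le_one' ℝ)]
  have hmeas : Measurable (fun y : ℝ => y ^ (d - 1) • (y ^ (-a) * (y ^ 2 + W) ^ (-c))) := by
    fun_prop
  have hpow : ∀ y : ℝ, 0 < y → y ^ (d - 1) * y ^ (-a) = y ^ ((d : ℝ) - 1 - a) := by
    intro y hy
    rw [← Real.rpow_natCast, ← Real.rpow_add hy, Nat.cast_sub hd]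
    simp [sub_eq_add_neg]
  -- Near the origin `(y² + W)^{-c}` is bounded and `a < d` suffices; at infinity it behaves like
  -- `y^{-2c}` and `d < a + 2c` is what is needed.
  refine IntegrableOn.union ?_ ?_
  · have h1 : IntegrableOn (fun y : ℝ => y ^ ((d : ℝ) - 1 - a)) (Set.Ioc 0 1) := by
      rw [← intervalIntegrable_iff_integrableOn_Ioc_of_le zero_le_one]
      exact intervalIntegral.intervalIntegrable_rpow' (by linarith)
    refine Integrable.mono' (h1.mul_const (W ^ (-c))) hmeas.aestronglyMeasurable ?_
    filter_upwards [ae_restrict_mem measurableSet_Ioc] with y hy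
    have hy0 : 0 < y := hy.1
    have hp : 0 < y ^ 2 + W := by positivity
    rw [smul_eq_mul, ← mul_assoc, hpow y hy0, Real.norm_of_nonneg (by positivity)]
    gcongr ?_ * ?_
    exact Real.rpow_le_rpow_of_nonpos hW (by nlinarith) (by linarith)
  · have h1 : IntegrableOn (fun y : ℝ => y ^ ((d : ℝ) - 1 - a - 2 * c)) (Set.Ioi 1) :=
      integrableOn_Ioi_rpow_of_lt (by linarith) one_pos
    refine Integrable.mono' h1 hmeas.aestronglyMeasurable ?_
    filter_upwards [ae_restrict_mem measurableSet_Ioi] with y hy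
    have hy0 : 0 < y := lt_trans one_pos hy
    have hp : 0 < y ^ 2 + W := by positivity
    rw [smul_eq_mul, ← mul_assoc, hpow y hy0, Real.norm_of_nonneg (by positivity),
      sub_eq_add_neg ((d : ℝ) - 1 - a), Real.rpow_add hy0]
    gcongr ?_ * ?_
    have : y ^ (-(2 * c)) = (y ^ 2) ^ (-c) := by
      rw [← Real.rpow_natCast, ← Real.rpow_mul hy0.le]; congr 1; push_cast; ring
    rw [this]
    exact Real.rpow_le_rpow_of_nonpos (by positivity) (by linarith) (by linarith)

/-- Substituting `q = √W y` extracts the whole dependence on `W`; no integrability is needed for the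
scaling identity. -/
theorem integral_radial_kernel {d : ℕ} {a c W : ℝ} (hW : 0 < W) :
    ∫ q : E d, ‖q‖ ^ (-a) * (‖q‖ ^ 2 + W) ^ (-c) =
      W ^ (((d : ℝ) - a) / 2 - c) * ∫ q : E d, ‖q‖ ^ (-a) * (‖q‖ ^ 2 + 1) ^ (-c) := by
  have h := Measure.integral_comp_smul (volume : Measure (E d))
    (fun q : E d => ‖q‖ ^ (-a) * (‖q‖ ^ 2 + W) ^ (-c)) (Real.sqrt W)
  have hs : 0 < Real.sqrt W := Real.sqrt_pos.2 hW
  have hsw : Real.sqrt W ^ (-a) = W ^ (-a / 2) := by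
    rw [Real.sqrt_eq_rpow, ← Real.rpow_mul hW.le]; congr 1; ring
  have h2 : ∀ y : E d, ‖Real.sqrt W • y‖ ^ (-a) * (‖Real.sqrt W • y‖ ^ 2 + W) ^ (-c) =
      W ^ (-a / 2 - c) * (‖y‖ ^ (-a) * (‖y‖ ^ 2 + 1) ^ (-c)) := by
    intro y
    rw [norm_smul, Real.norm_of_nonneg hs.le, Real.mul_rpow hs.le (norm_nonneg _), mul_pow,
      Real.sq_sqrt hW.le, show W * ‖y‖ ^ 2 + W = W * (‖y‖ ^ 2 + 1) by ring,
      Real.mul_rpow hW.le (by positivity), hsw, sub_eq_add_neg (-a / 2), Real.rpow_add hW]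
    ring
  simp only [h2] at h
  rw [integral_const_mul] at h
  have hfr : Module.finrank ℝ (E d) = d := by simp
  have h3 : |(Real.sqrt W ^ Module.finrank ℝ (E d))⁻¹| = W ^ (-(d : ℝ) / 2) := by
    rw [hfr, abs_of_nonneg (by positivity), Real.sqrt_eq_rpow, ← Real.rpow_natCast,
      ← Real.rpow_mul hW.le, ← Real.rpow_neg hW.le]
    congr 1; ring
  rw [h3, smul_eq_mul] at h
  have h4 : W ^ (((d : ℝ) - a) / 2 - c) = W ^ ((d : ℝ) / 2) * W ^ (-a / 2 - c) := by
    rw [← Real.rpow_add hW]; congr 1; ring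
  rw [h4, mul_assoc, h, ← mul_assoc, ← Real.rpow_add hW]
  rw [show (d : ℝ) / 2 + -(d : ℝ) / 2 = 0 by ring, Real.rpow_zero, one_mul]

/-- All exponents are nonpositive, so replacing both distances by the smaller one only increases the
product. This separates the two singularities. -/
theorem two_center_le {x y a b c W : ℝ} (hx : 0 < x) (hy : 0 < y) (ha : 0 ≤ a) (hb : 0 ≤ b)
    (hc : 0 ≤ c) (hW : 0 < W) :
    x ^ (-a) * y ^ (-b) * (y ^ 2 + W) ^ (-c) ≤
      x ^ (-(a + b)) * (x ^ 2 + W) ^ (-c) + y ^ (-(a + b)) * (y ^ 2 + W) ^ (-c) := by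
  have h0 : ∀ t : ℝ, 0 < t → t ^ (-(a + b)) = t ^ (-a) * t ^ (-b) := fun t ht => by
    rw [← Real.rpow_add ht]; congr 1; ring
  rw [h0 x hx, h0 y hy]
  rcases le_total x y with h | h
  · have h1 : y ^ (-b) ≤ x ^ (-b) := Real.rpow_le_rpow_of_nonpos hx h (by linarith)
    have h2 : (y ^ 2 + W) ^ (-c) ≤ (x ^ 2 + W) ^ (-c) :=
      Real.rpow_le_rpow_of_nonpos (by positivity) (by gcongr) (by linarith)
    have : 0 ≤ y ^ (-a) * y ^ (-b) * (y ^ 2 + W) ^ (-c) := by positivity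
    have h3 : x ^ (-a) * y ^ (-b) * (y ^ 2 + W) ^ (-c) ≤
      x ^ (-a) * x ^ (-b) * (x ^ 2 + W) ^ (-c) := by gcongr
    linarith
  · have h1 : x ^ (-a) ≤ y ^ (-a) := Real.rpow_le_rpow_of_nonpos hy h (by linarith)
    have : 0 ≤ x ^ (-a) * x ^ (-b) * (x ^ 2 + W) ^ (-c) := by positivity
    have h3 : x ^ (-a) * y ^ (-b) * (y ^ 2 + W) ^ (-c) ≤
      y ^ (-a) * y ^ (-b) * (y ^ 2 + W) ^ (-c) := by gcongr
    linarith

theorem ae_ne_point {d : ℕ} (hd : 0 < d) (x : E d) : ∀ᵐ q : E d, q ≠ x := by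
  have := nontrivial_E hd
  exact Measure.ae_ne volume x

/-- Bound, uniform in the second centre, for an integral with two singularities. -/
theorem exists_two_center_bound {d : ℕ} (hd : 0 < d) {a b c : ℝ} (ha : 0 ≤ a) (hb : 0 ≤ b)
    (hc : 0 < c) (hab : a + b < d) (habc : (d : ℝ) < a + b + 2 * c) :
    ∃ C : ℝ, 0 ≤ C ∧ ∀ (x : E d) (W : ℝ), 0 < W →
      ∫⁻ q : E d, ENNReal.ofReal (‖q‖ ^ (-a) * ‖q - x‖ ^ (-b) * (‖q - x‖ ^ 2 + W) ^ (-c)) ≤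
        ENNReal.ofReal (C * W ^ (((d : ℝ) - (a + b)) / 2 - c)) := by
  -- Each centre contributes one copy of the same radial integral, by translation invariance; hence
  -- the factor 2 and the uniformity in `x`.
  refine ⟨2 * ∫ q : E d, ‖q‖ ^ (-(a + b)) * (‖q‖ ^ 2 + 1) ^ (-c), ?_, fun x W hW => ?_⟩
  · exact mul_nonneg zero_le_two (integral_nonneg fun q => by positivity)
  set G : E d → ℝ := fun q => ‖q‖ ^ (-(a + b)) * (‖q‖ ^ 2 + W) ^ (-c) with hG
  have hG0 : ∀ q, 0 ≤ G q := fun q => by positivity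
  have hGm : Measurable G := by fun_prop
  calc ∫⁻ q : E d, ENNReal.ofReal (‖q‖ ^ (-a) * ‖q - x‖ ^ (-b) * (‖q - x‖ ^ 2 + W) ^ (-c))
      ≤ ∫⁻ q : E d, (ENNReal.ofReal (G q) + ENNReal.ofReal (G (q - x))) := by
        refine lintegral_mono_ae ?_
        filter_upwards [ae_ne_point hd 0, ae_ne_point hd x] with q h1 h2
        rw [← ENNReal.ofReal_add (hG0 _) (hG0 _)]
        exact ENNReal.ofReal_le_ofReal (two_center_le (norm_pos_iff.2 h1)
          (norm_pos_iff.2 (sub_ne_zero.2 h2)) ha hb hc.le hW)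
    _ = 2 * ∫⁻ q : E d, ENNReal.ofReal (G q) := by
        rw [lintegral_add_left hGm.ennreal_ofReal,
          lintegral_sub_right_eq_self (fun q => ENNReal.ofReal (G q)) x, two_mul]
    _ = _ := by
        rw [← ofReal_integral_eq_lintegral_ofReal
          (integrable_radial_kernel hd hc hW hab habc) (Filter.Eventually.of_forall hG0),
          integral_radial_kernel hW, mul_assoc, ENNReal.ofReal_mul zero_le_two,
          ENNReal.ofReal_ofNat, mul_comm (W ^ _)]

set_option linter.unusedSectionVars false

/-! ### Kernel operators along measure-preserving maps: Schur test and symmetry -/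

section KernelOperator

variable {X Q ι : Type*} [MeasurableSpace X] [MeasurableSpace Q] [Fintype ι]

theorem sum_lintegral_mul_sq_le {ν : Measure Q} {f g : ι → Q → ENNReal}
    (hf : ∀ i, Measurable (f i)) (hg : ∀ i, Measurable (g i)) :
    (∑ i, ∫⁻ q, f i q * g i q ∂ν) ^ 2 ≤
      (∑ i, ∫⁻ q, f i q ^ 2 ∂ν) * ∑ i, ∫⁻ q, g i q ^ 2 ∂ν := by
  have h1 : ∀ i, ∫⁻ q, f i q * g i q ∂ν ≤
      (∫⁻ q, f i q ^ 2 ∂ν) ^ (1 / 2 : ℝ) * (∫⁻ q, g i q ^ 2 ∂ν) ^ (1 / 2 : ℝ) := fun i => by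
    have := ENNReal.lintegral_mul_le_Lp_mul_Lq ν Real.HolderConjugate.two_two
      (hf i).aemeasurable (hg i).aemeasurable
    simpa only [Pi.mul_apply, ENNReal.rpow_two] using this
  have hsq : ∀ t : ENNReal, (t ^ (1 / 2 : ℝ)) ^ (2 : ℝ) = t := fun t => by
    rw [← ENNReal.rpow_mul]; norm_num
  have h2 := ENNReal.inner_le_Lp_mul_Lq (Finset.univ : Finset ι)
    (fun i => (∫⁻ q, f i q ^ 2 ∂ν) ^ (1 / 2 : ℝ)) (fun i => (∫⁻ q, g i q ^ 2 ∂ν) ^ (1 / 2 : ℝ))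
    Real.HolderConjugate.two_two
  simp only [hsq] at h2
  have h3 := (Finset.sum_le_sum fun i _ => h1 i).trans h2
  calc (∑ i, ∫⁻ q, f i q * g i q ∂ν) ^ 2
      ≤ ((∑ i, ∫⁻ q, f i q ^ 2 ∂ν) ^ (1 / 2 : ℝ) * (∑ i, ∫⁻ q, g i q ^ 2 ∂ν) ^ (1 / 2 : ℝ)) ^ 2 := by
        gcongr
    _ = _ := by
        rw [mul_pow, ← ENNReal.rpow_two, ← ENNReal.rpow_two, hsq, hsq]

/-- The operator `φ ↦ ∑ᵢ ∫ κᵢ(x, q) φ(Sᵢ(x, q)) dq`, where only the first component of `Sᵢ(x, q)`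
enters `φ`. -/
def kernelOp (ν : Measure Q) (κ : ι → X × Q → ℂ) (S : ι → X × Q → X × Q) (φ : X → ℂ) (x : X) : ℂ :=
  ∑ i, ∫ q, κ i (x, q) * φ (S i (x, q)).1 ∂ν

/-- The absolute version of `kernelOp`. -/
def kernelMass (ν : Measure Q) (κ : ι → X × Q → ℂ) (S : ι → X × Q → X × Q) (φ : X → ℂ) (x : X) :
    ENNReal :=
  ∑ i, ∫⁻ q, ‖κ i (x, q) * φ (S i (x, q)).1‖ₑ ∂ν

variable {μ : Measure X} {ν : Measure Q} [SFinite μ] [SFinite ν]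
  {κ : ι → X × Q → ℂ} {S : ι → X × Q → X × Q}

theorem measurable_kernel_term (hκ : ∀ i, Measurable (κ i)) (hS : ∀ i, Measurable (S i))
    {φ : X → ℂ} (hφ : Measurable φ) (i : ι) :
    Measurable (fun z => κ i z * φ (S i z).1) :=
  (hκ i).mul (hφ.comp (hS i).fst)

theorem measurable_kernelMass (hκ : ∀ i, Measurable (κ i)) (hS : ∀ i, Measurable (S i))
    {φ : X → ℂ} (hφ : Measurable φ) : Measurable (kernelMass ν κ S φ) := by
  refine Finset.measurable_sum _ fun i _ => ?_
  exact (measurable_kernel_term hκ hS hφ i).enorm.lintegral_prod_right'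

theorem measurable_kernelOp (hκ : ∀ i, Measurable (κ i)) (hS : ∀ i, Measurable (S i))
    {φ : X → ℂ} (hφ : Measurable φ) : Measurable (kernelOp ν κ S φ) := by
  refine Finset.measurable_sum _ fun i _ => ?_
  exact ((measurable_kernel_term hκ hS hφ i).stronglyMeasurable.integral_prod_right').measurable

theorem enorm_kernelOp_le (φ : X → ℂ) (x : X) :
    ‖kernelOp ν κ S φ x‖ₑ ≤ kernelMass ν κ S φ x :=
  (enorm_sum_le _ _).trans (Finset.sum_le_sum fun _ _ => enorm_integral_le_lintegral_enorm _)

/-- Weighted Schur test. -/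
theorem lintegral_kernelMass_sq_le (hS : ∀ i, MeasurePreserving (S i) (μ.prod ν) (μ.prod ν)) (e : ι ≃ ι)
    (hSe : ∀ i z, S i (S (e i) z) = z) {F G : ι → X × Q → ENNReal}
    (hF : ∀ i, Measurable (F i)) (hG : ∀ i, Measurable (G i))
    (hκFG : ∀ i z, ‖κ i z‖ₑ ≤ F i z * G i z) {A : ENNReal} {w : X → ENNReal}
    (h1 : ∀ x, ∑ i, ∫⁻ q, F i (x, q) ^ 2 ∂ν ≤ A)
    (h2 : ∀ y, ∑ i, ∫⁻ q, G i (S (e i) (y, q)) ^ 2 ∂ν ≤ w y)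
    {φ : X → ℂ} (hφ : Measurable φ) :
    ∫⁻ x, kernelMass ν κ S φ x ^ 2 ∂μ ≤ A * ∫⁻ y, w y * ‖φ y‖ₑ ^ 2 ∂μ := by
  have hm : ∀ i, Measurable fun z => G i z * ‖φ (S i z).1‖ₑ := fun i =>
    (hG i).mul (hφ.comp (hS i).measurable.fst).enorm
  calc ∫⁻ x, kernelMass ν κ S φ x ^ 2 ∂μ
      ≤ ∫⁻ x, A * ∑ i, ∫⁻ q, (G i (x, q) * ‖φ (S i (x, q)).1‖ₑ) ^ 2 ∂ν ∂μ := by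
        refine lintegral_mono fun x => ?_
        have hle : kernelMass ν κ S φ x ≤
            ∑ i, ∫⁻ q, F i (x, q) * (G i (x, q) * ‖φ (S i (x, q)).1‖ₑ) ∂ν := by
          refine Finset.sum_le_sum fun i _ => lintegral_mono fun q => ?_
          rw [enorm_mul, ← mul_assoc]
          exact mul_le_mul_left (hκFG i _) _
        refine (pow_le_pow_left' hle 2).trans ((sum_lintegral_mul_sq_le ?_ ?_).trans ?_)
        · exact fun i => (hF i).comp measurable_prodMk_left
        · exact fun i => (hm i).comp measurable_prodMk_left
        · exact mul_le_mul_left (h1 x) _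
    _ = A * ∑ i, ∫⁻ z, (G i z * ‖φ (S i z).1‖ₑ) ^ 2 ∂(μ.prod ν) := by
        rw [lintegral_const_mul, lintegral_finsetSum]
        · congr 1
          refine Finset.sum_congr rfl fun i _ => ?_
          rw [lintegral_prod _ ((hm i).pow_const 2).aemeasurable]
        · exact fun i _ => ((hm i).pow_const 2).lintegral_prod_right'
        · exact Finset.measurable_sum _ fun i _ => ((hm i).pow_const 2).lintegral_prod_right'
    -- Substituting `z = S (e i) (y, q)` turns `φ (S i z).1` into `φ y`, so that `q` can be
    -- integrated out of the weight alone.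
    _ = A * ∑ i, ∫⁻ y, (∫⁻ q, G i (S (e i) (y, q)) ^ 2 ∂ν) * ‖φ y‖ₑ ^ 2 ∂μ := by
        congr 1
        refine Finset.sum_congr rfl fun i _ => ?_
        rw [← (hS (e i)).lintegral_comp ((hm i).pow_const 2), lintegral_prod]
        · refine lintegral_congr fun y => ?_
          rw [← lintegral_mul_const]
          · simp only [hSe, mul_pow]
          · exact (((hG i).comp (hS (e i)).measurable).comp measurable_prodMk_left).pow_const 2
        · exact (((hm i).pow_const 2).comp (hS (e i)).measurable).aemeasurable
    _ = A * ∫⁻ y, (∑ i, ∫⁻ q, G i (S (e i) (y, q)) ^ 2 ∂ν) * ‖φ y‖ₑ ^ 2 ∂μ := by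
        rw [← lintegral_finsetSum]
        · simp only [Finset.sum_mul]
        · exact fun i _ => ((((hG i).comp (hS (e i)).measurable).pow_const
            2).lintegral_prod_right').mul (hφ.enorm.pow_const 2)
    _ ≤ _ := by
        gcongr with y
        exact h2 y

theorem ae_kernelMass_lt_top (hκ : ∀ i, Measurable (κ i)) (hS : ∀ i, Measurable (S i))
    {φ : X → ℂ} (hφ : Measurable φ) (hfin : ∫⁻ x, kernelMass ν κ S φ x ^ 2 ∂μ ≠ ⊤) :
    ∀ᵐ x ∂μ, kernelMass ν κ S φ x < ⊤ := by
  filter_upwards [ae_lt_top ((measurable_kernelMass hκ hS hφ).pow_const 2) hfin] with x hx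
  by_contra h
  rw [not_lt, top_le_iff] at h
  simp [h] at hx

theorem integrable_of_kernelMass_lt_top (hκ : ∀ i, Measurable (κ i)) (hS : ∀ i, Measurable (S i))
    {φ : X → ℂ} (hφ : Measurable φ) {x : X} (hx : kernelMass ν κ S φ x < ⊤) (i : ι) :
    Integrable (fun q => κ i (x, q) * φ (S i (x, q)).1) ν := by
  refine ⟨((measurable_kernel_term hκ hS hφ i).comp measurable_prodMk_left).aestronglyMeasurable,
    ?_⟩
  exact (Finset.single_le_sum (f := fun i => ∫⁻ q, ‖κ i (x, q) * φ (S i (x, q)).1‖ₑ ∂ν)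
    (fun _ _ => zero_le) (Finset.mem_univ i)).trans_lt hx

/-- A null set of `X` pulls back to a null set of `X × Q`, and Fubini slices it. This is what makes
the pointwise integrals independent of the representative of an L² class. -/
theorem ae_comp_fst {S : X × Q → X × Q} (hS : MeasurePreserving S (μ.prod ν) (μ.prod ν))
    {p : X → Prop} (hp : ∀ᵐ x ∂μ, p x) : ∀ᵐ x ∂μ, ∀ᵐ q ∂ν, p (S (x, q)).1 :=
  Measure.ae_ae_of_ae_prod
    (hS.quasiMeasurePreserving.ae (Measure.quasiMeasurePreserving_fst.ae hp))

theorem kernelOp_congr (hS : ∀ i, MeasurePreserving (S i) (μ.prod ν) (μ.prod ν)) {φ ψ : X → ℂ}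
    (h : φ =ᵐ[μ] ψ) : kernelOp ν κ S φ =ᵐ[μ] kernelOp ν κ S ψ := by
  filter_upwards [ae_all_iff.2 fun i => ae_comp_fst (hS i) h] with x hx
  refine Finset.sum_congr rfl fun i _ => integral_congr_ae ?_
  filter_upwards [hx i] with q hq
  rw [hq]

theorem kernelOp_add_smul (hκ : ∀ i, Measurable (κ i)) (hS : ∀ i, Measurable (S i))
    {φ ψ : X → ℂ} (hφ : Measurable φ) (hψ : Measurable ψ) (c : ℂ) {x : X}
    (h1 : kernelMass ν κ S φ x < ⊤) (h2 : kernelMass ν κ S ψ x < ⊤) :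
    kernelOp ν κ S (φ + c • ψ) x = kernelOp ν κ S φ x + c * kernelOp ν κ S ψ x := by
  rw [kernelOp, kernelOp, kernelOp, Finset.mul_sum, ← Finset.sum_add_distrib]
  refine Finset.sum_congr rfl fun i _ => ?_
  have i1 := integrable_of_kernelMass_lt_top hκ hS hφ h1 i
  have i2 := integrable_of_kernelMass_lt_top hκ hS hψ h2 i
  rw [← integral_const_mul, ← integral_add i1 (i2.const_mul c)]
  refine integral_congr_ae (Filter.Eventually.of_forall fun q => ?_)
  simp only [Pi.add_apply, Pi.smul_apply, smul_eq_mul]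
  ring

/-- A transformation of `x` that merely permutes the terms is absorbed by reindexing the sum;
applied to boson relabellings, it keeps the image in the symmetric sector. -/
theorem kernelOp_comp (hS : ∀ i, MeasurePreserving (S i) (μ.prod ν) (μ.prod ν)) {φ : X → ℂ}
    {σ : X → X} (hφ : ∀ᵐ x ∂μ, φ (σ x) = φ x) (π : ι ≃ ι)
    (hκσ : ∀ i x q, κ i (σ x, q) = κ (π i) (x, q))
    (hSσ : ∀ i x q, (S i (σ x, q)).1 = σ (S (π i) (x, q)).1) :
    ∀ᵐ x ∂μ, kernelOp ν κ S φ (σ x) = kernelOp ν κ S φ x := by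
  filter_upwards [ae_all_iff.2 fun i => ae_comp_fst (hS i) hφ] with x hx
  refine Eq.trans ?_ (Equiv.sum_comp π fun i => ∫ q, κ i (x, q) * φ (S i (x, q)).1 ∂ν)
  refine Finset.sum_congr rfl fun i _ => integral_congr_ae ?_
  filter_upwards [hx (π i)] with q hq
  rw [hκσ, hSσ, hq]

/-- Symmetry of `kernelOp` under a kernel symmetry. -/
theorem integral_kernelOp_symm (hκ : ∀ i, Measurable (κ i))
    (hS : ∀ i, MeasurePreserving (S i) (μ.prod ν) (μ.prod ν)) (e : ι ≃ ι)
    (hSe : ∀ i z, S i (S (e i) z) = z) (hκe : ∀ i z, κ (e i) z = starRingEnd ℂ (κ i (S (e i) z)))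
    {φ ψ : X → ℂ} (hφ : Measurable φ) (hψ : Measurable ψ)
    (hfin : ∫⁻ x, ‖ψ x‖ₑ * kernelMass ν κ S φ x ∂μ ≠ ⊤) :
    ∫ x, starRingEnd ℂ (kernelOp ν κ S φ x) * ψ x ∂μ =
      ∫ x, starRingEnd ℂ (φ x) * kernelOp ν κ S ψ x ∂μ := by
  -- Both pairings are sums of integrals of this one function, the right-hand one after composition
  -- with `S (e i)`. Hence absolute convergence of the left side alone is enough.
  set H : ι → X × Q → ℂ := fun i z => starRingEnd ℂ (κ i z * φ (S i z).1) * ψ z.1 with hH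
  have hSm := fun i => (hS i).measurable
  have hHm : ∀ i, Measurable (H i) := fun i =>
    (Complex.continuous_conj.measurable.comp (measurable_kernel_term hκ hSm hφ i)).mul
      (hψ.comp measurable_fst)
  have hHi : ∀ i, Integrable (H i) (μ.prod ν) := by
    intro i
    refine ⟨(hHm i).aestronglyMeasurable, ?_⟩
    rw [hasFiniteIntegral_iff_enorm, lintegral_prod _ (hHm i).enorm.aemeasurable]
    refine lt_of_le_of_lt (lintegral_mono fun x => ?_) (lt_top_iff_ne_top.2 hfin)
    have : ∫⁻ q, ‖H i (x, q)‖ₑ ∂ν = ‖ψ x‖ₑ * ∫⁻ q, ‖κ i (x, q) * φ (S i (x, q)).1‖ₑ ∂ν := by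
      have hm : Measurable fun q => ‖κ i (x, q) * φ (S i (x, q)).1‖ₑ :=
        ((measurable_kernel_term hκ hSm hφ i).comp measurable_prodMk_left).enorm
      rw [← lintegral_const_mul _ hm]
      refine lintegral_congr fun q => ?_
      rw [hH]
      simp only [enorm_mul, RCLike.enorm_conj]
      ring
    rw [this]
    exact mul_le_mul_right (Finset.single_le_sum
      (f := fun i => ∫⁻ q, ‖κ i (x, q) * φ (S i (x, q)).1‖ₑ ∂ν)
      (fun _ _ => zero_le) (Finset.mem_univ i)) _
  have hL : ∫ x, starRingEnd ℂ (kernelOp ν κ S φ x) * ψ x ∂μ =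
      ∑ i, ∫ z, H i z ∂(μ.prod ν) := by
    have : ∀ x, starRingEnd ℂ (kernelOp ν κ S φ x) * ψ x = ∑ i, ∫ q, H i (x, q) ∂ν := by
      intro x
      rw [kernelOp, map_sum, Finset.sum_mul]
      refine Finset.sum_congr rfl fun i _ => ?_
      rw [← integral_conj, ← integral_mul_const]
    simp only [this]
    rw [integral_finsetSum _ fun i _ => (hHi i).integral_prod_left]
    exact Finset.sum_congr rfl fun i _ => (integral_prod _ (hHi i)).symm
  have hHe : ∀ i z, H i (S (e i) z) = starRingEnd ℂ (φ z.1) * (κ (e i) z * ψ (S (e i) z).1) := by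
    intro i z
    simp only [hH, hSe, map_mul, hκe i z]
    ring
  have hR : ∫ x, starRingEnd ℂ (φ x) * kernelOp ν κ S ψ x ∂μ =
      ∑ i, ∫ z, H i (S (e i) z) ∂(μ.prod ν) := by
    have : ∀ x, starRingEnd ℂ (φ x) * kernelOp ν κ S ψ x =
        ∑ i, ∫ q, H i (S (e i) (x, q)) ∂ν := by
      intro x
      rw [kernelOp, ← Equiv.sum_comp e, Finset.mul_sum]
      refine Finset.sum_congr rfl fun i _ => ?_
      rw [← integral_const_mul]
      simp only [hHe]
    have hHSi : ∀ i, Integrable (fun z => H i (S (e i) z)) (μ.prod ν) := fun i =>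
      (hS (e i)).integrable_comp_of_integrable (hHi i)
    simp only [this]
    rw [integral_finsetSum _ fun i _ => (hHSi i).integral_prod_left]
    exact Finset.sum_congr rfl fun i _ => (integral_prod _ (hHSi i)).symm
  rw [hL, hR]
  refine Finset.sum_congr rfl fun i _ => ?_
  rw [← integral_map (hSm (e i)).aemeasurable, (hS (e i)).map_eq]
  rw [(hS (e i)).map_eq]
  exact (hHm i).aestronglyMeasurable

end KernelOperator

/-! ### Changes of configuration in the off-diagonal terms and their symmetries -/

section Maps

variable {d M n : ℕ}

/-- Append `q` as a last coordinate, transpose it with the `j`-th one, and split off the last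
coordinate again. -/
theorem measurePreserving_exchange (j : Fin n) :
    MeasurePreserving
      (fun z : (Fin n → E d) × E d => (Function.update z.1 j z.2, z.1 j)) volume volume := by
  have h1 := (volume_preserving_piFinSuccAbove (fun _ : Fin (n + 1) => E d) (Fin.last n))
  have h2 := volume_preserving_arrowCongr' (Equiv.swap j.castSucc (Fin.last n))
    (MeasurableEquiv.refl (E d)) (MeasurePreserving.id _)
  have hs : MeasurePreserving (Prod.swap : (Fin n → E d) × E d → E d × (Fin n → E d)) volume volume :=
    Measure.measurePreserving_swap
  have hs' : MeasurePreserving (Prod.swap : E d × (Fin n → E d) → (Fin n → E d) × E d) volume volume :=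
    Measure.measurePreserving_swap
  have h := hs'.comp (h1.comp (h2.comp ((h1.symm _).comp hs)))
  convert h using 1
  funext z
  refine Prod.ext (funext fun m => ?_) ?_
  · change _ = (Fin.insertNth (Fin.last n) z.2 z.1 : Fin (n + 1) → E d)
      ((Equiv.swap j.castSucc (Fin.last n)).symm ((Fin.last n).succAbove m))
    rw [Equiv.symm_swap, Fin.succAbove_last]
    by_cases hm : m = j
    · subst hm
      rw [Equiv.swap_apply_left]
      simp
    · rw [Equiv.swap_apply_of_ne_of_ne]
      · simp [hm]
      · simpa using hm
      · exact (Fin.castSucc_lt_last m).ne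
  · change _ = (Fin.insertNth (Fin.last n) z.2 z.1 : Fin (n + 1) → E d)
      ((Equiv.swap j.castSucc (Fin.last n)).symm (Fin.last n))
    rw [Equiv.symm_swap, Equiv.swap_apply_right]
    simp

/-- A skew product: for fixed boson variables the source momenta undergo a translation, under which
Lebesgue measure is invariant. -/
theorem measurePreserving_shear {g : (Fin n → E d) × E d → (Fin n → E d) × E d}
    (hg : MeasurePreserving g volume volume) {h : (Fin n → E d) × E d → Fin M → E d}
    (hh : Measurable h) :
    MeasurePreserving (fun z : Config d M n × E d =>
      (((z.1.1 + h (z.1.2, z.2), (g (z.1.2, z.2)).1), (g (z.1.2, z.2)).2) : Config d M n × E d))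
      volume volume := by
  have h1 : MeasurePreserving (fun p : ((Fin n → E d) × E d) × (Fin M → E d) =>
      (g p.1, p.2 + h p.1)) volume volume := by
    refine hg.skew_product (g := fun z P => P + h z) ?_ ?_
    · exact measurable_snd.add (hh.comp measurable_fst)
    · exact Filter.Eventually.of_forall fun z => map_add_right_eq_self _ _
  have hs : MeasurePreserving
      (Prod.swap : (Fin M → E d) × ((Fin n → E d) × E d) → _) volume volume :=
    Measure.measurePreserving_swap
  have hs' : MeasurePreserving
      (Prod.swap : ((Fin n → E d) × E d) × (Fin M → E d) → _) volume volume :=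
    Measure.measurePreserving_swap
  have ha := volume_preserving_prodAssoc (α₁ := Fin M → E d) (β₁ := Fin n → E d) (γ₁ := E d)
  exact ((ha.symm _).comp (hs'.comp (h1.comp (hs.comp ha))))

/-- Index set of the terms of `T_od` in the `n`-boson sector. -/
abbrev TermIdx (M n : ℕ) : Type := (Fin M × Fin M) × Option (Fin n)

/-- Exchange of the emitting and the absorbing source. -/
def swapIdx (M n : ℕ) : TermIdx M n ≃ TermIdx M n :=
  (Equiv.prodComm _ _).prodCongr (Equiv.refl _)

/-- The change of configuration in the term `((ℓ, i), ·)` of `T_od`. -/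
def termMap : TermIdx M n → Config d M n × E d → Config d M n × E d
  | ((ℓ, i), none), (x, q) => ((x.1 - Pi.single ℓ q + Pi.single i q, x.2), q)
  | ((ℓ, i), some j), (x, q) =>
    ((x.1 - Pi.single ℓ q + Pi.single i (x.2 j), Function.update x.2 j q), x.2 j)

/-- The kernel of the term `((ℓ, i), ·)` of `T_od`. -/
def termKernel (vhat : E d → ℂ) (ω : E d → ℝ) : TermIdx M n → Config d M n × E d → ℂ
  | ((ℓ, i), none), (x, q) =>
    if i = ℓ then 0 else ((‖vhat q‖ ^ 2 : ℝ) : ℂ) / ((freeSymbol ω (emit ℓ x q) : ℝ) : ℂ)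
  | ((ℓ, _), some j), (x, q) =>
    (starRingEnd ℂ) (vhat q) * vhat (x.2 j) / ((freeSymbol ω (emit ℓ x q) : ℝ) : ℂ)

theorem measurable_single (ℓ : Fin M) : Measurable (fun q : E d => (Pi.single ℓ q : Fin M → E d)) := by
  refine measurable_pi_iff.2 fun m => ?_
  by_cases h : m = ℓ
  · subst h; simpa using measurable_id'
  · simp [h]

theorem measurePreserving_termMap (t : TermIdx M n) :
    MeasurePreserving (termMap (d := d) t) (volume.prod volume) (volume.prod volume) := by
  obtain ⟨⟨ℓ, i⟩, _ | j⟩ := t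
  · have h := measurePreserving_shear (M := M) (MeasurePreserving.id (volume : Measure ((Fin n → E d) × E d)))
      (h := fun z => - Pi.single ℓ z.2 + Pi.single i z.2)
      (((measurable_single ℓ).comp measurable_snd).neg.add ((measurable_single i).comp measurable_snd))
    refine cast (congrArg (fun f => MeasurePreserving f _ _) ?_) h
    funext z
    simp only [termMap, id, sub_eq_add_neg, add_assoc]
  · have h := measurePreserving_shear (M := M) (measurePreserving_exchange (d := d) j)
      (h := fun z => - Pi.single ℓ z.2 + Pi.single i (z.1 j))
      (((measurable_single ℓ).comp measurable_snd).neg.add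
        ((measurable_single i).comp ((measurable_pi_apply j).comp measurable_fst)))
    refine cast (congrArg (fun f => MeasurePreserving f _ _) ?_) h
    funext z
    simp only [termMap, sub_eq_add_neg, add_assoc]

/-- Running the process backwards exchanges the source that emits with the one that absorbs, while
the second component keeps the momentum needed to undo the step. -/
theorem termMap_swapIdx (t : TermIdx M n) (z : Config d M n × E d) :
    termMap t (termMap (swapIdx M n t) z) = z := by
  obtain ⟨⟨ℓ, i⟩, _ | j⟩ := t <;> obtain ⟨⟨P, K⟩, q⟩ := z
  · simp only [swapIdx, termMap, Equiv.prodCongr_apply, Prod.map, Equiv.prodComm_apply,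
      Prod.swap, Equiv.refl_apply]
    congr 2
    abel
  · simp only [swapIdx, termMap, Equiv.prodCongr_apply, Prod.map, Equiv.prodComm_apply,
      Prod.swap, Equiv.refl_apply, Function.update_self, Function.update_idem,
      Function.update_eq_self]
    congr 2
    abel

theorem freeSymbol_emit (ω : E d → ℝ) (ℓ : Fin M) (x : Config d M n) (q : E d) :
    freeSymbol ω (emit ℓ x q) =
      (∑ i, ‖(x.1 - Pi.single ℓ q : Fin M → E d) i‖ ^ 2) + (∑ j, ω (x.2 j) + ω q) := by
  simp [freeSymbol, emit, Fin.sum_univ_castSucc]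

theorem sum_update {ω : E d → ℝ} (K : Fin n → E d) (j : Fin n) (q : E d) :
    ∑ m, ω (Function.update K j q m) + ω (K j) = ∑ m, ω (K m) + ω q := by
  rw [← Finset.add_sum_erase _ _ (Finset.mem_univ j),
    ← Finset.add_sum_erase (a := j) Finset.univ (fun m => ω (K m)) (Finset.mem_univ j)]
  have : ∑ m ∈ Finset.univ.erase j, ω (Function.update K j q m) =
      ∑ m ∈ Finset.univ.erase j, ω (K m) :=
    Finset.sum_congr rfl fun m hm => by rw [Function.update_of_ne (Finset.ne_of_mem_erase hm)]
  rw [this, Function.update_self]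
  ring

/-- Both sides are the energy of one intermediate configuration, reached from either end: the source
momenta agree and the bosons agree up to order. -/
theorem freeSymbol_emit_termMap (ω : E d → ℝ) (t : TermIdx M n) (z : Config d M n × E d) :
    freeSymbol ω (emit t.1.2 (termMap t z).1 (termMap t z).2) =
      freeSymbol ω (emit t.1.1 z.1 z.2) := by
  obtain ⟨⟨ℓ, i⟩, _ | j⟩ := t <;> obtain ⟨⟨P, K⟩, q⟩ := z
  · simp [freeSymbol_emit, termMap]
  · simp only [freeSymbol_emit, termMap, add_sub_cancel_right, sum_update]

/-- Hermitian symmetry of the kernel: the denominator is real and common to both sides, and the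
numerator is conjugated when the two boson momenta trade places. -/
theorem termKernel_swapIdx (vhat : E d → ℂ) (ω : E d → ℝ) (t : TermIdx M n)
    (z : Config d M n × E d) :
    termKernel vhat ω (swapIdx M n t) z =
      starRingEnd ℂ (termKernel vhat ω t (termMap (swapIdx M n t) z)) := by
  have h := freeSymbol_emit_termMap ω (swapIdx M n t) z
  obtain ⟨⟨ℓ, i⟩, _ | j⟩ := t <;> obtain ⟨⟨P, K⟩, q⟩ := z
  · simp only [swapIdx, termMap, termKernel, Equiv.prodCongr_apply, Prod.map, Equiv.prodComm_apply,
      Prod.swap, Equiv.refl_apply] at h ⊢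
    rw [h]
    by_cases hil : i = ℓ
    · simp [hil]
    · simp [hil, Ne.symm hil]
  · simp only [swapIdx, termMap, termKernel, Equiv.prodCongr_apply, Prod.map, Equiv.prodComm_apply,
      Prod.swap, Equiv.refl_apply, Function.update_self] at h ⊢
    rw [h]
    simp [mul_comm]

theorem measurable_freeSymbol {ω : E d → ℝ} (hω : Measurable ω) :
    Measurable (freeSymbol (M := M) (n := n) ω) := by
  unfold freeSymbol
  fun_prop

theorem measurable_freeSymbol_emit {ω : E d → ℝ} (hω : Measurable ω) (ℓ : Fin M) :
    Measurable fun z : Config d M n × E d => freeSymbol ω (emit ℓ z.1 z.2) := by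
  simp only [freeSymbol_emit]
  have := measurable_single (d := d) ℓ
  refine Measurable.add (Finset.measurable_sum _ fun i _ => ?_) (by fun_prop)
  have h1 : Measurable fun z : Config d M n × E d => (z.1.1 - Pi.single ℓ z.2 : Fin M → E d) :=
    measurable_fst.fst.sub (this.comp measurable_snd)
  exact ((measurable_pi_apply i).comp h1).norm.pow_const 2

theorem measurable_termKernel {vhat : E d → ℂ} {ω : E d → ℝ} (hv : Measurable vhat)
    (hω : Measurable ω) (t : TermIdx M n) : Measurable (termKernel vhat ω t) := by
  obtain ⟨⟨ℓ, i⟩, _ | j⟩ := t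
  · by_cases hil : i = ℓ
    · have : termKernel vhat ω (((ℓ, i), none) : TermIdx M n) = fun _ => 0 := by
        funext z; simp [termKernel, hil]
      rw [this]; exact measurable_const
    · have : termKernel vhat ω (((ℓ, i), none) : TermIdx M n) = fun z =>
          ((‖vhat z.2‖ ^ 2 : ℝ) : ℂ) / ((freeSymbol ω (emit ℓ z.1 z.2) : ℝ) : ℂ) := by
        funext z; simp [termKernel, hil]
      rw [this]
      exact (Complex.measurable_ofReal.comp ((hv.comp measurable_snd).norm.pow_const 2)).div
        (Complex.measurable_ofReal.comp (measurable_freeSymbol_emit hω ℓ))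
  · have h2 : Measurable fun z : Config d M n × E d => vhat (z.1.2 j) :=
      hv.comp ((measurable_pi_apply j).comp measurable_fst.snd)
    exact ((Complex.continuous_conj.measurable.comp (hv.comp measurable_snd)).mul h2).div
        (Complex.measurable_ofReal.comp (measurable_freeSymbol_emit hω ℓ))

/-- Relabelling of the terms of `T_od` under a permutation of the bosons. -/
def permIdx (M : ℕ) (σ : Equiv.Perm (Fin n)) : TermIdx M n ≃ TermIdx M n :=
  (Equiv.refl _).prodCongr (Equiv.optionCongr σ)

theorem freeSymbol_permBosons (ω : E d → ℝ) (σ : Equiv.Perm (Fin n)) (x : Config d M n) :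
    freeSymbol ω (permBosons σ x) = freeSymbol ω x := by
  simp only [freeSymbol, permBosons]
  rw [Equiv.sum_comp σ fun j => ω (x.2 j)]

theorem freeSymbol_emit_permBosons (ω : E d → ℝ) (σ : Equiv.Perm (Fin n)) (ℓ : Fin M)
    (x : Config d M n) (q : E d) :
    freeSymbol ω (emit ℓ (permBosons σ x) q) = freeSymbol ω (emit ℓ x q) := by
  simp only [freeSymbol_emit, permBosons]
  rw [Equiv.sum_comp σ fun j => ω (x.2 j)]

theorem termKernel_permBosons (vhat : E d → ℂ) (ω : E d → ℝ) (σ : Equiv.Perm (Fin n))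
    (t : TermIdx M n) (x : Config d M n) (q : E d) :
    termKernel vhat ω t (permBosons σ x, q) = termKernel vhat ω (permIdx M σ t) (x, q) := by
  obtain ⟨⟨ℓ, i⟩, _ | j⟩ := t
  · simp [termKernel, permIdx, freeSymbol_emit_permBosons]
  · simp [termKernel, permIdx, freeSymbol_emit_permBosons]
    rfl

theorem termMap_permBosons (σ : Equiv.Perm (Fin n)) (t : TermIdx M n) (x : Config d M n) (q : E d) :
    (termMap t (permBosons σ x, q)).1 = permBosons σ (termMap (permIdx M σ t) (x, q)).1 := by
  obtain ⟨⟨ℓ, i⟩, _ | j⟩ := t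
  · simp [termMap, permIdx, permBosons]
  · simp only [termMap, permIdx, permBosons, Equiv.prodCongr_apply, Prod.map, Equiv.refl_apply,
      Equiv.optionCongr_apply, Option.map_some]
    congr 1
    funext m
    by_cases hm : m = j
    · subst hm; simp
    · simp [hm, Function.update_of_ne]

/-- Deleting entry `j` after appending `q` gives the same momenta, in another order, as overwriting
entry `j` by `q`. The second form is the one with a simple inverse; on symmetric functions the two
are interchangeable. -/
theorem exists_perm_removeNth_snoc (j : Fin n) : ∃ σ : Equiv.Perm (Fin n),
    ∀ (K : Fin n → E d) (q : E d) (m : Fin n),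
      Fin.removeNth (α := fun _ => E d) j.castSucc (Fin.snoc (α := fun _ => E d) K q) m =
        Function.update K j q (σ m) := by
  set f : Fin n → Fin n := fun m =>
    Fin.lastCases (motive := fun _ => Fin n) j (fun a => a) (j.castSucc.succAbove m) with hf
  have hval : ∀ m, (j.castSucc.succAbove m = Fin.last n ∧ f m = j) ∨
      (j.castSucc.succAbove m = (f m).castSucc ∧ f m ≠ j) := by
    intro m
    have hne := Fin.succAbove_ne j.castSucc m
    rcases Fin.eq_castSucc_or_eq_last (j.castSucc.succAbove m) with ⟨a, ha⟩ | h
    · right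
      have : f m = a := by rw [hf]; simp only [ha, Fin.lastCases_castSucc]
      rw [this]
      refine ⟨ha, fun h => hne ?_⟩
      rw [ha, h]
    · left
      exact ⟨h, by rw [hf]; simp only [h, Fin.lastCases_last]⟩
  have hinj : Function.Injective f := by
    intro a b hab
    rcases hval a with ⟨ha, ha'⟩ | ⟨ha, ha'⟩ <;> rcases hval b with ⟨hb, hb'⟩ | ⟨hb, hb'⟩
    · exact Fin.succAbove_right_injective (ha.trans hb.symm)
    · exact absurd (hab.symm.trans ha') hb'
    · exact absurd (hab.trans hb') ha'
    · exact Fin.succAbove_right_injective (ha.trans (by rw [hb, hab]))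
  refine ⟨Equiv.ofBijective f (Finite.injective_iff_bijective.1 hinj), fun K q m => ?_⟩
  rw [Equiv.ofBijective_apply, Fin.removeNth]
  rcases hval m with ⟨ha, ha'⟩ | ⟨ha, ha'⟩
  · rw [ha, ha', Fin.snoc_last, Function.update_self]
  · rw [ha, Fin.snoc_castSucc, Function.update_of_ne ha']

end Maps

/-! ### Momentum integrals and the Schur bound for a boson passed between two sources -/

section Estimates

variable {d M n : ℕ}

theorem one_le_omega {ω : E d → ℝ} {β : ℝ} (hβ : 0 ≤ β)
    (hω : ∀ k, (1 + ‖k‖ ^ 2) ^ (β / 2) ≤ ω k) (k : E d) : 1 ≤ ω k :=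
  (Real.one_le_rpow (by nlinarith [sq_nonneg ‖k‖]) (by linarith)).trans (hω k)

theorem norm_rpow_le_omega {ω : E d → ℝ} {β : ℝ} (hβ : 0 ≤ β)
    (hω : ∀ k, (1 + ‖k‖ ^ 2) ^ (β / 2) ≤ ω k) (k : E d) : ‖k‖ ^ β ≤ ω k := by
  refine le_trans ?_ (hω k)
  have : ‖k‖ ^ β = (‖k‖ ^ 2) ^ (β / 2) := by
    rw [← Real.rpow_natCast, ← Real.rpow_mul (norm_nonneg _)]; congr 1; push_cast; ring
  rw [this]
  exact Real.rpow_le_rpow (by positivity) (by linarith) (by linarith)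

/-- The basic bound for integrals of `|v̂|² ω^{-σ}` against a resolvent. -/
theorem exists_vhat_integral_bound (hd : 0 < d) {vhat : E d → ℂ} {ω : E d → ℝ} {α β D σ b : ℝ}
    (hα : 0 ≤ α) (hβ : 0 ≤ β) (hv : ∀ k, k ≠ 0 → ‖vhat k‖ ≤ ‖k‖ ^ (-α))
    (hω : ∀ k, (1 + ‖k‖ ^ 2) ^ (β / 2) ≤ ω k) (hD : D = d - 2 * α - 2) (hσ : 0 ≤ σ) (hb : 0 ≤ b)
    (h1 : D < b + β * σ) (h2 : b + β * σ < D + 2) :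
    ∃ C : ℝ, 0 ≤ C ∧ ∀ (p : E d) (W : ℝ) (R : E d → ℝ), 0 < W → (∀ q, ‖q - p‖ ^ 2 + W ≤ R q) →
      ∫⁻ q : E d, ENNReal.ofReal (‖vhat q‖ ^ 2 * ω q ^ (-σ) * ‖q - p‖ ^ (-b) / R q) ≤
        ENNReal.ofReal (C * W ^ ((D - b - β * σ) / 2)) := by
  obtain ⟨C, hC, h⟩ := exists_two_center_bound hd (a := 2 * α + β * σ) (b := b) (c := 1)
    (by positivity) hb one_pos (by linarith) (by linarith)
  refine ⟨C, hC, fun p W R hW hR => ?_⟩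
  have he : ((d : ℝ) - (2 * α + β * σ + b)) / 2 - 1 = (D - b - β * σ) / 2 := by rw [hD]; ring
  rw [← he]
  refine (lintegral_mono_ae ?_).trans (h p W hW)
  filter_upwards [ae_ne_point hd 0] with q hq
  refine ENNReal.ofReal_le_ofReal ?_
  have hq0 : 0 < ‖q‖ := norm_pos_iff.2 hq
  have hp : 0 < ‖q - p‖ ^ 2 + W := by positivity
  have e1 : ‖vhat q‖ ^ 2 ≤ ‖q‖ ^ (-(2 * α)) := by
    have := pow_le_pow_left₀ (norm_nonneg _) (hv q hq) 2
    rwa [← Real.rpow_natCast (‖q‖ ^ (-α)), ← Real.rpow_mul hq0.le,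
      show -α * ((2 : ℕ) : ℝ) = -(2 * α) by push_cast; ring] at this
  have e2 : ω q ^ (-σ) ≤ ‖q‖ ^ (-(β * σ)) := by
    have := Real.rpow_le_rpow_of_nonpos (Real.rpow_pos_of_pos hq0 β)
      (norm_rpow_le_omega hβ hω q) (neg_nonpos.2 hσ)
    rwa [← Real.rpow_mul hq0.le, mul_neg] at this
  have e3 : ‖q‖ ^ (-(2 * α + β * σ)) = ‖q‖ ^ (-(2 * α)) * ‖q‖ ^ (-(β * σ)) := by
    rw [← Real.rpow_add hq0]; congr 1; ring
  have hωq : 0 < ω q := one_pos.trans_le (one_le_omega hβ hω q)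
  rw [e3, Real.rpow_neg_one, ← div_eq_mul_inv]
  have := hR q
  gcongr

theorem sq_add_le_freeSymbol_emit {ω : E d → ℝ} (ℓ : Fin M) (x : Config d M n) (q : E d) :
    ‖q - x.1 ℓ‖ ^ 2 + (∑ j, ω (x.2 j) + ω q) ≤ freeSymbol ω (emit ℓ x q) := by
  set f : Fin M → ℝ := fun i => ‖(x.1 - Pi.single ℓ q : Fin M → E d) i‖ ^ 2 with hf
  have h1 : freeSymbol ω (emit ℓ x q) = ∑ i, f i + (∑ j, ω (x.2 j) + ω q) := freeSymbol_emit ω ℓ x q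
  have hf0 : ∀ i, 0 ≤ f i := fun i => sq_nonneg _
  have h2 : ‖q - x.1 ℓ‖ ^ 2 = f ℓ := by simp [hf, norm_sub_rev]
  have h3 : f ℓ ≤ ∑ i, f i := Finset.single_le_sum (fun i _ => hf0 i) (Finset.mem_univ ℓ)
  rw [h1, h2]
  linarith

theorem sq_add_sq_add_le_freeSymbol_emit {ω : E d → ℝ} {ℓ i : Fin M} (hi : i ≠ ℓ)
    (x : Config d M n) (q : E d) :
    ‖q - x.1 ℓ‖ ^ 2 + ‖x.1 i‖ ^ 2 + (∑ j, ω (x.2 j) + ω q) ≤ freeSymbol ω (emit ℓ x q) := by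
  set f : Fin M → ℝ := fun i => ‖(x.1 - Pi.single ℓ q : Fin M → E d) i‖ ^ 2 with hf
  have h1 : freeSymbol ω (emit ℓ x q) = ∑ i, f i + (∑ j, ω (x.2 j) + ω q) := freeSymbol_emit ω ℓ x q
  have hf0 : ∀ i, 0 ≤ f i := fun i => sq_nonneg _
  have h2 : ‖q - x.1 ℓ‖ ^ 2 = f ℓ := by simp [hf, norm_sub_rev]
  have h2' : ‖x.1 i‖ ^ 2 = f i := by simp [hf, hi]
  have h3 : f ℓ + f i ≤ ∑ i, f i := by
    rw [← Finset.sum_pair hi.symm]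
    exact Finset.sum_le_univ_sum_of_nonneg hf0
  rw [h1, h2, h2']
  linarith

/-- The weight splitting the kernel of the terms in which one boson is created and annihilated. -/
def thetaWeight (D : ℝ) (ℓ i : Fin M) (z : Config d M n × E d) : ℝ :=
  (1 + ‖z.1.1 ℓ - z.2‖ ^ 2) ^ ((D + 1) / 2) * (1 + ‖z.1.1 i‖ ^ 2) ^ (-(1 / 2) : ℝ)

theorem thetaWeight_pos (D : ℝ) (ℓ i : Fin M) (z : Config d M n × E d) :
    0 < thetaWeight D ℓ i z := by
  unfold thetaWeight; positivity

/-- The other source supplies the mass `W = 1 + |p|²` in the denominator. Using `b = D + 1` gives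
`W^{1/2} W^{-1/2}` in the first integral; using `b = 1` gives `W^{(D+1)/2} W^{(D-1)/2} = W^D` in the
second. The latter requires `D < 1`. -/
theorem exists_theta_bound (hd : 0 < d) {vhat : E d → ℂ} {ω : E d → ℝ} {α β D : ℝ}
    (hα : 0 ≤ α) (hβ : 0 ≤ β) (hv : ∀ k, k ≠ 0 → ‖vhat k‖ ≤ ‖k‖ ^ (-α))
    (hω : ∀ k, (1 + ‖k‖ ^ 2) ^ (β / 2) ≤ ω k) (hD : D = d - 2 * α - 2) (hD0 : 0 ≤ D) (hD1 : D < 1) :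
    ∃ C : ℝ, 0 ≤ C ∧ ∀ {M n : ℕ} (ℓ i : Fin M), i ≠ ℓ →
      (∀ x : Config d M n, ∫⁻ q, ENNReal.ofReal (‖vhat q‖ ^ 2 /
        (freeSymbol ω (emit ℓ x q) * thetaWeight D ℓ i (x, q))) ≤ ENNReal.ofReal C) ∧
      ∀ y : Config d M n, ∫⁻ q, ENNReal.ofReal (‖vhat q‖ ^ 2 *
        thetaWeight D ℓ i (termMap ((i, ℓ), none) (y, q)) / (freeSymbol ω (emit i y q))) ≤
          ENNReal.ofReal (C * (1 + ‖y.1 ℓ‖ ^ 2) ^ D) := by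
  obtain ⟨C1, hC1, h1⟩ := exists_vhat_integral_bound hd (σ := 0) (b := D + 1) hα hβ hv hω hD le_rfl
    (by linarith) (by linarith) (by linarith)
  obtain ⟨C2, hC2, h2⟩ := exists_vhat_integral_bound hd (σ := 0) (b := 1) hα hβ hv hω hD le_rfl
    zero_le_one (by linarith) (by linarith)
  have key : ∀ (c : ℝ), 0 ≤ c → ∀ p q : E d, q ≠ p →
      (1 + ‖q - p‖ ^ 2) ^ (-(c / 2)) ≤ ‖q - p‖ ^ (-c) := by
    intro c hc p q hq
    have hpos : 0 < ‖q - p‖ := norm_pos_iff.2 (sub_ne_zero.2 hq)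
    have : ‖q - p‖ ^ (-c) = (‖q - p‖ ^ 2) ^ (-(c / 2)) := by
      rw [← Real.rpow_natCast, ← Real.rpow_mul hpos.le]; congr 1; push_cast; ring
    rw [this]
    exact Real.rpow_le_rpow_of_nonpos (by positivity) (by linarith) (by linarith)
  refine ⟨max C1 C2, hC1.trans (le_max_left _ _), fun {M n} ℓ i hi => ⟨fun x => ?_, fun y => ?_⟩⟩
  · set W := 1 + ‖x.1 i‖ ^ 2 with hW
    have hW0 : 0 < W := by positivity
    have hR : ∀ q, ‖q - x.1 ℓ‖ ^ 2 + W ≤ freeSymbol ω (emit ℓ x q) := fun q => by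
      refine le_trans ?_ (sq_add_sq_add_le_freeSymbol_emit hi x q)
      have a1 := one_le_omega hβ hω q
      have a2 : 0 ≤ ∑ j, ω (x.2 j) :=
        Finset.sum_nonneg fun j _ => zero_le_one.trans (one_le_omega hβ hω _)
      linarith
    calc _ ≤ ∫⁻ q, ENNReal.ofReal (W ^ (1 / 2 : ℝ)) * ENNReal.ofReal
            (‖vhat q‖ ^ 2 * ω q ^ (-0 : ℝ) * ‖q - x.1 ℓ‖ ^ (-(D + 1)) /
              freeSymbol ω (emit ℓ x q)) := by
          refine lintegral_mono_ae ?_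
          filter_upwards [ae_ne_point hd (x.1 ℓ)] with q hq
          rw [← ENNReal.ofReal_mul (by positivity)]
          refine ENNReal.ofReal_le_ofReal ?_
          have hRq : 0 < freeSymbol ω (emit ℓ x q) := lt_of_lt_of_le (by positivity) (hR q)
          have hk := key (D + 1) (by linarith) (x.1 ℓ) q hq
          have : ‖vhat q‖ ^ 2 / (freeSymbol ω (emit ℓ x q) * thetaWeight D ℓ i (x, q)) =
              W ^ (1 / 2 : ℝ) * (‖vhat q‖ ^ 2 * (1 + ‖q - x.1 ℓ‖ ^ 2) ^ (-((D + 1) / 2)) /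
                freeSymbol ω (emit ℓ x q)) := by
            simp only [thetaWeight]
            rw [norm_sub_rev, Real.rpow_neg (by positivity), Real.rpow_neg (by positivity), ← hW]
            field_simp
          rw [this, neg_zero, Real.rpow_zero, mul_one]
          gcongr
      _ ≤ ENNReal.ofReal (W ^ (1 / 2 : ℝ)) *
            ENNReal.ofReal (C1 * W ^ ((D - (D + 1) - β * 0) / 2)) := by
          rw [lintegral_const_mul' _ _ ENNReal.ofReal_ne_top]
          gcongr
          exact h1 (x.1 ℓ) W _ hW0 hR
      _ ≤ _ := by
          rw [← ENNReal.ofReal_mul (by positivity)]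
          refine ENNReal.ofReal_le_ofReal ?_
          rw [mul_left_comm, ← Real.rpow_add hW0]
          rw [show (1 / 2 : ℝ) + (D - (D + 1) - β * 0) / 2 = 0 by ring, Real.rpow_zero, mul_one]
          exact le_max_left _ _
  · set W := 1 + ‖y.1 ℓ‖ ^ 2 with hW
    have hW0 : 0 < W := by positivity
    have hR : ∀ q, ‖q - y.1 i‖ ^ 2 + W ≤ freeSymbol ω (emit i y q) := fun q => by
      refine le_trans ?_ (sq_add_sq_add_le_freeSymbol_emit hi.symm y q)
      have a1 := one_le_omega hβ hω q
      have a2 : 0 ≤ ∑ j, ω (y.2 j) :=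
        Finset.sum_nonneg fun j _ => zero_le_one.trans (one_le_omega hβ hω _)
      linarith
    calc _ ≤ ∫⁻ q, ENNReal.ofReal (W ^ ((D + 1) / 2)) * ENNReal.ofReal
            (‖vhat q‖ ^ 2 * ω q ^ (-0 : ℝ) * ‖q - y.1 i‖ ^ (-1 : ℝ) /
              freeSymbol ω (emit i y q)) := by
          refine lintegral_mono_ae ?_
          filter_upwards [ae_ne_point hd (y.1 i)] with q hq
          rw [← ENNReal.ofReal_mul (by positivity)]
          refine ENNReal.ofReal_le_ofReal ?_
          have hRq : 0 < freeSymbol ω (emit i y q) := lt_of_lt_of_le (by positivity) (hR q)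
          have hk := key 1 zero_le_one (y.1 i) q hq
          have : ‖vhat q‖ ^ 2 * thetaWeight D ℓ i (termMap ((i, ℓ), none) (y, q)) /
                freeSymbol ω (emit i y q) =
              W ^ ((D + 1) / 2) * (‖vhat q‖ ^ 2 * (1 + ‖q - y.1 i‖ ^ 2) ^ (-(1 / 2) : ℝ) /
                freeSymbol ω (emit i y q)) := by
            have t1 : (y.1 - Pi.single i q + Pi.single ℓ q : Fin M → E d) ℓ - q = y.1 ℓ := by
              simp [hi.symm]
            have t2 : (y.1 - Pi.single i q + Pi.single ℓ q : Fin M → E d) i = y.1 i - q := by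
              simp [hi]
            simp only [thetaWeight, termMap]
            rw [t1, t2, norm_sub_rev (y.1 i) q, ← hW]
            ring
          rw [this, neg_zero, Real.rpow_zero, mul_one]
          gcongr
      _ ≤ ENNReal.ofReal (W ^ ((D + 1) / 2)) *
            ENNReal.ofReal (C2 * W ^ ((D - 1 - β * 0) / 2)) := by
          rw [lintegral_const_mul' _ _ ENNReal.ofReal_ne_top]
          gcongr
          exact h2 (y.1 i) W _ hW0 hR
      _ ≤ _ := by
          rw [← ENNReal.ofReal_mul (by positivity)]
          refine ENNReal.ofReal_le_ofReal ?_
          rw [mul_left_comm, ← Real.rpow_add hW0]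
          rw [show (D + 1) / 2 + (D - 1 - β * 0) / 2 = D by ring]
          gcongr
          exact le_max_right _ _

/-- `∑ tⱼ^s ≤ n^{max(0, 1-s)} (∑ tⱼ)^s`. -/
theorem sum_rpow_le_card_rpow_mul {t : Fin n → ℝ} (ht : ∀ j, 1 ≤ t j) {s : ℝ} (hs : 0 < s) :
    ∑ j, t j ^ s ≤ (n : ℝ) ^ max 0 (1 - s) * (∑ j, t j) ^ s := by
  rcases Nat.eq_zero_or_pos n with rfl | hn
  · simp [Real.zero_rpow hs.ne']
  have ht0 : ∀ j, 0 < t j := fun j => one_pos.trans_le (ht j)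
  have : NeZero n := ⟨hn.ne'⟩
  have hT : 0 < ∑ j, t j := Finset.sum_pos (fun j _ => ht0 j) Finset.univ_nonempty
  set T := ∑ j, t j with hTdef
  have hnR : (0 : ℝ) < n := by exact_mod_cast hn
  rcases le_total s 1 with h | h
  · rw [max_eq_right (by linarith)]
    -- For `s ≤ 1` each power lies below its tangent at the mean `m`, by concavity; the linear terms
    -- then sum exactly.
    set m := T / n with hm
    have hm0 : 0 < m := by positivity
    have h1 : ∀ j, t j ^ s ≤ m ^ s * (s * (t j / m) + (1 - s)) := by
      intro j
      have := Real.geom_mean_le_arith_mean2_weighted hs.le (by linarith : (0 : ℝ) ≤ 1 - s)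
        (by have := ht0 j; positivity : 0 ≤ t j / m) zero_le_one (by ring)
      rw [Real.one_rpow, mul_one, mul_one, Real.div_rpow (ht0 j).le hm0.le] at this
      rwa [← div_le_iff₀' (by positivity)]
    calc ∑ j, t j ^ s ≤ ∑ j, m ^ s * (s * (t j / m) + (1 - s)) := Finset.sum_le_sum fun j _ => h1 j
      _ = m ^ s * (s * (T / m) + n * (1 - s)) := by
        rw [← Finset.mul_sum, Finset.sum_add_distrib, ← Finset.mul_sum, ← Finset.sum_div]
        rw [Finset.sum_const, Finset.card_univ, Fintype.card_fin, nsmul_eq_mul]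
      _ = m ^ s * n := by
        have : T / m = n := by rw [hm]; field_simp
        rw [this]; ring
      _ = _ := by
        rw [hm, Real.div_rpow hT.le hnR.le, Real.rpow_sub hnR, Real.rpow_one]
        field_simp
  · rw [max_eq_left (by linarith), Real.rpow_zero, one_mul]
    have h1 : ∀ j, t j ^ s ≤ t j * T ^ (s - 1) := by
      intro j
      have hle : t j ≤ T := Finset.single_le_sum (f := t) (fun j _ => (ht0 j).le) (Finset.mem_univ j)
      have := Real.rpow_le_rpow (ht0 j).le hle (by linarith : 0 ≤ s - 1)
      calc t j ^ s = t j * t j ^ (s - 1) := by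
            rw [← Real.rpow_one_add' (ht0 j).le (by linarith)]; congr 1; ring
        _ ≤ _ := mul_le_mul_of_nonneg_left this (ht0 j).le
    refine (Finset.sum_le_sum fun j _ => h1 j).trans (le_of_eq ?_)
    rw [← Finset.sum_mul, ← hTdef, ← Real.rpow_one_add' hT.le (by linarith)]
    congr 1; ring

/-- The weight splitting the kernel of the terms in which two bosons are exchanged. -/
def tauWeight (ω : E d → ℝ) (s u : ℝ) (j : Fin n) (z : Config d M n × E d) : ℝ :=
  ω z.2 ^ s * (ω (z.1.2 j) ^ (-u) + ω (z.1.2 j) ^ (-s) *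
    ((n : ℝ) ^ max 0 (1 - s) * (∑ m, ω (Function.update z.1.2 j z.2 m)) ^ (s - u)))

/-- Bound for the inverse of `tauWeight`. -/
theorem inv_tau_factor_le {Ω Ω' t ν s u : ℝ} (hΩ : 0 < Ω) (ht : 1 ≤ t)
    (hν : 1 ≤ ν) (hu1 : u < 1) (hus : u ≤ s) (hΩ'pos : 0 < Ω') (hΩ' : Ω - t ≤ Ω') :
    (t ^ (-u) + t ^ (-s) * (ν * Ω' ^ (s - u)))⁻¹ ≤
      2 ^ (1 - u) * Ω ^ (u - 1) * t + 2 ^ (s - u) * Ω ^ (u - s) * ν⁻¹ * t ^ s := by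
  have ht0 : 0 < t := by linarith
  have hν0 : 0 < ν := by linarith
  -- Either this boson carries at least half of the energy and the first summand of the weight is
  -- used, or the remaining bosons give `Ω' ≥ Ω / 2` and the second summand is used.
  rcases le_total Ω (2 * t) with h | h
  · calc (t ^ (-u) + t ^ (-s) * (ν * Ω' ^ (s - u)))⁻¹ ≤ (t ^ (-u))⁻¹ := by
          apply inv_anti₀ (by positivity)
          have : 0 ≤ t ^ (-s) * (ν * Ω' ^ (s - u)) := by positivity
          linarith
      _ = t ^ u := by rw [Real.rpow_neg ht0.le, inv_inv]
      _ ≤ (2 * t / Ω) ^ (1 - u) * t ^ u := by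
          refine le_mul_of_one_le_left (by positivity) (Real.one_le_rpow ?_ (by linarith))
          rwa [le_div_iff₀ hΩ, one_mul]
      _ = 2 ^ (1 - u) * Ω ^ (u - 1) * t := by
          rw [Real.div_rpow (by positivity) hΩ.le, Real.mul_rpow zero_le_two ht0.le,
            show u - 1 = -(1 - u) by ring, Real.rpow_neg hΩ.le]
          have : t ^ (1 - u) * t ^ u = t := by
            rw [← Real.rpow_add ht0]; simp
          linear_combination (2 ^ (1 - u) / Ω ^ (1 - u)) * this
      _ ≤ _ := by
          have : 0 ≤ 2 ^ (s - u) * Ω ^ (u - s) * ν⁻¹ * t ^ s := by positivity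
          linarith
  · have hh : Ω / 2 ≤ Ω' := by linarith
    calc (t ^ (-u) + t ^ (-s) * (ν * Ω' ^ (s - u)))⁻¹ ≤ (t ^ (-s) * (ν * (Ω / 2) ^ (s - u)))⁻¹ := by
          apply inv_anti₀ (by positivity)
          have h1 : (Ω / 2) ^ (s - u) ≤ Ω' ^ (s - u) :=
            Real.rpow_le_rpow (by positivity) hh (by linarith)
          have h2 : t ^ (-s) * (ν * (Ω / 2) ^ (s - u)) ≤ t ^ (-s) * (ν * Ω' ^ (s - u)) := by gcongr
          have : 0 < t ^ (-u) := by positivity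
          linarith
      _ = 2 ^ (s - u) * Ω ^ (u - s) * ν⁻¹ * t ^ s := by
          rw [Real.rpow_neg ht0.le, Real.div_rpow hΩ.le zero_le_two,
            show u - s = -(s - u) by ring, Real.rpow_neg hΩ.le]
          field_simp
      _ ≤ _ := by
          have : 0 ≤ 2 ^ (1 - u) * Ω ^ (u - 1) * t := by positivity
          linarith

end Estimates

/-! ### Schur bound for the exchange of two bosons -/

section Estimates

variable {d M n : ℕ}

theorem tauWeight_pos {ω : E d → ℝ} (hω1 : ∀ k, 1 ≤ ω k) (s u : ℝ) (j : Fin n)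
    (z : Config d M n × E d) : 0 < tauWeight ω s u j z := by
  have h0 : ∀ k, 0 < ω k := fun k => one_pos.trans_le (hω1 k)
  have h1 : 0 ≤ ∑ m, ω (Function.update z.1.2 j z.2 m) := Finset.sum_nonneg fun m _ => (h0 _).le
  have := h0 z.2
  have := h0 (z.1.2 j)
  unfold tauWeight
  positivity

theorem tauWeight_termMap (ω : E d → ℝ) (s u : ℝ) (ℓ i : Fin M) (j : Fin n)
    (y : Config d M n) (q : E d) :
    tauWeight ω s u j (termMap ((i, ℓ), some j) (y, q)) =
      ω (y.2 j) ^ s * (ω q ^ (-u) + ω q ^ (-s) *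
        ((n : ℝ) ^ max 0 (1 - s) * (∑ m, ω (y.2 m)) ^ (s - u))) := by
  simp [tauWeight, termMap]

/-- The factor `ω(q)^s` in the weight makes the first `q`-integral of order `Ω^{-u}`, and the
reciprocal of the bracket sums over `j` to order `Ω^u`. After the exchange the roles reverse:
`ω(k_j)^s` sums to at most `ν Ω^s`, and the two bracket terms integrate to `Ω^{-u2}` and `ν
Ω^{s-2u}`. -/
theorem exists_tau_bound (hd : 0 < d) {vhat : E d → ℂ} {ω : E d → ℝ} {α β D s u u2 : ℝ}
    (hα : 0 ≤ α) (hβ : 0 ≤ β) (hβ2 : β ≤ 2) (hvm : Measurable vhat) (hωm : Measurable ω)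
    (hv : ∀ k, k ≠ 0 → ‖vhat k‖ ≤ ‖k‖ ^ (-α))
    (hω : ∀ k, (1 + ‖k‖ ^ 2) ^ (β / 2) ≤ ω k) (hD : D = d - 2 * α - 2) (hD0 : 0 ≤ D)
    (hs : 0 < s) (hu : u = β / 2 * s - D / 2) (hu2 : u2 = β / 2 * u - D / 2) (hu1 : u < 1)
    (hu2pos : 0 < u2) :
    ∃ C : ℝ, 0 ≤ C ∧ ∀ {M n : ℕ} (ℓ i : Fin M),
      (∀ x : Config d M n, ∑ j : Fin n, ∫⁻ q, ENNReal.ofReal (‖vhat q‖ ^ 2 /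
        (freeSymbol ω (emit ℓ x q) * tauWeight ω s u j (x, q))) ≤ ENNReal.ofReal C) ∧
      ∀ y : Config d M n, ∑ j : Fin n, ∫⁻ q, ENNReal.ofReal (‖vhat q‖ ^ 2 *
        tauWeight ω s u j (termMap ((i, ℓ), some j) (y, q)) / (freeSymbol ω (emit i y q))) ≤
          ENNReal.ofReal (C * ((n : ℝ) ^ max 0 (1 - s) * (∑ m, ω (y.2 m)) ^ (s - u)) ^ 2) := by
  have hupos : 0 < u := by
    by_contra h
    have : β / 2 * u ≤ 0 := mul_nonpos_of_nonneg_of_nonpos (by linarith) (not_lt.1 h)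
    linarith
  have hus : u ≤ s := by nlinarith
  have hu2u : u2 ≤ u := by nlinarith
  have hω1 := one_le_omega hβ hω
  have hω0 : ∀ k, 0 < ω k := fun k => one_pos.trans_le (hω1 k)
  obtain ⟨C1, hC1, h1⟩ := exists_vhat_integral_bound hd (σ := s) (b := 0) hα hβ hv hω hD hs.le
    le_rfl (by linarith) (by linarith)
  obtain ⟨C2, hC2, h2⟩ := exists_vhat_integral_bound hd (σ := u) (b := 0) hα hβ hv hω hD hupos.le
    le_rfl (by linarith) (by linarith)
  rw [show (D - 0 - β * s) / 2 = -u by rw [hu]; ring] at h1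
  rw [show (D - 0 - β * u) / 2 = -u2 by rw [hu2]; ring] at h2
  simp only [neg_zero, Real.rpow_zero, mul_one] at h1 h2
  set Cm := max (C1 * (2 ^ (1 - u) + 2 ^ (s - u))) (C1 + C2) with hCm
  have hCm0 : 0 ≤ Cm := le_trans (by positivity) (le_max_right _ _)
  refine ⟨Cm, hCm0, fun {M n} ℓ i => ?_⟩
  rcases Nat.eq_zero_or_pos n with rfl | hn
  · simp
  have : NeZero n := ⟨hn.ne'⟩
  have hn1 : (1 : ℝ) ≤ n := by exact_mod_cast hn
  set ν := (n : ℝ) ^ max 0 (1 - s) with hν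
  have hν1 : 1 ≤ ν := Real.one_le_rpow hn1 (le_max_left _ _)
  have hν0 : 0 < ν := by linarith
  have hΩ1 : ∀ K : Fin n → E d, 1 ≤ ∑ m, ω (K m) := fun K =>
    (hω1 (K 0)).trans (Finset.single_le_sum (f := fun m => ω (K m)) (fun m _ => (hω0 _).le)
      (Finset.mem_univ 0))
  have hR : ∀ (ℓ : Fin M) (x : Config d M n) (q : E d),
      ‖q - x.1 ℓ‖ ^ 2 + ∑ m, ω (x.2 m) ≤ freeSymbol ω (emit ℓ x q) := fun ℓ x q => by
    have := sq_add_le_freeSymbol_emit (ω := ω) ℓ x q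
    have := hω0 q
    linarith
  have hRpos : ∀ (ℓ : Fin M) (x : Config d M n) (q : E d), 0 < freeSymbol ω (emit ℓ x q) :=
    fun ℓ x q => lt_of_lt_of_le (by have := hΩ1 x.2; positivity) (hR ℓ x q)
  refine ⟨fun x => ?_, fun y => ?_⟩
  · set Ω := ∑ m, ω (x.2 m) with hΩ
    have hΩ0 : 0 < Ω := one_pos.trans_le (hΩ1 x.2)
    -- A bound for the reciprocal bracket that no longer depends on `q`. Its first part is linear in
    -- `ω (x.2 j)` and sums to a multiple of `Ω^u`; its second carries `ν⁻¹` against the cost of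
    -- summing `s`-th powers.
    set h : Fin n → ℝ := fun j =>
      2 ^ (1 - u) * Ω ^ (u - 1) * ω (x.2 j) + 2 ^ (s - u) * Ω ^ (u - s) * ν⁻¹ * ω (x.2 j) ^ s with hh
    have hh0 : ∀ j, 0 ≤ h j := fun j => by have := hω0 (x.2 j); positivity
    have hterm : ∀ j, ∫⁻ q, ENNReal.ofReal (‖vhat q‖ ^ 2 /
        (freeSymbol ω (emit ℓ x q) * tauWeight ω s u j (x, q))) ≤
          ENNReal.ofReal (h j * (C1 * Ω ^ (-u))) := by
      intro j
      calc _ ≤ ∫⁻ q, ENNReal.ofReal (h j) * ENNReal.ofReal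
              (‖vhat q‖ ^ 2 * ω q ^ (-s) / freeSymbol ω (emit ℓ x q)) := by
            refine lintegral_mono fun q => ?_
            rw [← ENNReal.ofReal_mul (hh0 j)]
            refine ENNReal.ofReal_le_ofReal ?_
            have hRq := hRpos ℓ x q
            have hq0 := hω0 q
            have hup := sum_update (ω := ω) x.2 j q
            have hinv := inv_tau_factor_le (Ω := Ω)
              (Ω' := ∑ m, ω (Function.update x.2 j q m)) (t := ω (x.2 j)) hΩ0 (hω1 _) hν1 hu1 hus
              (one_pos.trans_le (hΩ1 (Function.update x.2 j q))) (by linarith)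
            have : ‖vhat q‖ ^ 2 / (freeSymbol ω (emit ℓ x q) * tauWeight ω s u j (x, q)) =
                (ω (x.2 j) ^ (-u) + ω (x.2 j) ^ (-s) *
                  (ν * (∑ m, ω (Function.update x.2 j q m)) ^ (s - u)))⁻¹ *
                (‖vhat q‖ ^ 2 * ω q ^ (-s) / freeSymbol ω (emit ℓ x q)) := by
              simp only [tauWeight]
              rw [← hν, Real.rpow_neg hq0.le s, div_eq_mul_inv, mul_inv, mul_inv]
              ring
            rw [this]
            gcongr
        _ ≤ ENNReal.ofReal (h j) * ENNReal.ofReal (C1 * Ω ^ (-u)) := by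
            rw [lintegral_const_mul' _ _ ENNReal.ofReal_ne_top]
            gcongr
            exact h1 (x.1 ℓ) Ω _ hΩ0 (hR ℓ x)
        _ = _ := by rw [ENNReal.ofReal_mul (hh0 j)]
    refine (Finset.sum_le_sum fun j _ => hterm j).trans ?_
    rw [← ENNReal.ofReal_sum_of_nonneg fun j _ => mul_nonneg (hh0 j) (by positivity)]
    refine ENNReal.ofReal_le_ofReal ?_
    have hsum : ∑ j, h j ≤ (2 ^ (1 - u) + 2 ^ (s - u)) * Ω ^ u := by
      have hS := sum_rpow_le_card_rpow_mul (fun j => hω1 (x.2 j)) hs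
      rw [hh, Finset.sum_add_distrib, ← Finset.mul_sum, ← Finset.mul_sum, ← hΩ]
      have e1 : Ω ^ (u - 1) * Ω = Ω ^ u := by
        rw [← Real.rpow_add_one hΩ0.ne']; congr 1; ring
      have e2 : Ω ^ (u - s) * Ω ^ s = Ω ^ u := by
        rw [← Real.rpow_add hΩ0]; congr 1; ring
      calc _ ≤ 2 ^ (1 - u) * Ω ^ (u - 1) * Ω +
            2 ^ (s - u) * Ω ^ (u - s) * ν⁻¹ * (ν * Ω ^ s) := by gcongr
        _ = 2 ^ (1 - u) * (Ω ^ (u - 1) * Ω) + 2 ^ (s - u) * (Ω ^ (u - s) * Ω ^ s) := by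
            field_simp
        _ = _ := by rw [e1, e2]; ring
    rw [← Finset.sum_mul]
    calc _ ≤ (2 ^ (1 - u) + 2 ^ (s - u)) * Ω ^ u * (C1 * Ω ^ (-u)) := by gcongr
      _ = C1 * (2 ^ (1 - u) + 2 ^ (s - u)) * (Ω ^ u * Ω ^ (-u)) := by ring
      _ = C1 * (2 ^ (1 - u) + 2 ^ (s - u)) := by
          rw [← Real.rpow_add hΩ0, add_neg_cancel, Real.rpow_zero, mul_one]
      _ ≤ Cm := le_max_left _ _
  · set Ω := ∑ m, ω (y.2 m) with hΩ
    have hΩ1' : 1 ≤ Ω := hΩ1 y.2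
    have hΩ0 : 0 < Ω := one_pos.trans_le hΩ1'
    have hb0 : 0 < ν * Ω ^ (s - u) := by positivity
    have hterm : ∀ j, ∫⁻ q, ENNReal.ofReal (‖vhat q‖ ^ 2 *
        tauWeight ω s u j (termMap ((i, ℓ), some j) (y, q)) / (freeSymbol ω (emit i y q))) ≤
          ENNReal.ofReal (ω (y.2 j) ^ s *
            (C2 * Ω ^ (-u2) + ν * Ω ^ (s - u) * (C1 * Ω ^ (-u)))) := by
      intro j
      have hj := hω0 (y.2 j)
      have hA : ∀ q, 0 ≤ ‖vhat q‖ ^ 2 * ω q ^ (-u) / freeSymbol ω (emit i y q) := fun q => by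
        have := hω0 q; have := hRpos i y q; positivity
      have hB : ∀ q, 0 ≤ ‖vhat q‖ ^ 2 * ω q ^ (-s) / freeSymbol ω (emit i y q) := fun q => by
        have := hω0 q; have := hRpos i y q; positivity
      have hmA : Measurable fun q => ENNReal.ofReal
          (‖vhat q‖ ^ 2 * ω q ^ (-u) / freeSymbol ω (emit i y q)) := by
        have := (measurable_freeSymbol_emit hωm i).comp (measurable_prodMk_left (x := y))
        exact (((hvm.norm.pow_const 2).mul (hωm.pow_const _)).div this).ennreal_ofReal
      calc _ = ∫⁻ q, ENNReal.ofReal (ω (y.2 j) ^ s) * (ENNReal.ofReal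
              (‖vhat q‖ ^ 2 * ω q ^ (-u) / freeSymbol ω (emit i y q)) +
              ENNReal.ofReal (ν * Ω ^ (s - u)) * ENNReal.ofReal
              (‖vhat q‖ ^ 2 * ω q ^ (-s) / freeSymbol ω (emit i y q))) := by
            refine lintegral_congr fun q => ?_
            rw [← ENNReal.ofReal_mul hb0.le, ← ENNReal.ofReal_add (hA q) (mul_nonneg hb0.le (hB q)),
              ← ENNReal.ofReal_mul (by positivity), tauWeight_termMap, ← hν, ← hΩ]
            congr 1
            ring
        _ ≤ ENNReal.ofReal (ω (y.2 j) ^ s) * (ENNReal.ofReal (C2 * Ω ^ (-u2)) +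
              ENNReal.ofReal (ν * Ω ^ (s - u)) * ENNReal.ofReal (C1 * Ω ^ (-u))) := by
            rw [lintegral_const_mul' _ _ ENNReal.ofReal_ne_top, lintegral_add_left hmA,
              lintegral_const_mul' _ _ ENNReal.ofReal_ne_top]
            gcongr
            · exact h2 (y.1 i) Ω _ hΩ0 (hR i y)
            · exact h1 (y.1 i) Ω _ hΩ0 (hR i y)
        _ = _ := by
            rw [← ENNReal.ofReal_mul hb0.le, ← ENNReal.ofReal_add (by positivity) (by positivity),
              ← ENNReal.ofReal_mul (by positivity)]
    refine (Finset.sum_le_sum fun j _ => hterm j).trans ?_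
    rw [← ENNReal.ofReal_sum_of_nonneg fun j _ => by have := hω0 (y.2 j); positivity]
    refine ENNReal.ofReal_le_ofReal ?_
    rw [← Finset.sum_mul]
    have hS := sum_rpow_le_card_rpow_mul (fun j => hω1 (y.2 j)) hs
    rw [← hν, ← hΩ] at hS
    have hsq : (ν * Ω ^ (s - u)) ^ 2 = ν ^ 2 * Ω ^ (2 * (s - u)) := by
      rw [mul_pow, ← Real.rpow_natCast (Ω ^ (s - u)), ← Real.rpow_mul hΩ0.le]
      congr 2; push_cast; ring
    -- Since `u - u2 = (β/2)(s - u)`, the exponents compare as soon as `β ≤ 2`, because `Ω ≥ 1`.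
    have e1 : Ω ^ s * Ω ^ (-u2) ≤ Ω ^ (2 * (s - u)) := by
      rw [← Real.rpow_add hΩ0]
      refine Real.rpow_le_rpow_of_exponent_le hΩ1' ?_
      have : 0 ≤ (2 - β) * (s - u) := mul_nonneg (by linarith) (by linarith)
      nlinarith
    have e2 : Ω ^ s * (Ω ^ (s - u) * Ω ^ (-u)) = Ω ^ (2 * (s - u)) := by
      rw [← Real.rpow_add hΩ0, ← Real.rpow_add hΩ0]; congr 1; ring
    have hνsq : ν ≤ ν ^ 2 := by nlinarith
    calc _ ≤ (ν * Ω ^ s) * (C2 * Ω ^ (-u2) + ν * Ω ^ (s - u) * (C1 * Ω ^ (-u))) := by gcongr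
      _ = C2 * (ν * (Ω ^ s * Ω ^ (-u2))) + C1 * (ν ^ 2 * (Ω ^ s * (Ω ^ (s - u) * Ω ^ (-u)))) := by
          ring
      _ ≤ C2 * (ν ^ 2 * Ω ^ (2 * (s - u))) + C1 * (ν ^ 2 * Ω ^ (2 * (s - u))) := by
          rw [e2]; gcongr
      _ = (C1 + C2) * (ν * Ω ^ (s - u)) ^ 2 := by rw [hsq]; ring
      _ ≤ _ := by gcongr; exact le_max_right _ _

end Estimates

/-! ### The regularised diagonal integrals -/

section Diagonal

variable {d M n : ℕ}

/-- Interpolation between `L ≥ 1` and `L ≥ r²`: it leaves the decay exponent of the inverse free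
anywhere in `[0, 2]`. -/
theorem inv_le_rpow_neg {L r b : ℝ} (hL : 1 ≤ L) (hr : 0 < r) (hrL : r ^ 2 ≤ L) (hb0 : 0 ≤ b)
    (hb2 : b ≤ 2) : L⁻¹ ≤ r ^ (-b) := by
  rw [Real.rpow_neg hr.le]
  apply inv_anti₀ (by positivity)
  calc r ^ b = (r ^ 2) ^ (b / 2) := by
        rw [← Real.rpow_natCast, ← Real.rpow_mul hr.le]; congr 1; push_cast; ring
    _ ≤ L ^ (b / 2) := Real.rpow_le_rpow (by positivity) hrL (by linarith)
    _ ≤ L ^ (1 : ℝ) := Real.rpow_le_rpow_of_exponent_le hL (by linarith)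
    _ = L := Real.rpow_one L

/-- Bound for a difference of resolvents. -/
theorem abs_inv_sub_inv_le {L A W q r : ℝ} (hL : 0 < L) (hA : 0 < A) (hW : 0 < W)
    (hdiff : |A - L| ≤ W + 2 * Real.sqrt W * q)
    (h1 : q ^ 2 + W ≤ 3 * (L + A)) (h2 : r ^ 2 + W ≤ 3 * (L + A)) :
    |1 / L - 1 / A| ≤ 9 * Real.sqrt W *
      (L⁻¹ * (r ^ 2 + W) ^ (-(1 / 2) : ℝ) + A⁻¹ * (q ^ 2 + W) ^ (-(1 / 2) : ℝ)) := by
  set S := L + A with hS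
  have hS0 : 0 < S := by positivity
  -- Writing `1/(LA)` as `(1/L + 1/A)/S` produces two terms, each with a single centre of decay.
  -- Half of the decay of `1/S` pays for the numerator and the other half remains.
  have hid : |1 / L - 1 / A| = |A - L| * ((L⁻¹ + A⁻¹) / S) := by
    have : 1 / L - 1 / A = (A - L) * ((L⁻¹ + A⁻¹) / S) := by
      rw [hS]; field_simp; ring
    rw [this, abs_mul, abs_of_nonneg (a := (L⁻¹ + A⁻¹) / S) (by positivity)]
  have hsq : Real.sqrt W * Real.sqrt W = W := Real.mul_self_sqrt hW.le
  have hnum : W + 2 * Real.sqrt W * q ≤ 3 * Real.sqrt W * Real.sqrt (3 * S) := by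
    have e1 : Real.sqrt W ≤ Real.sqrt (3 * S) := Real.sqrt_le_sqrt (by nlinarith)
    have e2 : q ≤ Real.sqrt (3 * S) := Real.le_sqrt_of_sq_le (by linarith)
    have h0 := Real.sqrt_nonneg W
    have e3 := mul_le_mul_of_nonneg_left e1 h0
    have e4 := mul_le_mul_of_nonneg_left e2 h0
    nlinarith
  have hrp : ∀ t : ℝ, 0 < t → t ≤ 3 * S →
      Real.sqrt (3 * S) / S ≤ 3 * t ^ (-(1 / 2) : ℝ) := by
    intro t ht hts
    have e1 : (3 * S) ^ (-(1 / 2) : ℝ) ≤ t ^ (-(1 / 2) : ℝ) :=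
      Real.rpow_le_rpow_of_nonpos ht hts (by norm_num)
    have e2 : Real.sqrt (3 * S) / S = 3 * (3 * S) ^ (-(1 / 2) : ℝ) := by
      rw [Real.rpow_neg (by positivity), ← Real.sqrt_eq_rpow]
      have : Real.sqrt (3 * S) * Real.sqrt (3 * S) = 3 * S := Real.mul_self_sqrt (by positivity)
      have hp : 0 < Real.sqrt (3 * S) := Real.sqrt_pos.2 (by positivity)
      field_simp
      linarith
    rw [e2]
    linarith
  have hr1 := hrp _ (by positivity) h2
  have hr2 := hrp _ (by positivity) h1
  rw [hid]
  calc |A - L| * ((L⁻¹ + A⁻¹) / S) ≤ (3 * Real.sqrt W * Real.sqrt (3 * S)) * ((L⁻¹ + A⁻¹) / S) := by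
        gcongr
        exact hdiff.trans hnum
    _ = 3 * Real.sqrt W * (L⁻¹ * (Real.sqrt (3 * S) / S) + A⁻¹ * (Real.sqrt (3 * S) / S)) := by ring
    _ ≤ 3 * Real.sqrt W * (L⁻¹ * (3 * (r ^ 2 + W) ^ (-(1 / 2) : ℝ)) +
          A⁻¹ * (3 * (q ^ 2 + W) ^ (-(1 / 2) : ℝ))) := by gcongr
    _ = _ := by ring

theorem freeSymbol_nonneg {ω : E d → ℝ} (hω1 : ∀ k, 1 ≤ ω k) (x : Config d M n) :
    0 ≤ freeSymbol ω x :=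
  add_nonneg (Finset.sum_nonneg fun _ _ => by positivity)
    (Finset.sum_nonneg fun _ _ => zero_le_one.trans (hω1 _))

theorem freeSymbol_emit_eq (ω : E d → ℝ) (ℓ : Fin M) (x : Config d M n) (q : E d) :
    freeSymbol ω (emit ℓ x q) =
      freeSymbol ω x - ‖x.1 ℓ‖ ^ 2 + ‖q - x.1 ℓ‖ ^ 2 + ω q := by
  set f : Fin M → ℝ := fun i => ‖(x.1 - Pi.single ℓ q : Fin M → E d) i‖ ^ 2 with hf
  set g : Fin M → ℝ := fun i => ‖x.1 i‖ ^ 2 with hg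
  have h0 : freeSymbol ω (emit ℓ x q) = ∑ i, f i + (∑ j, ω (x.2 j) + ω q) := freeSymbol_emit ω ℓ x q
  have h0' : freeSymbol ω x = ∑ i, g i + ∑ j, ω (x.2 j) := rfl
  have h1 : ∑ i ∈ Finset.univ.erase ℓ, f i = ∑ i ∈ Finset.univ.erase ℓ, g i :=
    Finset.sum_congr rfl fun i hi => by simp [hf, hg, Finset.ne_of_mem_erase hi]
  have h2 : f ℓ = ‖q - x.1 ℓ‖ ^ 2 := by simp [hf, norm_sub_rev]
  have h3 := Finset.add_sum_erase Finset.univ f (Finset.mem_univ ℓ)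
  have h4 := Finset.add_sum_erase Finset.univ g (Finset.mem_univ ℓ)
  have h5 : g ℓ = ‖x.1 ℓ‖ ^ 2 := rfl
  rw [h0, h0']
  linarith

theorem sq_norm_le_freeSymbol {ω : E d → ℝ} (hω1 : ∀ k, 1 ≤ ω k) (x : Config d M n) (ℓ : Fin M) :
    ‖x.1 ℓ‖ ^ 2 ≤ freeSymbol ω x := by
  have h1 : ‖x.1 ℓ‖ ^ 2 ≤ ∑ i, ‖x.1 i‖ ^ 2 :=
    Finset.single_le_sum (f := fun i => ‖x.1 i‖ ^ 2) (fun _ _ => by positivity) (Finset.mem_univ ℓ)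
  have h2 : 0 ≤ ∑ j, ω (x.2 j) := Finset.sum_nonneg fun _ _ => zero_le_one.trans (hω1 _)
  unfold freeSymbol
  linarith

theorem sum_omega_le_freeSymbol {ω : E d → ℝ} (x : Config d M n) :
    ∑ j, ω (x.2 j) ≤ freeSymbol ω x :=
  le_add_of_nonneg_left (Finset.sum_nonneg fun _ _ => by positivity)

/-- The quadratic terms and `ω(q)` cancel in the difference of the denominators, leaving `2⟨q, p⟩ -
L(x)` with `p = x.1 ℓ`: linear in `q`, and bounded by `W + 2 √W |q|` for `W = 1 + L(x)`. -/
theorem abs_diagIntegrand_le {vhat : E d → ℂ} {ω : E d → ℝ} (hω1 : ∀ k, 1 ≤ ω k) (ℓ : Fin M)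
    (x : Config d M n) (q : E d) :
    |diagIntegrand vhat ω ℓ x q| ≤ ‖vhat q‖ ^ 2 * (9 * Real.sqrt (1 + freeSymbol ω x) *
      ((freeSymbol ω (emit ℓ x q))⁻¹ *
          (‖q - x.1 ℓ‖ ^ 2 + (1 + freeSymbol ω x)) ^ (-(1 / 2) : ℝ) +
        (‖q‖ ^ 2 + ω q)⁻¹ * (‖q‖ ^ 2 + (1 + freeSymbol ω x)) ^ (-(1 / 2) : ℝ))) := by
  have hx0 := freeSymbol_nonneg hω1 x
  have hp := sq_norm_le_freeSymbol hω1 x ℓ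
  have hq := hω1 q
  have he := freeSymbol_emit_eq ω ℓ x q
  have hexp : ‖q - x.1 ℓ‖ ^ 2 = ‖q‖ ^ 2 - 2 * inner ℝ q (x.1 ℓ) + ‖x.1 ℓ‖ ^ 2 :=
    norm_sub_sq_real _ _
  have hcs : |inner ℝ q (x.1 ℓ)| ≤ ‖q‖ * ‖x.1 ℓ‖ := abs_real_inner_le_norm _ _
  have hpl : ‖x.1 ℓ‖ ≤ Real.sqrt (1 + freeSymbol ω x) := Real.le_sqrt_of_sq_le (by linarith)
  have hcs' : |inner ℝ q (x.1 ℓ)| ≤ Real.sqrt (1 + freeSymbol ω x) * ‖q‖ :=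
    hcs.trans (by rw [mul_comm]; gcongr)
  have hcs2 : |inner ℝ q (x.1 ℓ)| ≤ (‖q‖ ^ 2 + ‖x.1 ℓ‖ ^ 2) / 2 :=
    hcs.trans (by nlinarith [sq_nonneg (‖q‖ - ‖x.1 ℓ‖)])
  have hsqn : 0 ≤ ‖q - x.1 ℓ‖ ^ 2 := by positivity
  -- The energy after emission lacks `|p|²`, while `W` contains it. It is recovered from the two
  -- centres, whence the constant 3 in the comparison with `L + A`.
  have hpar : ‖x.1 ℓ‖ ^ 2 ≤ 2 * ‖q - x.1 ℓ‖ ^ 2 + 2 * ‖q‖ ^ 2 := by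
    have : ‖x.1 ℓ‖ ≤ ‖q - x.1 ℓ‖ + ‖q‖ := by
      have := norm_sub_le q (q - x.1 ℓ)
      rw [sub_sub_cancel] at this
      linarith
    have := pow_le_pow_left₀ (norm_nonneg _) this 2
    nlinarith [sq_nonneg (‖q - x.1 ℓ‖ - ‖q‖)]
  have hqq : 0 ≤ ‖q‖ ^ 2 := by positivity
  rw [diagIntegrand, abs_mul, abs_of_nonneg (a := ‖vhat q‖ ^ 2) (by positivity)]
  refine mul_le_mul_of_nonneg_left ?_ (by positivity)
  refine abs_inv_sub_inv_le ?_ ?_ ?_ ?_ ?_ ?_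
  · linarith
  · positivity
  · linarith
  · rw [he, hexp]
    rw [abs_le] at hcs' ⊢
    constructor <;> nlinarith [hcs'.1, hcs'.2]
  · linarith
  · linarith

theorem measurable_diagIntegrand {vhat : E d → ℂ} {ω : E d → ℝ} (hv : Measurable vhat)
    (hω : Measurable ω) (ℓ : Fin M) :
    Measurable fun z : Config d M n × E d => diagIntegrand vhat ω ℓ z.1 z.2 := by
  have := measurable_freeSymbol_emit (M := M) (n := n) hω ℓ
  unfold diagIntegrand
  fun_prop

/-- The regularised diagonal integrals converge and grow at most like `(1 + L)^e`. -/
theorem exists_diag_bound (hd : 0 < d) {vhat : E d → ℂ} {ω : E d → ℝ} {α β D e : ℝ}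
    (hα : 0 ≤ α) (hβ : 0 ≤ β) (hvm : Measurable vhat) (hωm : Measurable ω)
    (hv : ∀ k, k ≠ 0 → ‖vhat k‖ ≤ ‖k‖ ^ (-α))
    (hω : ∀ k, (1 + ‖k‖ ^ 2) ^ (β / 2) ≤ ω k) (hD : D = d - 2 * α - 2) (hD0 : 0 ≤ D)
    (he0 : 0 < e) (he1 : e < 1 / 2) (heD : D / 2 ≤ e) :
    ∃ C : ℝ, 0 ≤ C ∧ ∀ {M n : ℕ} (ℓ : Fin M) (x : Config d M n),
      Integrable (diagIntegrand vhat ω ℓ x) ∧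
      |∫ q, diagIntegrand vhat ω ℓ x q| ≤ C * (1 + freeSymbol ω x) ^ e := by
  -- Chosen so that `2 * α + b = d - 2 * e`: the integral then scales as `W^{e - 1/2}` and converges
  -- exactly for `0 < e < 1/2`. The bound `b ≤ 2` is `D / 2 ≤ e`.
  set b := 2 + D - 2 * e with hb
  have hb0 : 0 ≤ b := by linarith
  have hb2 : b ≤ 2 := by linarith
  have hω1 := one_le_omega hβ hω
  obtain ⟨C1, hC1, h1⟩ := exists_two_center_bound hd (a := 2 * α) (b := b) (c := 1 / 2)
    (by positivity) hb0 (by norm_num) (by linarith) (by linarith)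
  obtain ⟨C2, hC2, h2⟩ := exists_two_center_bound hd (a := 2 * α + b) (b := 0) (c := 1 / 2)
    (by positivity) le_rfl (by norm_num) (by linarith) (by linarith)
  have hx1 : ((d : ℝ) - (2 * α + b)) / 2 - 1 / 2 = e - 1 / 2 := by linarith
  rw [hx1] at h1
  rw [add_zero, hx1] at h2
  refine ⟨9 * (C1 + C2), by positivity, fun {M n} ℓ x => ?_⟩
  set W := 1 + freeSymbol ω x with hW
  have hW0 : 0 < W := by have := freeSymbol_nonneg hω1 x; positivity
  set s1 : E d → ℝ := fun q =>
    ‖q‖ ^ (-(2 * α)) * ‖q - x.1 ℓ‖ ^ (-b) * (‖q - x.1 ℓ‖ ^ 2 + W) ^ (-(1 / 2) : ℝ) with hs1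
  set s2 : E d → ℝ := fun q =>
    ‖q‖ ^ (-(2 * α + b)) * ‖q - 0‖ ^ (-0 : ℝ) * (‖q - 0‖ ^ 2 + W) ^ (-(1 / 2) : ℝ) with hs2
  have hs10 : ∀ q, 0 ≤ s1 q := fun q => by positivity
  have hs20 : ∀ q, 0 ≤ s2 q := fun q => by positivity
  have hpt : ∀ᵐ q : E d, |diagIntegrand vhat ω ℓ x q| ≤ 9 * Real.sqrt W * (s1 q + s2 q) := by
    filter_upwards [ae_ne_point hd 0, ae_ne_point hd (x.1 ℓ)] with q hq hqp
    refine (abs_diagIntegrand_le hω1 ℓ x q).trans ?_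
    have hq0 : 0 < ‖q‖ := norm_pos_iff.2 hq
    have hr0 : 0 < ‖q - x.1 ℓ‖ := norm_pos_iff.2 (sub_ne_zero.2 hqp)
    have e1 : ‖vhat q‖ ^ 2 ≤ ‖q‖ ^ (-(2 * α)) := by
      have := pow_le_pow_left₀ (norm_nonneg _) (hv q hq) 2
      rwa [← Real.rpow_natCast (‖q‖ ^ (-α)), ← Real.rpow_mul hq0.le,
        show -α * ((2 : ℕ) : ℝ) = -(2 * α) by push_cast; ring] at this
    have hlow := sq_add_le_freeSymbol_emit (ω := ω) ℓ x q
    have hS : 0 ≤ ∑ j, ω (x.2 j) := Finset.sum_nonneg fun _ _ => zero_le_one.trans (hω1 _)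
    have hωq := hω1 q
    have hr2 : 0 ≤ ‖q - x.1 ℓ‖ ^ 2 := by positivity
    have e2 : (freeSymbol ω (emit ℓ x q))⁻¹ ≤ ‖q - x.1 ℓ‖ ^ (-b) :=
      inv_le_rpow_neg (by linarith) hr0 (by linarith) hb0 hb2
    have e3 : (‖q‖ ^ 2 + ω q)⁻¹ ≤ ‖q‖ ^ (-b) :=
      inv_le_rpow_neg (by nlinarith) hq0 (by linarith) hb0 hb2
    have e4 : s2 q = ‖q‖ ^ (-(2 * α)) * (‖q‖ ^ (-b) * (‖q‖ ^ 2 + W) ^ (-(1 / 2) : ℝ)) := by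
      simp only [hs2, sub_zero, neg_zero, Real.rpow_zero, mul_one]
      rw [← mul_assoc, ← Real.rpow_add hq0]
      congr 2; ring
    have hL0 : 0 < freeSymbol ω (emit ℓ x q) := by linarith
    rw [e4, ← hW]
    calc _ ≤ ‖q‖ ^ (-(2 * α)) * (9 * Real.sqrt W *
          (‖q - x.1 ℓ‖ ^ (-b) * (‖q - x.1 ℓ‖ ^ 2 + W) ^ (-(1 / 2) : ℝ) +
            ‖q‖ ^ (-b) * (‖q‖ ^ 2 + W) ^ (-(1 / 2) : ℝ))) := by gcongr
      _ = _ := by simp only [hs1]; ring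
  have hm1 : Measurable fun q => ENNReal.ofReal (s1 q) := by fun_prop
  have hbound : ∫⁻ q, ‖diagIntegrand vhat ω ℓ x q‖ₑ ≤ ENNReal.ofReal (9 * (C1 + C2) * W ^ e) := by
    calc _ ≤ ∫⁻ q, ENNReal.ofReal (9 * Real.sqrt W) *
            (ENNReal.ofReal (s1 q) + ENNReal.ofReal (s2 q)) := by
          refine lintegral_mono_ae ?_
          filter_upwards [hpt] with q hq
          rw [← ENNReal.ofReal_add (hs10 q) (hs20 q), ← ENNReal.ofReal_mul (by positivity),
            Real.enorm_eq_ofReal_abs]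
          exact ENNReal.ofReal_le_ofReal hq
      _ ≤ ENNReal.ofReal (9 * Real.sqrt W) *
            (ENNReal.ofReal (C1 * W ^ (e - 1 / 2)) + ENNReal.ofReal (C2 * W ^ (e - 1 / 2))) := by
          rw [lintegral_const_mul' _ _ ENNReal.ofReal_ne_top, lintegral_add_left hm1]
          gcongr
          · exact h1 (x.1 ℓ) W hW0
          · exact h2 0 W hW0
      _ = _ := by
          rw [← ENNReal.ofReal_add (by positivity) (by positivity),
            ← ENNReal.ofReal_mul (by positivity)]
          congr 1
          have : Real.sqrt W * W ^ (e - 1 / 2) = W ^ e := by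
            rw [Real.sqrt_eq_rpow, ← Real.rpow_add hW0]; congr 1; ring
          rw [← this]; ring
  have hmeas : Measurable (diagIntegrand vhat ω ℓ x) :=
    (measurable_diagIntegrand hvm hωm ℓ).comp (measurable_prodMk_left (x := x))
  refine ⟨⟨hmeas.aestronglyMeasurable, hbound.trans_lt ENNReal.ofReal_lt_top⟩, ?_⟩
  have h3 := (enorm_integral_le_lintegral_enorm (diagIntegrand vhat ω ℓ x)).trans hbound
  rw [Real.enorm_eq_ofReal_abs] at h3
  exact (ENNReal.ofReal_le_ofReal_iff (by positivity)).1 h3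

end Diagonal

/-! ### Assembling the weighted bound for the off-diagonal part -/

section OffDiagonal

variable {d M n : ℕ}

/-- First factor in the Schur test for `T_od`. -/
def schurLeft (vhat : E d → ℂ) (ω : E d → ℝ) (D s u : ℝ) : TermIdx M n → Config d M n × E d → ENNReal
  | ((ℓ, i), none), z => if i = ℓ then 0 else ENNReal.ofReal (Real.sqrt
      (‖vhat z.2‖ ^ 2 / (freeSymbol ω (emit ℓ z.1 z.2) * thetaWeight D ℓ i z)))
  | ((ℓ, _), some j), z => ENNReal.ofReal (Real.sqrt
      (‖vhat z.2‖ ^ 2 / (freeSymbol ω (emit ℓ z.1 z.2) * tauWeight ω s u j z)))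

/-- Second factor in the Schur test for `T_od`. -/
def schurRight (vhat : E d → ℂ) (ω : E d → ℝ) (D s u : ℝ) : TermIdx M n → Config d M n × E d → ENNReal
  | ((ℓ, i), none), z => if i = ℓ then 0 else ENNReal.ofReal (Real.sqrt
      (‖vhat z.2‖ ^ 2 * thetaWeight D ℓ i z / freeSymbol ω (emit ℓ z.1 z.2)))
  | ((ℓ, _), some j), z => ENNReal.ofReal (Real.sqrt
      (‖vhat (z.1.2 j)‖ ^ 2 * tauWeight ω s u j z / freeSymbol ω (emit ℓ z.1 z.2)))

theorem measurable_thetaWeight (D : ℝ) (ℓ i : Fin M) :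
    Measurable (thetaWeight (d := d) (n := n) D ℓ i) := by
  unfold thetaWeight
  fun_prop

theorem measurable_tauWeight {ω : E d → ℝ} (hω : Measurable ω) (s u : ℝ) (j : Fin n) :
    Measurable (tauWeight (M := M) ω s u j) := by
  have h : ∀ m, Measurable fun z : Config d M n × E d => Function.update z.1.2 j z.2 m := fun m =>
    (measurable_pi_apply m).comp ((measurePreserving_exchange (d := d) j).measurable.fst.comp
      ((measurable_snd.comp measurable_fst).prodMk measurable_snd))
  have h2 : Measurable fun z : Config d M n × E d =>
      ∑ m, ω (Function.update z.1.2 j z.2 m) :=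
    Finset.measurable_sum _ fun m _ => hω.comp (h m)
  unfold tauWeight
  fun_prop

theorem measurable_schurLeft {vhat : E d → ℂ} {ω : E d → ℝ} (hv : Measurable vhat)
    (hω : Measurable ω) (D s u : ℝ) (t : TermIdx M n) :
    Measurable (schurLeft vhat ω D s u t) := by
  obtain ⟨⟨ℓ, i⟩, _ | j⟩ := t
  · have h1 := measurable_freeSymbol_emit (M := M) (n := n) hω ℓ
    have h2 := measurable_thetaWeight (d := d) (n := n) D ℓ i
    by_cases hil : i = ℓ
    · have : schurLeft vhat ω D s u (((ℓ, i), none) : TermIdx M n) = fun _ => 0 := by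
        funext z; simp [schurLeft, hil]
      rw [this]; exact measurable_const
    · have : schurLeft vhat ω D s u (((ℓ, i), none) : TermIdx M n) = fun z =>
          ENNReal.ofReal (Real.sqrt
            (‖vhat z.2‖ ^ 2 / (freeSymbol ω (emit ℓ z.1 z.2) * thetaWeight D ℓ i z))) := by
        funext z; simp [schurLeft, hil]
      rw [this]
      fun_prop
  · have h1 := measurable_freeSymbol_emit (M := M) (n := n) hω ℓ
    have h2 := measurable_tauWeight (M := M) hω s u j
    have : schurLeft vhat ω D s u (((ℓ, i), some j) : TermIdx M n) = fun z =>
        ENNReal.ofReal (Real.sqrt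
          (‖vhat z.2‖ ^ 2 / (freeSymbol ω (emit ℓ z.1 z.2) * tauWeight ω s u j z))) := rfl
    rw [this]
    fun_prop

theorem measurable_schurRight {vhat : E d → ℂ} {ω : E d → ℝ} (hv : Measurable vhat)
    (hω : Measurable ω) (D s u : ℝ) (t : TermIdx M n) :
    Measurable (schurRight vhat ω D s u t) := by
  obtain ⟨⟨ℓ, i⟩, _ | j⟩ := t
  · have h1 := measurable_freeSymbol_emit (M := M) (n := n) hω ℓ
    have h2 := measurable_thetaWeight (d := d) (n := n) D ℓ i
    by_cases hil : i = ℓ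
    · have : schurRight vhat ω D s u (((ℓ, i), none) : TermIdx M n) = fun _ => 0 := by
        funext z; simp [schurRight, hil]
      rw [this]; exact measurable_const
    · have : schurRight vhat ω D s u (((ℓ, i), none) : TermIdx M n) = fun z =>
          ENNReal.ofReal (Real.sqrt
            (‖vhat z.2‖ ^ 2 * thetaWeight D ℓ i z / freeSymbol ω (emit ℓ z.1 z.2))) := by
        funext z; simp [schurRight, hil]
      rw [this]
      fun_prop
  · have h1 := measurable_freeSymbol_emit (M := M) (n := n) hω ℓ
    have h2 := measurable_tauWeight (M := M) hω s u j
    have : schurRight vhat ω D s u (((ℓ, i), some j) : TermIdx M n) = fun z =>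
        ENNReal.ofReal (Real.sqrt
          (‖vhat (z.1.2 j)‖ ^ 2 * tauWeight ω s u j z / freeSymbol ω (emit ℓ z.1 z.2))) := rfl
    rw [this]
    fun_prop

theorem ofReal_sqrt_sq {a : ℝ} (ha : 0 ≤ a) :
    ENNReal.ofReal (Real.sqrt a) ^ 2 = ENNReal.ofReal a := by
  rw [← ENNReal.ofReal_pow (Real.sqrt_nonneg _), Real.sq_sqrt ha]

/-- The splitting of a kernel by an arbitrary positive weight `X`, which cancels in the product; `X`
is free to balance the two Schur integrals. -/
theorem enorm_le_ofReal_sqrt_mul {c : ℂ} {a b L X : ℝ} (hL : 0 < L) (hX : 0 < X)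
    (hc : ‖c‖ = a * b / L) :
    ‖c‖ₑ ≤ ENNReal.ofReal (Real.sqrt (a ^ 2 / (L * X))) *
      ENNReal.ofReal (Real.sqrt (b ^ 2 * X / L)) := by
  rw [← ENNReal.ofReal_mul (Real.sqrt_nonneg _), ← Real.sqrt_mul (by positivity), ← ofReal_norm]
  refine ENNReal.ofReal_le_ofReal (Real.le_sqrt_of_sq_le (le_of_eq ?_))
  rw [hc]
  field_simp

theorem freeSymbol_emit_pos {ω : E d → ℝ} (hω1 : ∀ k, 1 ≤ ω k) (ℓ : Fin M) (x : Config d M n)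
    (q : E d) : 0 < freeSymbol ω (emit ℓ x q) := by
  have h1 := sq_add_le_freeSymbol_emit (ω := ω) ℓ x q
  have h2 := hω1 q
  have h3 : 0 ≤ ∑ j, ω (x.2 j) := Finset.sum_nonneg fun _ _ => zero_le_one.trans (hω1 _)
  have h4 : 0 ≤ ‖q - x.1 ℓ‖ ^ 2 := by positivity
  linarith

theorem enorm_termKernel_le {vhat : E d → ℂ} {ω : E d → ℝ} (hω1 : ∀ k, 1 ≤ ω k) (D s u : ℝ)
    (t : TermIdx M n) (z : Config d M n × E d) :
    ‖termKernel vhat ω t z‖ₑ ≤ schurLeft vhat ω D s u t z * schurRight vhat ω D s u t z := by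
  obtain ⟨⟨ℓ, i⟩, _ | j⟩ := t
  · have hL := freeSymbol_emit_pos hω1 ℓ z.1 z.2
    by_cases hil : i = ℓ
    · simp [termKernel, schurLeft, hil]
    · simp only [termKernel, schurLeft, schurRight, hil, if_false]
      refine enorm_le_ofReal_sqrt_mul hL (thetaWeight_pos D ℓ i z) ?_
      rw [norm_div, Complex.norm_real, Complex.norm_real, Real.norm_of_nonneg (by positivity),
        Real.norm_of_nonneg hL.le, sq]
  · have hL := freeSymbol_emit_pos hω1 ℓ z.1 z.2
    simp only [termKernel, schurLeft, schurRight]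
    refine enorm_le_ofReal_sqrt_mul hL (tauWeight_pos hω1 s u j z) ?_
    rw [norm_div, norm_mul, RCLike.norm_conj, Complex.norm_real, Real.norm_of_nonneg hL.le]

/-- Weighted `L²` bound for `T_od`, uniform in the number of bosons. -/
theorem exists_kernelMass_bound (hd : 0 < d) (M : ℕ) {vhat : E d → ℂ} {ω : E d → ℝ}
    {α β D s u u2 : ℝ}
    (hα : 0 ≤ α) (hβ : 0 ≤ β) (hβ2 : β ≤ 2) (hvm : Measurable vhat) (hωm : Measurable ω)
    (hv : ∀ k, k ≠ 0 → ‖vhat k‖ ≤ ‖k‖ ^ (-α))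
    (hω : ∀ k, (1 + ‖k‖ ^ 2) ^ (β / 2) ≤ ω k) (hD : D = d - 2 * α - 2) (hD0 : 0 ≤ D) (hD1 : D < 1)
    (hs : 0 < s) (hu : u = β / 2 * s - D / 2) (hu2 : u2 = β / 2 * u - D / 2) (hu1 : u < 1)
    (hu2pos : 0 < u2) :
    ∃ C : ℝ, 0 ≤ C ∧ ∀ (n : ℕ) (φ : Config d M n → ℂ), Measurable φ →
      ∫⁻ x, kernelMass volume (termKernel vhat ω) termMap φ x ^ 2 ≤
        ENNReal.ofReal C * ∫⁻ x, ENNReal.ofReal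
          ((((n : ℝ) + 1) ^ max 0 (1 - s) * (1 + freeSymbol ω x) ^ (s - u)) ^ 2) * ‖φ x‖ₑ ^ 2 := by
  have hω1 := one_le_omega hβ hω
  have hω0 : ∀ k, 0 ≤ ω k := fun k => zero_le_one.trans (hω1 k)
  obtain ⟨C1, hC1, h1⟩ := exists_theta_bound hd hα hβ hv hω hD hD0 hD1
  obtain ⟨C2, hC2, h2⟩ := exists_tau_bound hd hα hβ hβ2 hvm hωm hv hω hD hD0 hs hu hu2 hu1 hu2pos
  -- Each ordered pair of sources contributes at most `C1` from its own term and `C2` from all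
  -- boson-exchange terms together.
  set A : ℝ := ((M : ℝ) * M) * (C1 + C2) with hA
  have hA0 : 0 ≤ A := by positivity
  have hcard : ∀ c : ENNReal, ∑ _p : Fin M × Fin M, c = ENNReal.ofReal ((M : ℝ) * M) * c := by
    intro c
    rw [Finset.sum_const, Finset.card_univ, Fintype.card_prod, Fintype.card_fin, nsmul_eq_mul]
    congr 1
    rw [← Nat.cast_mul, ENNReal.ofReal_natCast]
  refine ⟨A * A, by positivity, fun n φ hφ => ?_⟩
  set w : Config d M n → ℝ := fun x =>
    ((n : ℝ) + 1) ^ max 0 (1 - s) * (1 + freeSymbol ω x) ^ (s - u) with hw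
  have hfirst : ∀ x : Config d M n,
      ∑ t : TermIdx M n, ∫⁻ q, schurLeft vhat ω D s u t (x, q) ^ 2 ≤ ENNReal.ofReal A := by
    intro x
    rw [Fintype.sum_prod_type, hA, ENNReal.ofReal_mul (by positivity), ← hcard]
    refine Finset.sum_le_sum fun p _ => ?_
    obtain ⟨ℓ, i⟩ := p
    rw [Fintype.sum_option, ENNReal.ofReal_add hC1 hC2]
    refine add_le_add ?_ ?_
    · by_cases hil : i = ℓ
      · simp [schurLeft, hil]
      · refine le_trans (le_of_eq (lintegral_congr fun q => ?_)) ((h1 ℓ i hil).1 x)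
        simp only [schurLeft, hil, if_false]
        have := freeSymbol_emit_pos hω1 ℓ x q
        have := thetaWeight_pos D ℓ i (x, q)
        exact ofReal_sqrt_sq (by positivity)
    · refine le_trans (le_of_eq (Finset.sum_congr rfl fun j _ => lintegral_congr fun q => ?_))
        ((h2 ℓ i).1 x)
      simp only [schurLeft]
      have := freeSymbol_emit_pos hω1 ℓ x q
      have := tauWeight_pos hω1 s u j (x, q)
      exact ofReal_sqrt_sq (by positivity)
  have hsecond : ∀ y : Config d M n,
      ∑ t : TermIdx M n, ∫⁻ q, schurRight vhat ω D s u t (termMap (swapIdx M n t) (y, q)) ^ 2 ≤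
        ENNReal.ofReal A * ENNReal.ofReal (w y ^ 2) := by
    intro y
    have hL0 := freeSymbol_nonneg hω1 y
    -- `2 (s - u) = (2 - β) s + D`, so the growth `(1 + L)^D` of the two-source terms is already
    -- covered by the weight.
    have hb : D ≤ 2 * (s - u) := by nlinarith
    have hw1 : (1 + freeSymbol ω y) ^ D ≤ w y ^ 2 := by
      have e1 : (1 : ℝ) ≤ ((n : ℝ) + 1) ^ max 0 (1 - s) :=
        Real.one_le_rpow (by linarith [Nat.cast_nonneg (α := ℝ) n]) (le_max_left _ _)
      have e2 : (1 + freeSymbol ω y) ^ D ≤ ((1 + freeSymbol ω y) ^ (s - u)) ^ 2 := by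
        rw [← Real.rpow_natCast ((1 + freeSymbol ω y) ^ (s - u)), ← Real.rpow_mul (by positivity)]
        exact Real.rpow_le_rpow_of_exponent_le (by linarith) (by push_cast; linarith)
      refine e2.trans (pow_le_pow_left₀ (by positivity) ?_ 2)
      exact le_mul_of_one_le_left (by positivity) e1
    rw [Fintype.sum_prod_type, hA, ENNReal.ofReal_mul (by positivity), mul_assoc, ← hcard]
    refine Finset.sum_le_sum fun p _ => ?_
    obtain ⟨ℓ, i⟩ := p
    rw [Fintype.sum_option, ENNReal.ofReal_add hC1 hC2, add_mul, ← ENNReal.ofReal_mul hC1,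
      ← ENNReal.ofReal_mul hC2]
    refine add_le_add ?_ ?_
    · by_cases hil : i = ℓ
      · simp [schurRight, hil]
      · refine (le_trans (le_of_eq (lintegral_congr fun q => ?_)) ((h1 ℓ i hil).2 y)).trans ?_
        · have hf : freeSymbol ω (emit ℓ (termMap (((i, ℓ), none) : TermIdx M n) (y, q)).1
              (termMap (((i, ℓ), none) : TermIdx M n) (y, q)).2) = freeSymbol ω (emit i y q) :=
            freeSymbol_emit_termMap ω (((i, ℓ), none) : TermIdx M n) (y, q)
          change schurRight vhat ω D s u ((ℓ, i), none)
            (termMap (((i, ℓ), none) : TermIdx M n) (y, q)) ^ 2 = _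
          simp only [schurRight, hil, if_false]
          rw [hf]
          have := freeSymbol_emit_pos hω1 i y q
          have := thetaWeight_pos D ℓ i (termMap (((i, ℓ), none) : TermIdx M n) (y, q))
          rw [ofReal_sqrt_sq (by positivity)]
          rfl
        · refine ENNReal.ofReal_le_ofReal (mul_le_mul_of_nonneg_left (le_trans ?_ hw1) hC1)
          have := sq_norm_le_freeSymbol hω1 y ℓ
          gcongr
    · refine (le_trans (le_of_eq (Finset.sum_congr rfl fun j _ => lintegral_congr fun q => ?_))
        ((h2 ℓ i).2 y)).trans ?_
      · have hf : freeSymbol ω (emit ℓ (termMap (((i, ℓ), some j) : TermIdx M n) (y, q)).1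
              (termMap (((i, ℓ), some j) : TermIdx M n) (y, q)).2) = freeSymbol ω (emit i y q) :=
            freeSymbol_emit_termMap ω (((i, ℓ), some j) : TermIdx M n) (y, q)
        have hq : (termMap (((i, ℓ), some j) : TermIdx M n) (y, q)).1.2 j = q := by
          simp [termMap]
        change schurRight vhat ω D s u ((ℓ, i), some j)
            (termMap (((i, ℓ), some j) : TermIdx M n) (y, q)) ^ 2 = _
        simp only [schurRight]
        rw [hf, hq]
        have := freeSymbol_emit_pos hω1 i y q
        have := tauWeight_pos hω1 s u j (termMap (((i, ℓ), some j) : TermIdx M n) (y, q))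
        rw [ofReal_sqrt_sq (by positivity)]
      · have hS0 : 0 ≤ ∑ m, ω (y.2 m) := Finset.sum_nonneg fun _ _ => hω0 _
        have hS := sum_omega_le_freeSymbol (ω := ω) y
        have hb0 : 0 ≤ s - u := by linarith
        have hm0 : 0 ≤ max 0 (1 - s) := le_max_left _ _
        refine ENNReal.ofReal_le_ofReal (mul_le_mul_of_nonneg_left ?_ hC2)
        have hn1 : (n : ℝ) ≤ n + 1 := by linarith
        have hS1 : ∑ m, ω (y.2 m) ≤ 1 + freeSymbol ω y := by linarith
        simp only [hw]
        gcongr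
  have hmain := lintegral_kernelMass_sq_le (μ := (volume : Measure (Config d M n)))
    (ν := (volume : Measure (E d))) (κ := termKernel vhat ω) (S := termMap)
    measurePreserving_termMap (swapIdx M n) termMap_swapIdx
    (measurable_schurLeft hvm hωm D s u) (measurable_schurRight hvm hωm D s u)
    (enorm_termKernel_le hω1 D s u) hfirst hsecond hφ
  refine hmain.trans (le_of_eq ?_)
  simp only [mul_assoc]
  rw [lintegral_const_mul' _ _ ENNReal.ofReal_ne_top, ENNReal.ofReal_mul hA0, mul_assoc]

end OffDiagonal

/-! ### Building vectors of the Fock space and density of multiplier domains -/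

section FockVectors

variable {d M : ℕ}

theorem measurable_component (φ : Fock d M) (n : ℕ) : Measurable (component φ n) :=
  (Lp.stronglyMeasurable _).measurable

theorem component_permBosons (φ : Fock d M) (n : ℕ) (σ : Equiv.Perm (Fin n)) :
    ∀ᵐ x, component φ n (permBosons σ x) = component φ n x :=
  (φ n).2 σ

theorem lintegral_enorm_sq_Lp {X : Type*} [MeasurableSpace X] {μ : Measure X} (f : Lp ℂ 2 μ) :
    ∫⁻ x, ‖f x‖ₑ ^ 2 ∂μ = ENNReal.ofReal (‖f‖ ^ 2) := by
  have h := eLpNorm_nnreal_pow_eq_lintegral (f := f) (μ := μ) (p := 2) two_ne_zero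
  simp only [NNReal.coe_ofNat, ENNReal.rpow_ofNat] at h
  rw [← h, ENNReal.ofReal_pow (norm_nonneg _), ofReal_norm, Lp.enorm_def]
  rfl

theorem lintegral_component_sq (φ : Fock d M) (n : ℕ) :
    ∫⁻ x, ‖component φ n x‖ₑ ^ 2 = ENNReal.ofReal (‖φ n‖ ^ 2) :=
  lintegral_enorm_sq_Lp _

theorem summable_norm_sq (φ : Fock d M) : Summable fun n => ‖φ n‖ ^ 2 := by
  have := (memℓp_gen_iff (by norm_num)).1 (lp.memℓp φ)
  simpa using this

theorem memLp_two_of_lintegral_sq {X : Type*} [MeasurableSpace X] {μ : Measure X} {f : X → ℂ}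
    (hf : Measurable f) (h : ∫⁻ x, ‖f x‖ₑ ^ 2 ∂μ ≠ ⊤) : MemLp f 2 μ := by
  refine ⟨hf.aestronglyMeasurable, ?_⟩
  have h2 := eLpNorm_nnreal_pow_eq_lintegral (f := f) (μ := μ) (p := 2) two_ne_zero
  simp only [NNReal.coe_ofNat, ENNReal.rpow_ofNat] at h2
  rw [← h2] at h
  by_contra hc
  rw [not_lt, top_le_iff] at hc
  exact h (by rw [show ((2 : NNReal) : ENNReal) = 2 from rfl, hc]; simp)

/-- Construction of a Fock space vector from its components. -/
theorem exists_fock_of_components {f : ∀ n, Config d M n → ℂ} (hf : ∀ n, Measurable (f n))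
    (hsymm : ∀ n (σ : Equiv.Perm (Fin n)), ∀ᵐ x, f n (permBosons σ x) = f n x) {c : ℕ → ℝ}
    (hc0 : ∀ n, 0 ≤ c n) (hc : Summable c)
    (hfc : ∀ n, ∫⁻ x, ‖f n x‖ₑ ^ 2 ≤ ENNReal.ofReal (c n)) :
    ∃ χ : Fock d M, ∀ n, component χ n =ᵐ[volume] f n := by
  have hmem : ∀ n, MemLp (f n) 2 (volume : Measure (Config d M n)) := fun n =>
    memLp_two_of_lintegral_sq (hf n) ((hfc n).trans_lt ENNReal.ofReal_lt_top).ne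
  have hsec : ∀ n, (hmem n).toLp (f n) ∈ sector d M n := by
    intro n σ
    have h1 := (hmem n).coeFn_toLp
    filter_upwards [hsymm n σ, h1,
      (measurePreserving_permBosons σ).quasiMeasurePreserving.ae h1] with x e1 e2 e3
    rw [e3, e2, e1]
  set F : ∀ n, sector d M n := fun n => ⟨(hmem n).toLp (f n), hsec n⟩ with hF
  have hnorm : ∀ n, ‖F n‖ ^ 2 ≤ c n := by
    intro n
    have h1 : ∫⁻ x, ‖(hmem n).toLp (f n) x‖ₑ ^ 2 = ∫⁻ x, ‖f n x‖ₑ ^ 2 := by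
      refine lintegral_congr_ae ?_
      filter_upwards [(hmem n).coeFn_toLp] with x hx
      rw [hx]
    have h2 := hfc n
    rw [← h1, lintegral_enorm_sq_Lp] at h2
    exact (ENNReal.ofReal_le_ofReal_iff (hc0 n)).1 h2
  have hmemℓ : Memℓp F 2 := by
    rw [memℓp_gen_iff (by norm_num)]
    have : Summable fun n => ‖F n‖ ^ 2 :=
      Summable.of_nonneg_of_le (fun n => by positivity) hnorm hc
    simpa using this
  exact ⟨⟨F, hmemℓ⟩, fun n => (hmem n).coeFn_toLp⟩

theorem fock_ext {φ ψ : Fock d M} (h : ∀ n, component φ n =ᵐ[volume] component ψ n) : φ = ψ := by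
  refine lp.ext (funext fun n => Subtype.ext (Lp.ext (h n)))

/-- The sector is the common fixed-point set of the isometries induced by relabelling. Completeness
of the sectors is needed to characterise density by a trivial orthogonal complement. -/
theorem isClosed_sector (d M n : ℕ) : 
    IsClosed (sector d M n : Set (Lp ℂ 2 (volume : Measure (Config d M n)))) := by
  have hset : (sector d M n : Set (Lp ℂ 2 (volume : Measure (Config d M n)))) =
      ⋂ σ : Equiv.Perm (Fin n),
        {f | Lp.compMeasurePreserving (permBosons σ) (measurePreserving_permBosons σ) f = f} := by
    ext f
    rw [Set.mem_iInter]
    refine forall_congr' fun σ => ?_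
    have hc := Lp.coeFn_compMeasurePreserving f (measurePreserving_permBosons (d := d) (M := M) σ)
    constructor
    · intro h
      refine Lp.ext ?_
      filter_upwards [hc, h] with x e1 e2
      rw [e1, ← e2, Function.comp_apply]
    · intro h
      rw [Set.mem_ofPred_eq] at h
      rw [h] at hc
      filter_upwards [hc] with x e1
      exact e1.symm
  rw [hset]
  refine isClosed_iInter fun σ => isClosed_eq ?_ continuous_id
  exact (Lp.isometry_compMeasurePreserving _).continuous

instance completeSpace_sector (d M n : ℕ) : CompleteSpace (sector d M n) :=
  (isClosed_sector d M n).isComplete.completeSpace_coe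

theorem component_add (φ ψ : Fock d M) (n : ℕ) :
    component (φ + ψ) n =ᵐ[volume] component φ n + component ψ n :=
  Lp.coeFn_add _ _

theorem component_smul (c : ℂ) (φ : Fock d M) (n : ℕ) :
    component (c • φ) n =ᵐ[volume] c • component φ n :=
  Lp.coeFn_smul _ _

theorem inner_component (φ ψ : Fock d M) (n : ℕ) :
    inner ℂ (φ n) (ψ n) = ∫ x, starRingEnd ℂ (component φ n x) * component ψ n x := by
  rw [Submodule.coe_inner, L2.inner_def]
  refine integral_congr_ae (Filter.Eventually.of_forall fun x => ?_)
  simp only [RCLike.inner_apply]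
  exact mul_comm _ _

theorem memLp_component (φ : Fock d M) (n : ℕ) : MemLp (component φ n) 2 volume :=
  Lp.memLp _

theorem integrable_conj_mul {X : Type*} [MeasurableSpace X] {μ : Measure X} {f g : X → ℂ}
    (hf : MemLp f 2 μ) (hg : MemLp g 2 μ) : Integrable (fun x => starRingEnd ℂ (f x) * g x) μ :=
  hf.star.integrable_mul hg

/-- A multiplier with measurable symmetric components has dense domain. -/
theorem dense_multiplierDomain {m : ∀ n, Config d M n → ℝ} (hm : ∀ n, Measurable (m n))
    (hσ : ∀ n (σ : Equiv.Perm (Fin n)) x, m n (permBosons σ x) = m n x) :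
    Dense (multiplierDomain m : Set (Fock d M)) := by
  have : CompleteSpace (Fock d M) := lp.completeSpace
  rw [Submodule.dense_iff_topologicalClosure_eq_top, Submodule.topologicalClosure_eq_top_iff,
    Submodule.eq_bot_iff]
  intro φ hφ
  have hpos : ∀ n (x : Config d M n), 0 < 1 + |m n x| := fun n x => by positivity
  have hmeas : ∀ n, Measurable fun x => ((1 + |m n x| : ℝ) : ℂ) := fun n =>
    Complex.measurable_ofReal.comp (measurable_const.add (measurable_abs.comp (hm n)))
  -- One estimate serves `w = 1` and `w = m`: dividing `φ` by `1 + |m|` gives a vector `χ` of the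
  -- domain together with its image `η`.
  have hle : ∀ (z w : ℂ) (t : ℝ), 0 < t → ‖w‖ ≤ t → ‖w * z / (t : ℂ)‖ₑ ^ 2 ≤ ‖z‖ₑ ^ 2 := by
    intro z w t ht hw
    refine pow_le_pow_left' ?_ 2
    rw [enorm_le_iff_norm_le, norm_div, norm_mul, Complex.norm_real, Real.norm_of_nonneg ht.le,
      div_le_iff₀ ht, mul_comm]
    gcongr
  have hφn := summable_norm_sq φ
  obtain ⟨χ, hχ⟩ := exists_fock_of_components (d := d) (M := M)
    (f := fun n x => 1 * component φ n x / ((1 + |m n x| : ℝ) : ℂ))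
    (fun n => (measurable_const.mul (measurable_component φ n)).div (hmeas n))
    (fun n σ => by
      filter_upwards [component_permBosons φ n σ] with x hx
      rw [hx, hσ])
    (fun n => by positivity) hφn
    (fun n => by
      rw [← lintegral_component_sq]
      refine lintegral_mono fun x => hle _ _ _ (hpos n x) ?_
      rw [norm_one]
      linarith [abs_nonneg (m n x)])
  obtain ⟨η, hη⟩ := exists_fock_of_components (d := d) (M := M)
    (f := fun n x => (m n x : ℂ) * component φ n x / ((1 + |m n x| : ℝ) : ℂ))
    (fun n => ((Complex.measurable_ofReal.comp (hm n)).mul (measurable_component φ n)).div (hmeas n))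
    (fun n σ => by
      filter_upwards [component_permBosons φ n σ] with x hx
      rw [hx, hσ])
    (fun n => by positivity) hφn
    (fun n => by
      rw [← lintegral_component_sq]
      refine lintegral_mono fun x => hle _ _ _ (hpos n x) ?_
      rw [Complex.norm_real, Real.norm_eq_abs]
      linarith)
  have hχm : χ ∈ multiplierDomain m := by
    refine ⟨η, fun n => ?_⟩
    filter_upwards [hχ n, hη n] with x e1 e2
    rw [e1, e2]
    ring
  have horth : inner ℂ χ φ = 0 := (Submodule.mem_orthogonal _ _).1 hφ χ hχm
  -- The sector contributions to `⟨χ, φ⟩ = 0` are nonnegative, so all vanish; as the density is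
  -- strictly positive, `φ` vanishes.
  set r : ℕ → ℝ := fun n => ∫ x, ‖component φ n x‖ ^ 2 / (1 + |m n x|) with hr
  have hterm : ∀ n, inner ℂ (χ n) (φ n) = ((r n : ℝ) : ℂ) := by
    intro n
    rw [inner_component, hr, ← integral_complex_ofReal]
    refine integral_congr_ae ?_
    filter_upwards [hχ n] with x e1
    rw [e1, one_mul, map_div₀, Complex.conj_ofReal, div_mul_eq_mul_div, RCLike.conj_mul]
    push_cast
    rfl
  have hr0 : ∀ n, 0 ≤ r n := fun n => integral_nonneg fun x => by positivity
  have hsum : HasSum (fun n => ((r n : ℝ) : ℂ)) 0 := by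
    have := lp.hasSum_inner (𝕜 := ℂ) χ φ
    simp only [hterm] at this
    rwa [horth] at this
  have hsumr : HasSum r 0 := by
    have := Complex.reCLM.hasSum hsum
    simpa using this
  have hr_zero : r = 0 := (hasSum_zero_iff_of_nonneg hr0).1 hsumr
  refine fock_ext fun n => ?_
  have hint : Integrable fun x => ‖component φ n x‖ ^ 2 / (1 + |m n x|) := by
    refine Integrable.mono' ((memLp_two_iff_integrable_sq_norm
      (measurable_component φ n).aestronglyMeasurable).1 (memLp_component φ n)) ?_
      (Filter.Eventually.of_forall fun x => ?_)
    · exact (((measurable_component φ n).norm.pow_const 2).div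
        (measurable_const.add (measurable_abs.comp (hm n)))).aestronglyMeasurable
    · rw [Real.norm_of_nonneg (by positivity)]
      exact div_le_self (by positivity) (by linarith [abs_nonneg (m n x)])
  have hz := (integral_eq_zero_iff_of_nonneg (fun x => by positivity) hint).1
    (congrFun hr_zero n)
  have h0 : component (0 : Fock d M) n =ᵐ[volume] 0 := Lp.coeFn_zero _ _ _
  filter_upwards [hz, h0] with x hx hx0
  rw [hx0]
  have := (div_eq_zero_iff.1 hx).resolve_right (hpos n x).ne'
  simpa using this

end FockVectors

/-! ### From sector estimates to a symmetric operator -/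

section Assembly

variable {d M : ℕ}

theorem enorm_add_sq_le (a b : ENNReal) : (a + b) ^ 2 ≤ 2 * (a ^ 2 + b ^ 2) := by
  have h := ENNReal.rpow_add_le_mul_rpow_add_rpow a b (p := 2) one_le_two
  norm_num at h
  exact h

theorem mul_le_sq_add_sq (a b : ENNReal) : a * b ≤ a ^ 2 + b ^ 2 := by
  rcases le_total a b with h | h
  · calc a * b ≤ b * b := by gcongr
      _ ≤ _ := by rw [sq b]; exact le_add_self
  · calc a * b ≤ a * a := by gcongr
      _ ≤ _ := by rw [sq a]; exact le_self_add

/-- The multiplier of the diagonal part `T_d`. -/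
def diagMultiplier {n : ℕ} (g : ℝ) (vhat : E d → ℂ) (ω : E d → ℝ) (x : Config d M n) : ℝ :=
  -g ^ 2 * ∑ ℓ : Fin M, ∫ q, diagIntegrand vhat ω ℓ x q

/-- `T` in the `n`-boson sector, with the off-diagonal part written as a kernel operator. -/
def sectorOp {n : ℕ} (g : ℝ) (vhat : E d → ℂ) (ω : E d → ℝ) (φ : Config d M n → ℂ)
    (x : Config d M n) : ℂ :=
  (diagMultiplier g vhat ω x : ℂ) * φ x +
    ((-g ^ 2 : ℝ) : ℂ) * kernelOp volume (termKernel vhat ω) termMap φ x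

theorem measurable_diagMultiplier {n : ℕ} (g : ℝ) {vhat : E d → ℂ} {ω : E d → ℝ}
    (hv : Measurable vhat) (hω : Measurable ω) :
    Measurable (diagMultiplier (M := M) (n := n) g vhat ω) := by
  refine Measurable.const_mul (Finset.measurable_sum _ fun ℓ _ => ?_) _
  exact (StronglyMeasurable.integral_prod_right'
    (measurable_diagIntegrand hv hω ℓ).stronglyMeasurable).measurable

theorem diagMultiplier_permBosons {n : ℕ} (g : ℝ) (vhat : E d → ℂ) (ω : E d → ℝ)
    (σ : Equiv.Perm (Fin n)) (x : Config d M n) :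
    diagMultiplier g vhat ω (permBosons σ x) = diagMultiplier g vhat ω x := by
  simp only [diagMultiplier, diagIntegrand, freeSymbol_emit_permBosons]

/-- The integrand as defined and its kernel form evaluate `φ` at relabelled configurations. The null
set where symmetry fails is pulled back along the change of configuration, hence the equality for
almost every `x` and then almost every `q`. -/
theorem ae_tauIntegrand_eq {n : ℕ} (vhat : E d → ℂ) (ω : E d → ℝ) {φ : Config d M n → ℂ}
    (hφ : ∀ σ : Equiv.Perm (Fin n), ∀ᵐ x, φ (permBosons σ x) = φ x) :
    ∀ᵐ x, ∀ (ℓ i : Fin M) (j : Fin n), tauIntegrand vhat ω ℓ i j φ x =ᵐ[volume]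
      fun q => termKernel vhat ω (((ℓ, i), some j) : TermIdx M n) (x, q) *
        φ (termMap (((ℓ, i), some j) : TermIdx M n) (x, q)).1 := by
  refine ae_all_iff.2 fun ℓ => ae_all_iff.2 fun i => ae_all_iff.2 fun j => ?_
  obtain ⟨σ, hσ⟩ := exists_perm_removeNth_snoc (d := d) j
  filter_upwards [ae_comp_fst (measurePreserving_termMap (((ℓ, i), some j) : TermIdx M n))
    (hφ σ)] with x hx
  filter_upwards [hx] with q hq
  rw [← hq]
  have : permBosons σ (termMap (((ℓ, i), some j) : TermIdx M n) (x, q)).1 =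
      (x.1 - Pi.single ℓ q + Pi.single i (x.2 j),
        Fin.removeNth (α := fun _ => E d) j.castSucc (Fin.snoc (α := fun _ => E d) x.2 q)) := by
    refine Prod.ext rfl (funext fun m => ?_)
    exact (hσ x.2 q m).symm
  rw [this]
  simp only [tauIntegrand, termKernel]
  ring

theorem thetaIntegrand_eq {n : ℕ} (vhat : E d → ℂ) (ω : E d → ℝ) (φ : Config d M n → ℂ)
    {ℓ i : Fin M} (hi : i ≠ ℓ) (x : Config d M n) (q : E d) :
    thetaIntegrand vhat ω ℓ i φ x q = termKernel vhat ω (((ℓ, i), none) : TermIdx M n) (x, q) *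
      φ (termMap (((ℓ, i), none) : TermIdx M n) (x, q)).1 := by
  simp only [thetaIntegrand, termKernel, termMap, hi, if_false]
  rw [sub_add]
  ring

theorem ae_sectorOp_eq {n : ℕ} (g : ℝ) {vhat : E d → ℂ} {ω : E d → ℝ} (hv : Measurable vhat)
    (hω : Measurable ω) {φ : Config d M n → ℂ} (hφm : Measurable φ)
    (hφ : ∀ σ : Equiv.Perm (Fin n), ∀ᵐ x, φ (permBosons σ x) = φ x)
    (hdiag : ∀ (ℓ : Fin M) (x : Config d M n), Integrable (diagIntegrand vhat ω ℓ x))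
    (hmass : ∫⁻ x, kernelMass volume (termKernel vhat ω) termMap φ x ^ 2 ≠ ⊤) :
    ∀ᵐ x, TConverges vhat ω φ x ∧
      sectorOp g vhat ω φ x = Tdiag g vhat ω φ x + Toffdiag g vhat ω φ x := by
  have hκ := measurable_termKernel (M := M) (n := n) hv hω
  have hS := fun t : TermIdx M n => (measurePreserving_termMap (d := d) t).measurable
  filter_upwards [ae_kernelMass_lt_top hκ hS hφm hmass, ae_tauIntegrand_eq vhat ω hφ] with x hx htau
  have hint := integrable_of_kernelMass_lt_top hκ hS hφm hx
  refine ⟨⟨fun ℓ => hdiag ℓ x, fun ℓ i hi => ?_, fun ℓ i j => ?_⟩, ?_⟩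
  · have := hint ((ℓ, i), none)
    simpa only [← thetaIntegrand_eq vhat ω φ hi x] using this
  · exact (hint ((ℓ, i), some j)).congr (htau ℓ i j).symm
  · have hK : kernelOp volume (termKernel vhat ω) termMap φ x =
        (∑ ℓ : Fin M, ∑ i ∈ Finset.univ.filter (fun i : Fin M => i ≠ ℓ),
          ∫ q, thetaIntegrand vhat ω ℓ i φ x q) +
        ∑ ℓ : Fin M, ∑ i : Fin M, ∑ j : Fin n, ∫ q, tauIntegrand vhat ω ℓ i j φ x q := by
      rw [kernelOp, Fintype.sum_prod_type, Fintype.sum_prod_type, ← Finset.sum_add_distrib]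
      refine Finset.sum_congr rfl fun ℓ _ => ?_
      rw [Finset.sum_filter, ← Finset.sum_add_distrib]
      refine Finset.sum_congr rfl fun i _ => ?_
      rw [Fintype.sum_option]
      congr 1
      · by_cases hi : i = ℓ
        · simp [termKernel, hi]
        · rw [if_pos hi]
          simp only [thetaIntegrand_eq vhat ω φ hi x]
      · exact Finset.sum_congr rfl fun j _ => (integral_congr_ae (htau ℓ i j)).symm
    rw [sectorOp, hK, Tdiag, Toffdiag, diagMultiplier]
    push_cast
    ring

theorem sectorOp_permBosons {n : ℕ} (g : ℝ) (vhat : E d → ℂ) (ω : E d → ℝ)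
    {φ : Config d M n → ℂ} (σ : Equiv.Perm (Fin n)) (hφ : ∀ᵐ x, φ (permBosons σ x) = φ x) :
    ∀ᵐ x, sectorOp g vhat ω φ (permBosons σ x) = sectorOp g vhat ω φ x := by
  have h := kernelOp_comp (ν := (volume : Measure (E d))) (κ := termKernel vhat ω)
    (S := termMap) measurePreserving_termMap hφ (permIdx M σ)
    (termKernel_permBosons vhat ω σ) (termMap_permBosons σ)
  filter_upwards [h, hφ] with x h1 h2
  rw [sectorOp, sectorOp, h1, h2, diagMultiplier_permBosons]

theorem measurable_sectorOp {n : ℕ} (g : ℝ) {vhat : E d → ℂ} {ω : E d → ℝ} (hv : Measurable vhat)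
    (hω : Measurable ω) {φ : Config d M n → ℂ} (hφ : Measurable φ) :
    Measurable (sectorOp g vhat ω φ) :=
  ((Complex.measurable_ofReal.comp (measurable_diagMultiplier g hv hω)).mul hφ).add
    ((measurable_kernelOp (measurable_termKernel hv hω)
      (fun t => (measurePreserving_termMap t).measurable) hφ).const_mul _)

/-- Symmetry of `T` in one sector. -/
theorem integral_sectorOp_symm {n : ℕ} (g : ℝ) {vhat : E d → ℂ} {ω : E d → ℝ}
    (hv : Measurable vhat) (hω : Measurable ω) {φ ψ : Config d M n → ℂ} (hφm : Measurable φ)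
    (hψm : Measurable ψ) (hφ2 : MemLp φ 2 volume) (hψ2 : MemLp ψ 2 volume)
    (hψsq : ∫⁻ x, ‖ψ x‖ₑ ^ 2 ≠ ⊤)
    (hdφ : MemLp (fun x => (diagMultiplier g vhat ω x : ℂ) * φ x) 2 volume)
    (hdψ : MemLp (fun x => (diagMultiplier g vhat ω x : ℂ) * ψ x) 2 volume)
    (hKφ : ∫⁻ x, kernelMass volume (termKernel vhat ω) termMap φ x ^ 2 ≠ ⊤)
    (hKψ : ∫⁻ x, kernelMass volume (termKernel vhat ω) termMap ψ x ^ 2 ≠ ⊤) :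
    ∫ x, starRingEnd ℂ (sectorOp g vhat ω φ x) * ψ x =
      ∫ x, starRingEnd ℂ (φ x) * sectorOp g vhat ω ψ x := by
  have hκ := measurable_termKernel (M := M) (n := n) hv hω
  have hS := fun t : TermIdx M n => (measurePreserving_termMap (d := d) t).measurable
  have hKmem : ∀ {χ : Config d M n → ℂ}, Measurable χ →
      ∫⁻ x, kernelMass volume (termKernel vhat ω) termMap χ x ^ 2 ≠ ⊤ →
      MemLp (kernelOp volume (termKernel vhat ω) termMap χ) 2 volume := by
    intro χ hχ hfin
    refine memLp_two_of_lintegral_sq (measurable_kernelOp hκ hS hχ) (ne_top_of_le_ne_top hfin ?_)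
    exact lintegral_mono fun x => pow_le_pow_left' (enorm_kernelOp_le _ _) 2
  -- Square-integrability of `ψ` and of the absolute kernel integral gives the absolute convergence
  -- that justifies Fubini.
  have hfin : ∫⁻ x, ‖ψ x‖ₑ * kernelMass volume (termKernel vhat ω) termMap φ x ≠ ⊤ := by
    refine ne_top_of_le_ne_top (ENNReal.add_ne_top.2 ⟨hψsq, hKφ⟩) ?_
    rw [← lintegral_add_left (hψm.enorm.pow_const 2)]
    exact lintegral_mono fun x => mul_le_sq_add_sq _ _
  have hsymm := integral_kernelOp_symm hκ measurePreserving_termMap (swapIdx M n)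
    termMap_swapIdx (termKernel_swapIdx vhat ω) hφm hψm hfin
  have i1 := integrable_conj_mul hdφ hψ2
  have i2 := (integrable_conj_mul (hKmem hφm hKφ) hψ2).const_mul ((-g ^ 2 : ℝ) : ℂ)
  have i3 := integrable_conj_mul hφ2 hdψ
  have i4 := (integrable_conj_mul hφ2 (hKmem hψm hKψ)).const_mul ((-g ^ 2 : ℝ) : ℂ)
  have e1 : ∀ x, starRingEnd ℂ (sectorOp g vhat ω φ x) * ψ x =
      starRingEnd ℂ ((diagMultiplier g vhat ω x : ℂ) * φ x) * ψ x +
        ((-g ^ 2 : ℝ) : ℂ) *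
          (starRingEnd ℂ (kernelOp volume (termKernel vhat ω) termMap φ x) * ψ x) := by
    intro x
    simp only [sectorOp, map_add, map_mul, Complex.conj_ofReal]
    ring
  have e2 : ∀ x, starRingEnd ℂ (φ x) * sectorOp g vhat ω ψ x =
      starRingEnd ℂ (φ x) * ((diagMultiplier g vhat ω x : ℂ) * ψ x) +
        ((-g ^ 2 : ℝ) : ℂ) *
          (starRingEnd ℂ (φ x) * kernelOp volume (termKernel vhat ω) termMap ψ x) := by
    intro x
    simp only [sectorOp]
    ring
  simp only [e1, e2]
  rw [integral_add i1 i2, integral_add i3 i4, integral_const_mul, integral_const_mul, hsymm]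
  congr 1
  refine integral_congr_ae (Filter.Eventually.of_forall fun x => ?_)
  simp only [map_mul, Complex.conj_ofReal]
  ring

/-- The graph norm of a multiplier controls the weighted norm. -/
theorem lintegral_weight_sq_le {m : ∀ n, Config d M n → ℝ} {φ η : Fock d M}
    (hη : ∀ n, ∀ᵐ x, component η n x = (m n x : ℂ) * component φ n x) (n : ℕ) :
    ∫⁻ x, ENNReal.ofReal ((1 + |m n x|) ^ 2) * ‖component φ n x‖ₑ ^ 2 ≤
      ENNReal.ofReal (2 * (‖φ n‖ ^ 2 + ‖η n‖ ^ 2)) := by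
  calc _ ≤ ∫⁻ x, 2 * (‖component φ n x‖ₑ ^ 2 + ‖component η n x‖ₑ ^ 2) := by
        refine lintegral_mono_ae ?_
        filter_upwards [hη n] with x hx
        refine le_trans (le_of_eq ?_) (enorm_add_sq_le _ _)
        have habs : ‖((m n x : ℝ) : ℂ)‖ₑ = ENNReal.ofReal |m n x| := by
          rw [← ofReal_norm, Complex.norm_real, Real.norm_eq_abs]
        rw [hx, enorm_mul, habs, ENNReal.ofReal_pow (by positivity), ← mul_pow,
          ENNReal.ofReal_add zero_le_one (abs_nonneg _), ENNReal.ofReal_one, add_mul, one_mul]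
    _ = 2 * (ENNReal.ofReal (‖φ n‖ ^ 2) + ENNReal.ofReal (‖η n‖ ^ 2)) := by
        rw [lintegral_const_mul' _ _ ENNReal.ofNat_ne_top,
          lintegral_add_left ((measurable_component φ n).enorm.pow_const 2),
          lintegral_component_sq, lintegral_component_sq]
    _ = _ := by
        rw [← ENNReal.ofReal_add (by positivity) (by positivity), ENNReal.ofReal_mul zero_le_two,
          ENNReal.ofReal_ofNat]
theorem lintegral_sectorOp_sq_le {n : ℕ} (g : ℝ) {vhat : E d → ℂ} {ω : E d → ℝ}
    (hv : Measurable vhat) (hω : Measurable ω) {φ : Config d M n → ℂ} (hφ : Measurable φ)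
    {b₁ b₂ : ℝ} (hb₁ : 0 ≤ b₁) (hb₂ : 0 ≤ b₂)
    (h₁ : ∫⁻ x, ‖(diagMultiplier g vhat ω x : ℂ) * φ x‖ₑ ^ 2 ≤ ENNReal.ofReal b₁)
    (h₂ : ∫⁻ x, kernelMass volume (termKernel vhat ω) termMap φ x ^ 2 ≤ ENNReal.ofReal b₂) :
    ∫⁻ x, ‖sectorOp g vhat ω φ x‖ₑ ^ 2 ≤ ENNReal.ofReal (2 * (b₁ + (g ^ 2) ^ 2 * b₂)) := by
  have hmd : Measurable fun x : Config d M n => ‖(diagMultiplier g vhat ω x : ℂ) * φ x‖ₑ ^ 2 :=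
    (((Complex.measurable_ofReal.comp
      (measurable_diagMultiplier g hv hω)).mul hφ).enorm).pow_const 2
  have hpt : ∀ x, ‖sectorOp g vhat ω φ x‖ₑ ^ 2 ≤
      2 * (‖(diagMultiplier g vhat ω x : ℂ) * φ x‖ₑ ^ 2 +
        ENNReal.ofReal ((g ^ 2) ^ 2) * kernelMass volume (termKernel vhat ω) termMap φ x ^ 2) := by
    intro x
    refine (pow_le_pow_left' (enorm_add_le _ _) 2).trans ((enorm_add_sq_le _ _).trans ?_)
    refine mul_le_mul_right (add_le_add le_rfl ?_) _
    rw [enorm_mul, mul_pow]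
    refine mul_le_mul' (le_of_eq ?_) (pow_le_pow_left' (enorm_kernelOp_le _ _) 2)
    rw [← ofReal_norm, Complex.norm_real, norm_neg, Real.norm_of_nonneg (sq_nonneg g),
      ENNReal.ofReal_pow (sq_nonneg g)]
  refine (lintegral_mono hpt).trans ?_
  rw [lintegral_const_mul' _ _ ENNReal.ofNat_ne_top, lintegral_add_left hmd,
    lintegral_const_mul' _ _ ENNReal.ofReal_ne_top, ENNReal.ofReal_mul zero_le_two,
    ENNReal.ofReal_add hb₁ (by positivity), ENNReal.ofReal_mul (by positivity),
    ENNReal.ofReal_ofNat]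
  exact mul_le_mul_right (add_le_add h₁ (mul_le_mul_right h₂ _)) _

/-- Only almost-everywhere equality is asked of `χ`, since the component of a sum is a new
representative; finite mass is what makes the integrals additive. -/
theorem sectorOp_add_smul {n : ℕ} (g : ℝ) {vhat : E d → ℂ} {ω : E d → ℝ}
    (hv : Measurable vhat) (hω : Measurable ω) {φ ψ χ : Config d M n → ℂ} (hφ : Measurable φ)
    (hψ : Measurable ψ) {z : ℂ} (hχ : χ =ᵐ[volume] φ + z • ψ)
    (h₁ : ∫⁻ x, kernelMass volume (termKernel vhat ω) termMap φ x ^ 2 ≠ ⊤)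
    (h₂ : ∫⁻ x, kernelMass volume (termKernel vhat ω) termMap ψ x ^ 2 ≠ ⊤) :
    sectorOp g vhat ω χ =ᵐ[volume] sectorOp g vhat ω φ + z • sectorOp g vhat ω ψ := by
  have hκ := measurable_termKernel (M := M) (n := n) hv hω
  have hS := fun t : TermIdx M n => (measurePreserving_termMap (d := d) t).measurable
  filter_upwards [hχ, kernelOp_congr (ν := (volume : Measure (E d))) (κ := termKernel vhat ω)
    measurePreserving_termMap hχ, ae_kernelMass_lt_top hκ hS hφ h₁,
    ae_kernelMass_lt_top hκ hS hψ h₂] with x e6 e7 e8 e9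
  simp only [sectorOp, Pi.add_apply, Pi.smul_apply]
  rw [e6, e7, kernelOp_add_smul hκ hS hφ hψ z e8 e9]
  simp only [Pi.add_apply, Pi.smul_apply, smul_eq_mul]
  ring

theorem component_add_smul (φ ψ : Fock d M) (z : ℂ) (n : ℕ) :
    component (φ + z • ψ) n =ᵐ[volume] component φ n + z • component ψ n := by
  filter_upwards [component_add φ (z • ψ) n, component_smul z ψ n] with x e1 e2
  rw [e1, Pi.add_apply, Pi.add_apply, e2]

theorem fock_eq_add_smul {χ φ ψ : Fock d M} {z : ℂ} {f₁ f₂ f₃ : ∀ n, Config d M n → ℂ}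
    (h₁ : ∀ n, component χ n =ᵐ[volume] f₁ n) (h₂ : ∀ n, component φ n =ᵐ[volume] f₂ n)
    (h₃ : ∀ n, component ψ n =ᵐ[volume] f₃ n) (h : ∀ n, f₁ n =ᵐ[volume] f₂ n + z • f₃ n) :
    χ = φ + z • ψ := by
  refine fock_ext fun n => ?_
  filter_upwards [h₁ n, h₂ n, h₃ n, h n, component_add_smul φ ψ z n] with x e1 e2 e3 e4 e5
  rw [e1, e4, e5]
  simp only [Pi.add_apply, Pi.smul_apply, e2, e3]

theorem lintegral_diagMultiplier_sq_le {n : ℕ} {g c : ℝ} {vhat : E d → ℂ} {ω : E d → ℝ}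
    {m : Config d M n → ℝ}
    (hdiag : ∀ (ℓ : Fin M) (x : Config d M n),
      |∫ q, diagIntegrand vhat ω ℓ x q| ≤ c * (1 + |m x|)) (φ : Config d M n → ℂ) :
    ∫⁻ x, ‖(diagMultiplier g vhat ω x : ℂ) * φ x‖ₑ ^ 2 ≤ ENNReal.ofReal ((g ^ 2 * (M * c)) ^ 2) *
      ∫⁻ x, ENNReal.ofReal ((1 + |m x|) ^ 2) * ‖φ x‖ₑ ^ 2 := by
  have hdm : ∀ x : Config d M n, |diagMultiplier g vhat ω x| ≤ g ^ 2 * (M * c) * (1 + |m x|) := by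
    intro x
    rw [diagMultiplier, abs_mul, abs_neg, abs_of_nonneg (sq_nonneg g), mul_assoc, mul_assoc]
    refine mul_le_mul_of_nonneg_left ?_ (sq_nonneg g)
    refine (Finset.abs_sum_le_sum_abs _ _).trans
      ((Finset.sum_le_sum fun ℓ _ => hdiag ℓ x).trans (le_of_eq ?_))
    rw [Finset.sum_const, Finset.card_univ, Fintype.card_fin, nsmul_eq_mul]
  have hpt : ∀ x : Config d M n, ‖(diagMultiplier g vhat ω x : ℂ) * φ x‖ₑ ^ 2 ≤
      ENNReal.ofReal ((g ^ 2 * (M * c)) ^ 2) *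
        (ENNReal.ofReal ((1 + |m x|) ^ 2) * ‖φ x‖ₑ ^ 2) := by
    intro x
    have h1 : ‖((diagMultiplier g vhat ω x : ℝ) : ℂ)‖ₑ ^ 2 ≤
        ENNReal.ofReal ((g ^ 2 * (M * c)) ^ 2) * ENNReal.ofReal ((1 + |m x|) ^ 2) := by
      rw [← ofReal_norm, Complex.norm_real, Real.norm_eq_abs, ← ENNReal.ofReal_pow (abs_nonneg _),
        ← ENNReal.ofReal_mul (by positivity), ← mul_pow]
      exact ENNReal.ofReal_le_ofReal (pow_le_pow_left₀ (abs_nonneg _) (hdm x) 2)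
    rw [enorm_mul, mul_pow, ← mul_assoc]
    exact mul_le_mul_left h1 _
  rw [← lintegral_const_mul' _ _ ENNReal.ofReal_ne_top]
  exact lintegral_mono hpt

/-- The constants `B` and `C` do not depend on `n`, so summability of `r` passes to the squared
norms of the image. -/
theorem exists_sectorOp_vector (g : ℝ) {vhat : E d → ℂ} {ω : E d → ℝ} (hv : Measurable vhat)
    (hω : Measurable ω) {φ : Fock d M} {r : ℕ → ℝ} (hr0 : ∀ n, 0 ≤ r n) (hr : Summable r)
    {B C : ℝ} (hB : 0 ≤ B) (hC : 0 ≤ C)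
    (h₁ : ∀ n, ∫⁻ x, ‖(diagMultiplier g vhat ω x : ℂ) * component φ n x‖ₑ ^ 2 ≤
      ENNReal.ofReal B * ENNReal.ofReal (r n))
    (h₂ : ∀ n, ∫⁻ x, kernelMass volume (termKernel vhat ω) termMap (component φ n) x ^ 2 ≤
      ENNReal.ofReal C * ENNReal.ofReal (r n)) :
    ∃ χ : Fock d M, ∀ n, component χ n =ᵐ[volume] sectorOp g vhat ω (component φ n) := by
  have hs : Summable fun n => 2 * (B * r n + (g ^ 2) ^ 2 * (C * r n)) :=
    ((hr.mul_left _).add ((hr.mul_left _).mul_left _)).mul_left 2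
  have h0 : ∀ n, 0 ≤ 2 * (B * r n + (g ^ 2) ^ 2 * (C * r n)) := fun n => by
    have := hr0 n; positivity
  refine exists_fock_of_components
    (fun n => measurable_sectorOp g hv hω (measurable_component φ n))
    (fun n σ => sectorOp_permBosons g vhat ω σ (component_permBosons φ n σ)) h0 hs fun n => ?_
  have := hr0 n
  refine lintegral_sectorOp_sq_le g hv hω (measurable_component φ n) (by positivity)
    (by positivity) ?_ ?_
  · rw [ENNReal.ofReal_mul hB]
    exact h₁ n
  · rw [ENNReal.ofReal_mul hC]
    exact h₂ n

/-- A map that respects `φ + z • ψ` is linear. -/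
def linearMapOfAddSMul {V W : Type*} [AddCommGroup V] [Module ℂ V] [AddCommGroup W] [Module ℂ W]
    (T : V → W) (h : ∀ φ ψ (z : ℂ), T (φ + z • ψ) = T φ + z • T ψ) : V →ₗ[ℂ] W where
  toFun := T
  map_add' φ ψ := by simpa using h φ ψ 1
  map_smul' z φ := by
    have h0 : T 0 = 0 := by simpa using h 0 0 1
    simpa [h0] using h 0 φ z

theorem symmetricOn_of_map {g : ℝ} {vhat : E d → ℂ} {ω : E d → ℝ} {𝒟 : Submodule ℂ (Fock d M)}
    (hdense : Dense (𝒟 : Set (Fock d M))) (T : 𝒟 → Fock d M)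
    (hlin : ∀ (φ ψ : 𝒟) (z : ℂ), T (φ + z • ψ) = T φ + z • T ψ)
    (hT : ∀ (φ : 𝒟) (n : ℕ), ∀ᵐ x, TConverges vhat ω (component (φ : Fock d M) n) x ∧
      component (T φ) n x = Tdiag g vhat ω (component (φ : Fock d M) n) x +
        Toffdiag g vhat ω (component (φ : Fock d M) n) x)
    (hsymm : ∀ φ ψ : 𝒟, inner ℂ (T φ) (ψ : Fock d M) = inner ℂ (φ : Fock d M) (T ψ)) :
    TSymmetricOn g vhat ω 𝒟 :=
  ⟨hdense, ⟨𝒟, linearMapOfAddSMul T hlin⟩, rfl, hT, hsymm⟩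

/-- Abstract criterion: `T` is symmetric on the domain of a multiplier that dominates its diagonal
part pointwise and its off-diagonal part in the weighted `L²` sense. -/
theorem symmetricOn_multiplierDomain (g : ℝ) {vhat : E d → ℂ} {ω : E d → ℝ} (hv : Measurable vhat)
    (hω : Measurable ω) {m : ∀ n, Config d M n → ℝ} (hm : ∀ n, Measurable (m n))
    (hσ : ∀ n (σ : Equiv.Perm (Fin n)) x, m n (permBosons σ x) = m n x) {c C : ℝ}
    (hC : 0 ≤ C)
    (hdiag : ∀ n (ℓ : Fin M) (x : Config d M n), Integrable (diagIntegrand vhat ω ℓ x) ∧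
      |∫ q, diagIntegrand vhat ω ℓ x q| ≤ c * (1 + |m n x|))
    (hoff : ∀ n (φ : Config d M n → ℂ), Measurable φ →
      ∫⁻ x, kernelMass volume (termKernel vhat ω) termMap φ x ^ 2 ≤
        ENNReal.ofReal C * ∫⁻ x, ENNReal.ofReal ((1 + |m n x|) ^ 2) * ‖φ x‖ₑ ^ 2) :
    TSymmetricOn g vhat ω (multiplierDomain m : Submodule ℂ (Fock d M)) := by
  set B := (g ^ 2 * (M * c)) ^ 2 with hB
  have hB0 : 0 ≤ B := by positivity
  have hdsq := fun n => lintegral_diagMultiplier_sq_le (g := g) fun ℓ x => (hdiag n ℓ x).2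
  have hgraph : ∀ φ : (multiplierDomain m : Submodule ℂ (Fock d M)), ∃ η : Fock d M,
      ∀ n, ∫⁻ x, ENNReal.ofReal ((1 + |m n x|) ^ 2) * ‖component (φ : Fock d M) n x‖ₑ ^ 2 ≤
        ENNReal.ofReal (2 * (‖(φ : Fock d M) n‖ ^ 2 + ‖η n‖ ^ 2)) := by
    rintro ⟨φ, η, hη⟩
    exact ⟨η, lintegral_weight_sq_le hη⟩
  have hmass : ∀ (φ : (multiplierDomain m : Submodule ℂ (Fock d M))) (n : ℕ),
      ∫⁻ x, kernelMass volume (termKernel vhat ω) termMap (component (φ : Fock d M) n) x ^ 2 ≠ ⊤ := by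
    intro φ n
    obtain ⟨η, hη⟩ := hgraph φ
    refine ne_top_of_le_ne_top ?_ (hoff n _ (measurable_component _ n))
    exact ENNReal.mul_ne_top ENNReal.ofReal_ne_top (ne_top_of_le_ne_top ENNReal.ofReal_ne_top (hη n))
  have hdmem : ∀ (φ : (multiplierDomain m : Submodule ℂ (Fock d M))) (n : ℕ),
      MemLp (fun x => (diagMultiplier g vhat ω x : ℂ) * component (φ : Fock d M) n x) 2 volume := by
    intro φ n
    obtain ⟨η, hη⟩ := hgraph φ
    refine memLp_two_of_lintegral_sq ((Complex.measurable_ofReal.comp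
      (measurable_diagMultiplier g hv hω)).mul (measurable_component _ n))
      (ne_top_of_le_ne_top ?_ (hdsq n _))
    exact ENNReal.mul_ne_top ENNReal.ofReal_ne_top (ne_top_of_le_ne_top ENNReal.ofReal_ne_top (hη n))
  have hex : ∀ φ : (multiplierDomain m : Submodule ℂ (Fock d M)), ∃ χ : Fock d M,
      ∀ n, component χ n =ᵐ[volume] sectorOp g vhat ω (component (φ : Fock d M) n) := by
    intro φ
    obtain ⟨η, hη⟩ := hgraph φ
    exact exists_sectorOp_vector g hv hω (fun n => by positivity)
      (((summable_norm_sq (φ : Fock d M)).add (summable_norm_sq η)).mul_left 2) hB0 hC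
      (fun n => (hdsq n _).trans (mul_le_mul_right (hη n) _))
      (fun n => (hoff n _ (measurable_component _ n)).trans (mul_le_mul_right (hη n) _))
  -- Images chosen vector by vector are automatically linear, because the components determine a
  -- vector up to null sets.
  choose T hT using hex
  have hlin : ∀ (φ ψ : (multiplierDomain m : Submodule ℂ (Fock d M))) (z : ℂ),
      T (φ + z • ψ) = T φ + z • T ψ := by
    intro φ ψ z
    exact fock_eq_add_smul (hT (φ + z • ψ)) (hT φ) (hT ψ) fun n =>
      sectorOp_add_smul g hv hω (measurable_component (φ : Fock d M) n)
        (measurable_component (ψ : Fock d M) n)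
        (component_add_smul (φ : Fock d M) (ψ : Fock d M) z n) (hmass φ n) (hmass ψ n)
  refine symmetricOn_of_map (dense_multiplierDomain hm hσ) T hlin (fun φ n => ?_) fun φ ψ => ?_
  · filter_upwards [hT φ n, ae_sectorOp_eq g hv hω (measurable_component (φ : Fock d M) n)
      (component_permBosons _ n) (fun ℓ x => (hdiag n ℓ x).1) (hmass φ n)] with x e1 e2
    exact ⟨e2.1, e1.trans e2.2⟩
  · rw [lp.inner_eq_tsum, lp.inner_eq_tsum]
    refine tsum_congr fun n => ?_
    rw [inner_component, inner_component]
    have e1 : ∫ x, starRingEnd ℂ (component (T φ) n x) * component (ψ : Fock d M) n x =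
        ∫ x, starRingEnd ℂ (sectorOp g vhat ω (component (φ : Fock d M) n) x) *
          component (ψ : Fock d M) n x := by
      refine integral_congr_ae ?_
      filter_upwards [hT φ n] with x hx
      rw [hx]
    have e2 : ∫ x, starRingEnd ℂ (component (φ : Fock d M) n x) * component (T ψ) n x =
        ∫ x, starRingEnd ℂ (component (φ : Fock d M) n x) *
          sectorOp g vhat ω (component (ψ : Fock d M) n) x := by
      refine integral_congr_ae ?_
      filter_upwards [hT ψ n] with x hx
      rw [hx]
    rw [e1, e2]
    exact integral_sectorOp_symm g hv hω (measurable_component _ n) (measurable_component _ n)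
      (memLp_component _ n) (memLp_component _ n)
      (by rw [lintegral_component_sq]; exact ENNReal.ofReal_ne_top)
      (hdmem φ n) (hdmem ψ n) (hmass φ n) (hmass ψ n)

end Assembly

/-! ### Comparing the weights with the domain multipliers -/

section Main

variable {d M n : ℕ}

theorem one_add_rpow_le {L b : ℝ} (hL : 0 ≤ L) (hb : 0 ≤ b) :
    (1 + L) ^ b ≤ 2 ^ b * (1 + L ^ b) := by
  have hLb : 0 ≤ L ^ b := by positivity
  have h2 : (0 : ℝ) < 2 ^ b := by positivity
  rcases le_total L 1 with h | h
  · calc (1 + L) ^ b ≤ 2 ^ b := Real.rpow_le_rpow (by positivity) (by linarith) hb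
      _ ≤ _ := by nlinarith
  · calc (1 + L) ^ b ≤ (2 * L) ^ b := Real.rpow_le_rpow (by positivity) (by linarith) hb
      _ = 2 ^ b * L ^ b := Real.mul_rpow zero_le_two hL
      _ ≤ _ := by nlinarith

theorem natCast_le_freeSymbol {ω : E d → ℝ} (hω1 : ∀ k, 1 ≤ ω k) (x : Config d M n) :
    (n : ℝ) ≤ freeSymbol ω x := by
  refine le_trans ?_ (sum_omega_le_freeSymbol x)
  have := Finset.card_nsmul_le_sum Finset.univ (fun j => ω (x.2 j)) 1 fun j _ => hω1 _
  simpa using this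

/-- For `n ≥ 1` one has `L ≥ 1`, so `1 + L ≤ 2 L`. Small `L` occurs only for `n = 0`, where the
number factor is 1 and the added constant suffices. -/
theorem mul_one_add_rpow_le {a b L : ℝ} (hnL : (n : ℝ) ≤ L) (hb : 0 ≤ b) :
    ((n : ℝ) + 1) ^ a * (1 + L) ^ b ≤ 2 ^ b * (1 + ((n : ℝ) + 1) ^ a * L ^ b) := by
  have h2 : (0 : ℝ) < 2 ^ b := by positivity
  rcases Nat.eq_zero_or_pos n with rfl | hn
  · have hL : 0 ≤ L := by simpa using hnL
    simpa using one_add_rpow_le hL hb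
  · have hn1 : (1 : ℝ) ≤ n := by exact_mod_cast hn
    have hL : 1 ≤ L := hn1.trans hnL
    have h1 : (1 + L) ^ b ≤ 2 ^ b * L ^ b := by
      rw [← Real.mul_rpow zero_le_two (by linarith)]
      exact Real.rpow_le_rpow (by positivity) (by linarith) hb
    calc _ ≤ ((n : ℝ) + 1) ^ a * (2 ^ b * L ^ b) := by gcongr
      _ ≤ _ := by nlinarith

/-- Symmetry of `T` on the domain of a multiplier dominating the natural weights. -/
theorem symmetricOn_of_weight (hd : 0 < d) (M : ℕ) (g : ℝ) {vhat : E d → ℂ} {ω : E d → ℝ}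
    {α β D s u u2 e : ℝ}
    (hα : 0 ≤ α) (hβ : 0 ≤ β) (hβ2 : β ≤ 2) (hvm : Measurable vhat) (hωm : Measurable ω)
    (hv : ∀ k, k ≠ 0 → ‖vhat k‖ ≤ ‖k‖ ^ (-α))
    (hω : ∀ k, (1 + ‖k‖ ^ 2) ^ (β / 2) ≤ ω k) (hD : D = d - 2 * α - 2) (hD0 : 0 ≤ D) (hD1 : D < 1)
    (hs : 0 < s) (hu : u = β / 2 * s - D / 2) (hu2 : u2 = β / 2 * u - D / 2) (hu1 : u < 1)
    (hu2pos : 0 < u2) (he0 : 0 < e) (he1 : e < 1 / 2) (heD : D / 2 ≤ e)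
    {m : ∀ n, Config d M n → ℝ} (hm : ∀ n, Measurable (m n))
    (hσ : ∀ n (σ : Equiv.Perm (Fin n)) x, m n (permBosons σ x) = m n x) {K : ℝ}
    (h₁ : ∀ n (x : Config d M n), (1 + freeSymbol ω x) ^ e ≤ K * (1 + |m n x|))
    (h₂ : ∀ n (x : Config d M n),
      ((n : ℝ) + 1) ^ max 0 (1 - s) * (1 + freeSymbol ω x) ^ (s - u) ≤ K * (1 + |m n x|)) :
    TSymmetricOn g vhat ω (multiplierDomain m : Submodule ℂ (Fock d M)) := by
  have hω1 := one_le_omega hβ hω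
  obtain ⟨c, hc, hcb⟩ := exists_diag_bound hd hα hβ hvm hωm hv hω hD hD0 he0 he1 heD
  obtain ⟨C, hC, hCb⟩ := exists_kernelMass_bound hd M hα hβ hβ2 hvm hωm hv hω hD hD0 hD1 hs hu hu2
    hu1 hu2pos
  refine symmetricOn_multiplierDomain g hvm hωm hm hσ (c := c * K) (C := C * K ^ 2)
    (by positivity) (fun n ℓ x => ⟨(hcb ℓ x).1, ?_⟩) fun n φ hφ => ?_
  · refine (hcb ℓ x).2.trans ?_
    rw [mul_assoc]
    exact mul_le_mul_of_nonneg_left (h₁ n x) hc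
  · refine (hCb n φ hφ).trans ?_
    have hpt : ∀ x : Config d M n, ENNReal.ofReal
        ((((n : ℝ) + 1) ^ max 0 (1 - s) * (1 + freeSymbol ω x) ^ (s - u)) ^ 2) * ‖φ x‖ₑ ^ 2 ≤
        ENNReal.ofReal (K ^ 2) * (ENNReal.ofReal ((1 + |m n x|) ^ 2) * ‖φ x‖ₑ ^ 2) := by
      intro x
      have hL := freeSymbol_nonneg hω1 x
      rw [← mul_assoc, ← ENNReal.ofReal_mul (by positivity), ← mul_pow]
      exact mul_le_mul_left
        (ENNReal.ofReal_le_ofReal (pow_le_pow_left₀ (by positivity) (h₂ n x) 2)) _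
    rw [ENNReal.ofReal_mul hC, mul_assoc]
    refine mul_le_mul_right ?_ _
    rw [← lintegral_const_mul' _ _ ENNReal.ofReal_ne_top]
    exact lintegral_mono hpt

end Main

end IBC
end

theorem mainTheorem6 (d M : ℕ) (hd : d = 1 ∨ d = 2 ∨ d = 3) (g α β D : ℝ)
    (v : 𝓢'(IBC.E d, ℂ)) (vhat : IBC.E d → ℂ) (ω : IBC.E d → ℝ)
    (hcond : IBC.Admissible v vhat ω α β)
    (hDdef : D = d - 2 * α - 2) (hD : 0 ≤ D)
    (u : ℝ → ℝ) (hu : ∀ s, u s = β / 2 * s - D / 2) :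
    (D = 0 ∧ β = 2 → ∀ ε : ℝ, 0 < ε →
      IBC.TSymmetricOn g vhat ω (IBC.domainL d M ω ε)) ∧
    (0 < D ∨ β < 2 → ∀ s : ℝ, 0 < s → u s < 1 → 0 < u (u s) →
      IBC.TSymmetricOn g vhat ω (IBC.domainNL d M ω (max 0 (1 - s)) (s - u s))) := by
  obtain ⟨hvm, hωm, -, -, hv, hω, hα, -, hβ, hβ2, hcases⟩ := hcond
  have hd0 : 0 < d := by omega
  have hω1 := IBC.one_le_omega hβ hω
  -- For `d ≤ 2` this is immediate from `α ≥ 0`. For `d = 3`, `D = 1 - 2α`: case (1) makes it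
  -- negative, and in case (2) `β ≤ 2` gives `β²/(8+β²) < 1/2`, forcing `α > 0`.
  have hD1 : D < 1 := by
    rcases hd with rfl | rfl | rfl
    · push_cast at hDdef; linarith
    · push_cast at hDdef; linarith
    · push_cast at hDdef
      rcases hcases with h | ⟨-, -, h⟩
      · push_cast at h; linarith
      · have h3 := h rfl
        have : β ^ 2 / (8 + β ^ 2) < 1 / 2 := by
          rw [div_lt_div_iff₀ (by positivity) two_pos]
          nlinarith
        linarith
  refine ⟨?_, ?_⟩
  · rintro ⟨rfl, rfl⟩ ε hε
    -- Here `u` is the identity, so any `s` in `(0, 1)` is admissible. This one also has `1 - s ≤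
    -- ε`, which lets `(1+L)^ε` absorb the number weight; `1/2` keeps `s` positive for large `ε`.
    have hs0 : 0 < max (1 / 2) (1 - ε) := lt_of_lt_of_le (by norm_num) (le_max_left _ _)
    have hs1 : max (1 / 2) (1 - ε) < 1 := max_lt (by norm_num) (by linarith)
    have hsε : 1 - ε ≤ max (1 / 2) (1 - ε) := le_max_right _ _
    set s := max (1 / 2) (1 - ε) with hs
    refine IBC.symmetricOn_of_weight hd0 M g (s := s) (u := s) (u2 := s) (e := min ε (1 / 4))
      hα hβ hβ2 hvm hωm hv hω hDdef hD hD1 hs0 (by ring) (by ring) hs1 hs0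
      (by positivity) ((min_le_right _ _).trans_lt (by norm_num)) (by rw [zero_div]; positivity)
      (fun n => (IBC.measurable_freeSymbol hωm).pow_const ε)
      (fun n σ x => by rw [IBC.freeSymbol_permBosons]) (K := 2 ^ ε)
      (fun n x => ?_) (fun n x => ?_)
    · have hL := IBC.freeSymbol_nonneg hω1 x
      rw [abs_of_nonneg (by positivity)]
      refine le_trans ?_ (IBC.one_add_rpow_le hL hε.le)
      exact Real.rpow_le_rpow_of_exponent_le (by linarith) (min_le_left _ _)
    · have hL := IBC.freeSymbol_nonneg hω1 x
      have hn := IBC.natCast_le_freeSymbol hω1 x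
      rw [abs_of_nonneg (by positivity), sub_self, Real.rpow_zero, mul_one,
        max_eq_right (by linarith)]
      refine le_trans ?_ (IBC.one_add_rpow_le hL hε.le)
      calc ((n : ℝ) + 1) ^ (1 - s) ≤ (1 + IBC.freeSymbol ω x) ^ (1 - s) :=
            Real.rpow_le_rpow (by positivity) (by linarith) (by linarith)
        _ ≤ _ := Real.rpow_le_rpow_of_exponent_le (by linarith) (by linarith)
  · intro hor s hs hus huus
    -- `s - u s = (1 - β/2) s + D/2`: with `s > 0`, `β ≤ 2` and `D ≥ 0`, it is positive exactly when
    -- `D > 0` or `β < 2`.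
    have hb0 : 0 < s - u s := by
      rw [hu s]
      rcases hor with h | h <;> nlinarith
    have hbD : D / 2 ≤ s - u s := by
      rw [hu s]
      nlinarith
    have hD2 : D / 2 < 1 / 2 := by linarith
    set b := s - u s with hb
    -- The diagonal exponent must lie in `[D/2, 1/2)`, be positive even if `D = 0`, and not exceed
    -- the power `b` available in the domain.
    set e := max (D / 2) (min b (1 / 4)) with he
    have he0 : 0 < e := lt_of_lt_of_le (by positivity) (le_max_right _ _)
    have he1 : e < 1 / 2 := max_lt hD2 ((min_le_right _ _).trans_lt (by norm_num))
    have heb : e ≤ b := max_le hbD (min_le_left _ _)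
    refine IBC.symmetricOn_of_weight hd0 M g (s := s) (u := u s) (u2 := u (u s)) (e := e)
      hα hβ hβ2 hvm hωm hv hω hDdef hD hD1 hs (hu s) (hu (u s)) hus huus he0 he1 (le_max_left _ _)
      (fun n => ((IBC.measurable_freeSymbol hωm).pow_const b).const_mul _)
      (fun n σ x => by rw [IBC.freeSymbol_permBosons]) (K := 2 ^ b)
      (fun n x => ?_) (fun n x => ?_)
    · have hL := IBC.freeSymbol_nonneg hω1 x
      have hn := IBC.natCast_le_freeSymbol hω1 x
      rw [abs_of_nonneg (by positivity)]
      refine le_trans ?_ (IBC.mul_one_add_rpow_le hn hb0.le)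
      have h1 : (1 : ℝ) ≤ ((n : ℝ) + 1) ^ max 0 (1 - s) :=
        Real.one_le_rpow (by linarith [Nat.cast_nonneg (α := ℝ) n]) (le_max_left _ _)
      calc _ ≤ (1 + IBC.freeSymbol ω x) ^ b :=
            Real.rpow_le_rpow_of_exponent_le (by linarith) heb
        _ ≤ _ := le_mul_of_one_le_left (by positivity) h1
    · have hL := IBC.freeSymbol_nonneg hω1 x
      have hn := IBC.natCast_le_freeSymbol hω1 x
      rw [abs_of_nonneg (by positivity)]
      exact IBC.mul_one_add_rpow_le hn hb0.le
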